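/- Let $S^1\subset\mathbb{R}^2$ be the unit circle, $\sigma$ its arc length measure, and $X=\frac{d}{d\theta}$ the vector field on $S^1$ that generates the rotations; write $\exp(tX)$ for the rotation by $t$ radians. For a real number $s>0$ that is not an integer write $s=k+\alpha$ with $k\in\mathbb{Z}_{\ge 0}$ and $\alpha\in(0,1)$, and let $\mathcal{H}^s=\mathcal{H}^s(S^1)$ be the set of all $f\in L^2(S^1,\sigma;\mathbb{C})$ whose distributional derivatives $X^m f$, $0\le m\le k$, belong to $L^2(S^1)$ and satisfy $$\sup_{0<|t|\le 1}\frac{\|(X^m f)\circ\exp(tX)-X^m f\|_{L^2(S^1)}}{|t|^{\alpha}}<\infty\qquad(0\le m\le k).$$ For $f\in L^2(S^1)$ let $f\sigma*f\sigma*f\sigma*f\sigma*f\sigma$ be the convolution on $\mathbb{R}^2$ of five copies of the complex measure $f\sigma$. The restriction to $S^1$ of a complex measure $\nu$ on $\mathbb{R}^2$ is the function $F\in L^2(S^1)$, if there is one, such that the averages $x\mapsto \nu(B(x,r))/|B(x,r)|$ converge to $F$ in $L^2(S^1)$ as $r\to 0^+$. **Lemma.** For every $\varepsilon>0$ there exists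 $\delta>0$ such that for every $s\in[\varepsilon,\infty)\setminus\mathbb{Z}$ and every $f\in\mathcal{H}^s(S^1)$ the restriction $$f\sigma*f\sigma*f\sigma*f\sigma*f\sigma\,\big|_{S^1}$$ exists and belongs to $\mathcal{H}^t(S^1)$ for all $t\in[0,s+\delta]\setminus\mathbb{Z}$. -/

import Mathlib

open MeasureTheory Filter Set
open scoped Topology

namespace CircleConv

/-- The Borel `σ`-algebra on the unit circle. -/
noncomputable instance instMeasurableSpaceCircle : MeasurableSpace Circle := borel Circle

instance instBorelSpaceCircle : BorelSpace Circle := ⟨rfl⟩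

/-- Arc length measure `σ` on the unit circle `S¹ ⊆ ℝ² = ℂ` (total mass `2π`). -/
noncomputable def arc : Measure Circle :=
  (volume.restrict (Ioc (-Real.pi) Real.pi)).map Circle.exp

/-- Smooth complex valued functions on the circle; `Circle.exp` is the angular parametrization. -/
def IsSmooth (φ : Circle → ℂ) : Prop :=
  ContDiff ℝ (⊤ : ℕ∞) (fun θ : ℝ => φ (Circle.exp θ))

/-- The derivative `Xφ` of `φ` along the vector field `X` that generates the rotations
`exp(tX) x = e^{it} x`. -/
noncomputable def rotDeriv (φ : Circle → ℂ) (x : Circle) : ℂ :=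
  deriv (fun t : ℝ => φ (Circle.exp t * x)) 0

/-- `Xf = g` in the sense of distributions on the circle (used for `f, g ∈ L²`). -/
def HasWeakRotDeriv (f g : Circle → ℂ) : Prop :=
  ∀ φ : Circle → ℂ, IsSmooth φ →
    ∫ x, f x * rotDeriv φ x ∂arc = - ∫ x, g x * φ x ∂arc

/-- The seminorm `sup_{0 < |t| ≤ 1} ‖g ∘ exp(tX) - g‖_{L²} / |t|^α` is finite. -/
def L2Holder (α : ℝ) (g : Circle → ℂ) : Prop :=
  ∃ C : ℝ, ∀ t : ℝ, 0 < |t| → |t| ≤ 1 →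
    eLpNorm (fun x => g (Circle.exp t * x) - g x) 2 arc ≤ ENNReal.ofReal (C * |t| ^ α)

/-- The space `𝓗^s(S¹)` for `s = k + α ≥ 0`, `k = ⌊s⌋`: the weak derivatives `X^m f`, `0 ≤ m ≤ k`,
exist in `L²` and each of them is `L²`-Hölder continuous of order `α` along rotations.
Here `D m` is `X^m f`. -/
def MemH (s : ℝ) (f : Circle → ℂ) : Prop :=
  ∃ D : ℕ → Circle → ℂ, D 0 = f ∧
    (∀ m ≤ ⌊s⌋₊, MemLp (D m) 2 arc) ∧
    (∀ m < ⌊s⌋₊, HasWeakRotDeriv (D m) (D (m + 1))) ∧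
    (∀ m ≤ ⌊s⌋₊, L2Holder (s - ⌊s⌋₊) (D m))

/-- The convolution `fσ ∗ fσ ∗ fσ ∗ fσ ∗ fσ` of five copies of the complex measure `fσ` on the plane:
the image of the product measure `(fσ)^{⊗5}` under addition. -/
noncomputable def conv5 (f : Circle → ℂ) : ComplexMeasure ℂ :=
  ((Measure.pi fun _ : Fin 5 => arc).withDensityᵥ (fun ω => ∏ i, f (ω i))).map
    (fun ω => ∑ i, (ω i : ℂ))

/-- `g ∈ L²(S¹)` is the restriction (trace) to the circle of the complex measure `ν` on the plane:
the averages `ν(B(x,r)) / |B(x,r)|` converge to `g` in `L²(S¹)` as `r → 0`. If `ν` has a continuous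
density then `g` is the restriction of that density. -/
def IsCircleRestriction (ν : ComplexMeasure ℂ) (g : Circle → ℂ) : Prop :=
  MemLp g 2 arc ∧
    Tendsto (fun r : ℝ =>
      eLpNorm (fun x : Circle =>
        ν (Metric.ball (x : ℂ) r) / ((volume.real (Metric.ball (x : ℂ) r) : ℝ) : ℂ) - g x) 2 arc)
      (𝓝[>] 0) (𝓝 0)

end CircleConv

namespace CircleConv

open scoped ENNReal

/-! ### Arc length -/

/-! Expand `f` in characters. The convolution of the five measures `z ^ ν i dσ` has a continuous
density, because its Fourier transform is a product of five factors of size `|ξ|^(-1/2)`, integrable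
on the plane. By rotation invariance this density restricts to the circle as `kern ν` times the
character of order `∑ ν i`. The restriction of the fivefold convolution is therefore a five-linear
form with multiplier `kern`, and two estimates for it carry the proof.

The first is boundedness on `L²` up to `N ^ η` for inputs of degree at most `N`, with `η`
arbitrarily small (`exists_norm_fiveSum_kern_le`). It comes from the averages over discs of radius
`r`. By Cauchy–Schwarz their `L²` norm reduces to a uniform bound for `σ * σ * σ` on discs, which is
a planar estimate on how often `‖w + a + z‖` is near `1`, and only `r ^ (-κ)` is lost. Since the
densities of characters are Hölder continuous with polynomial constants, taking `r` a negative power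
of `N` replaces the averages by the form itself.

The second is a gain when one input has frequencies at least `M` and the other four at most `L`: the
form is `O(M ^ (-1/10) * L ^ 8)` (`exists_norm_fiveSum_kern_gain`). This rests on decay of the
transform of `z ^ n dσ` in `n` and `ξ` jointly (`exists_norm_circFT_le_mixed`). The high input is
kept in `ℓ²` by orthogonality of the output characters.

When the truncation degree doubles from `M`, each contribution to the increment contains an input of
frequency at least `M`, worth `M ^ (-s)`. With `L` a small power of `M`, either all other inputs lie
below `L` and the second estimate gains, or another input lies above `L` and its factor `L ^ (-s)`
outweighs `N ^ η`. So the increments decay like `M ^ (-(s + cε))`. Their limit has Sobolev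
regularity of every order below `s + cε`, and it is the `L²` limit of the averages. Passing from
`𝓗^s` to Sobolev weights costs an arbitrarily small amount of regularity, which the gain absorbs;
the passage back costs nothing. -/

instance fact_two_pi_pos : Fact (0 < 2 * Real.pi) := ⟨Real.two_pi_pos⟩

lemma toCircle_coe_eq_exp (θ : ℝ) :
    AddCircle.toCircle (θ : AddCircle (2 * Real.pi)) = Circle.exp θ := by
  rw [AddCircle.toCircle_apply_mk]
  congr 1
  field_simp

lemma measurePreserving_exp :
    MeasurePreserving Circle.exp (volume.restrict (Ioc (-Real.pi) Real.pi)) arc :=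
  ⟨Circle.exp.continuous.measurable, rfl⟩

/-- Identifies arc length with the volume of `AddCircle (2π)`, from which rotation invariance and
the completeness of the characters are transported. -/
lemma measurePreserving_toCircle :
    MeasurePreserving (AddCircle.toCircle : AddCircle (2 * Real.pi) → Circle) volume arc := by
  refine ⟨AddCircle.continuous_toCircle.measurable, ?_⟩
  have h := (AddCircle.measurePreserving_mk (2 * Real.pi) (-Real.pi)).map_eq
  rw [← h, Measure.map_map AddCircle.continuous_toCircle.measurable
    (AddCircle.measurePreserving_mk (2 * Real.pi) (-Real.pi)).measurable, arc]
  congr 1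
  · ext θ
    simp [toCircle_coe_eq_exp]
  · congr 2
    ring

instance isFiniteMeasure_arc : IsFiniteMeasure arc := by
  rw [arc]
  infer_instance

lemma arc_univ : arc univ = ENNReal.ofReal (2 * Real.pi) := by
  rw [← measurePreserving_exp.measure_preimage MeasurableSet.univ.nullMeasurableSet]
  simp only [preimage_univ, Measure.restrict_apply_univ, Real.volume_Ioc]
  congr 1
  ring

instance isMulLeftInvariant_arc : arc.IsMulLeftInvariant := by
  refine ⟨fun g => ?_⟩
  obtain ⟨a, rfl⟩ : ∃ a : AddCircle (2 * Real.pi), AddCircle.toCircle a = g :=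
    ⟨(Complex.arg (g : ℂ) : ℝ), by rw [toCircle_coe_eq_exp, Circle.exp_arg]⟩
  have h := measurePreserving_toCircle.map_eq
  have hm : Measurable (AddCircle.toCircle : AddCircle (2 * Real.pi) → Circle) :=
    measurePreserving_toCircle.measurable
  rw [← h, Measure.map_map (measurable_const_mul _) hm]
  have : ((fun x => AddCircle.toCircle a * x) ∘ AddCircle.toCircle)
      = AddCircle.toCircle ∘ fun x : AddCircle (2 * Real.pi) => a + x := by
    ext x
    simp [AddCircle.toCircle_add]
  rw [this, ← Measure.map_map hm (measurable_const_add a), map_add_left_eq_self]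

lemma lintegral_arc (f : Circle → ℝ≥0∞) (hf : Measurable f) :
    ∫⁻ x, f x ∂arc = ∫⁻ θ in Ioc (-Real.pi) Real.pi, f (Circle.exp θ) := by
  rw [measurePreserving_exp.lintegral_comp hf]

lemma integral_arc (f : Circle → ℂ) (hf : Continuous f) :
    ∫ x, f x ∂arc = ∫ θ in (-Real.pi)..Real.pi, f (Circle.exp θ) := by
  rw [intervalIntegral.integral_of_le (by linarith [Real.pi_pos]), arc,
    integral_map Circle.exp.continuous.aemeasurable hf.aestronglyMeasurable]

/-! ### Chords -/

lemma norm_exp_sub_one (θ : ℝ) : ‖(Circle.exp θ : ℂ) - 1‖ = 2 * |Real.sin (θ / 2)| := by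
  rw [Circle.coe_exp]
  have := Complex.norm_exp_I_mul_ofReal_sub_one θ
  rw [mul_comm] at this
  rw [this, norm_mul]
  simp

lemma abs_le_norm_exp_sub_one {θ : ℝ} (h : |θ| ≤ Real.pi) :
    (2 / Real.pi) * |θ| ≤ ‖(Circle.exp θ : ℂ) - 1‖ := by
  rw [norm_exp_sub_one]
  have h1 := Real.mul_abs_le_abs_sin (x := θ / 2) (by rw [abs_div, abs_two]; linarith)
  rw [abs_div, abs_two] at h1
  linarith

lemma norm_coe_sub_eq (x y : Circle) : ‖(x : ℂ) - y‖ = ‖((y⁻¹ * x : Circle) : ℂ) - 1‖ := by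
  have : (x : ℂ) - y = y * (((y⁻¹ * x : Circle) : ℂ) - 1) := by
    rw [mul_sub, ← Circle.coe_mul]
    simp
  rw [this, norm_mul, Circle.norm_coe, one_mul]

lemma lintegral_norm_sub_eq (φ : ℝ → ℝ≥0∞) (hφ : Measurable φ) (p : Circle) :
    ∫⁻ z, φ ‖(z : ℂ) - p‖ ∂arc = ∫⁻ θ in Ioc (-Real.pi) Real.pi, φ ‖(Circle.exp θ : ℂ) - 1‖ := by
  rw [← lintegral_arc (fun z => φ ‖(z : ℂ) - 1‖) (by fun_prop)]
  rw [← lintegral_mul_left_eq_self (μ := arc) (fun z => φ ‖(z : ℂ) - 1‖) p⁻¹]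
  simp_rw [norm_coe_sub_eq _ p]

/-- After rotating `p` to `1`, the inequality `|e^{iθ} - 1| ≥ (2/π)|θ|` confines `θ` to an interval
of length `πt`. -/
lemma arc_chord_le (p : Circle) (t : ℝ) :
    arc {z : Circle | ‖(z : ℂ) - p‖ < t} ≤ ENNReal.ofReal (Real.pi * t) := by
  have hm : MeasurableSet {z : Circle | ‖(z : ℂ) - p‖ < t} :=
    measurableSet_lt (by fun_prop) measurable_const
  rw [← lintegral_indicator_one hm]
  have := lintegral_norm_sub_eq ((Iio t).indicator 1)
    (measurable_one.indicator measurableSet_Iio) p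
  have h2 : ∀ z : Circle, ({z : Circle | ‖(z : ℂ) - p‖ < t}.indicator (1 : Circle → ℝ≥0∞)) z
      = (Iio t).indicator (1 : ℝ → ℝ≥0∞) ‖(z : ℂ) - p‖ := fun z => rfl
  simp_rw [h2]
  rw [this]
  have h3 : ∫⁻ θ in Ioc (-Real.pi) Real.pi, (Iio t).indicator 1 ‖(Circle.exp θ : ℂ) - 1‖
      ≤ ∫⁻ θ : ℝ, (Ioo (-(Real.pi * t / 2)) (Real.pi * t / 2)).indicator (1 : ℝ → ℝ≥0∞) θ := by
    refine (setLIntegral_mono' (μ := volume) measurableSet_Ioc (g := fun θ => (Ioo (-(Real.pi * t / 2)) (Real.pi * t / 2)).indicator (1 : ℝ → ℝ≥0∞) θ) fun θ hθ => ?_).trans (setLIntegral_le_lintegral _ _)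
    by_cases hc : ‖(Circle.exp θ : ℂ) - 1‖ < t
    · have h4 := abs_le_norm_exp_sub_one (θ := θ) (abs_le.2 ⟨hθ.1.le, hθ.2⟩)
      have h5 : |θ| < Real.pi * t / 2 := by
        have := h4.trans_lt hc
        rw [div_mul_eq_mul_div, div_lt_iff₀ Real.pi_pos] at this
        linarith
      rw [indicator_of_mem (show θ ∈ Ioo _ _ from abs_lt.1 h5)]
      exact indicator_le_self' (fun _ _ => zero_le) _
    · rw [indicator_of_notMem (by exact hc)]
      exact zero_le
  refine h3.trans ?_
  rw [lintegral_indicator_one measurableSet_Ioo, Real.volume_Ioo]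
  apply le_of_eq
  congr 1
  ring

/-- A centre off the circle is replaced by any circle point `q` in the set, at the price of doubling
the radius. -/
lemma arc_norm_sub_lt_le (p : ℂ) (t : ℝ) :
    arc {z : Circle | ‖(z : ℂ) - p‖ < t} ≤ ENNReal.ofReal (2 * Real.pi * t) := by
  rcases eq_empty_or_nonempty {z : Circle | ‖(z : ℂ) - p‖ < t} with h | ⟨q, hq⟩
  · rw [h]
    simp
  · refine (measure_mono fun z hz => ?_).trans
      ((arc_chord_le q (2 * t)).trans (le_of_eq (by congr 1; ring)))
    have : ‖(z : ℂ) - q‖ ≤ ‖(z : ℂ) - p‖ + ‖(q : ℂ) - p‖ := by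
      rw [← norm_neg ((q : ℂ) - p)]
      refine (le_of_eq ?_).trans (norm_add_le _ _)
      congr 1
      ring
    simp only [mem_ofPred_eq] at *
    linarith

/-- Negative powers of the chord length have bounded integrals. -/
lemma exists_lintegral_chord_rpow_le {τ : ℝ} (hτ : τ < 1) (hτ0 : 0 ≤ τ) :
    ∃ C : ℝ, 0 < C ∧ ∀ p : Circle,
      ∫⁻ z, (ENNReal.ofReal ‖(z : ℂ) - p‖) ^ (-τ) ∂arc ≤ ENNReal.ofReal C := by
  have hint : ∫⁻ θ in Ioc (-Real.pi) Real.pi, (ENNReal.ofReal ‖(Circle.exp θ : ℂ) - 1‖) ^ (-τ) < ∞ := by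
    have hI : IntervalIntegrable (fun θ : ℝ => ((2 / Real.pi) * |θ|) ^ (-τ)) volume
        (-Real.pi) Real.pi := by
      have h0 : IntervalIntegrable (fun θ : ℝ => ((2 / Real.pi) * |θ|) ^ (-τ)) volume
        0 Real.pi := by
        have h := (intervalIntegral.intervalIntegrable_rpow' (a := 0) (b := Real.pi)
          (r := -τ) (by linarith)).const_mul ((2 / Real.pi) ^ (-τ))
        refine h.congr ?_
        intro θ hθ
        rw [uIoc_of_le Real.pi_pos.le] at hθ
        simp only
        rw [abs_of_pos hθ.1, Real.mul_rpow (by positivity) hθ.1.le]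
      have h1 := h0.comp_sub_left 0
      simp only [zero_sub, abs_neg, sub_self] at h1
      exact h1.symm.trans h0
    rw [intervalIntegrable_iff_integrableOn_Ioc_of_le (by linarith [Real.pi_pos])] at hI
    refine lt_of_le_of_lt ?_ hI.lintegral_lt_top
    refine lintegral_mono_ae ?_
    -- At `θ = 0` and `τ > 0` the extended power is `∞` while the real power is `0`, so this point
    -- has to be discarded.
    have hne : ∀ᵐ θ : ℝ ∂(volume.restrict (Ioc (-Real.pi) Real.pi)), θ ≠ 0 := by
      refine ae_restrict_of_ae ?_
      simp [ae_iff]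
    filter_upwards [hne, ae_restrict_mem measurableSet_Ioc] with θ h0 hθ
    have hpos : 0 < (2 / Real.pi) * |θ| := by
      have := Real.pi_pos
      positivity
    rw [← ENNReal.ofReal_rpow_of_pos hpos, ENNReal.rpow_neg, ENNReal.rpow_neg]
    refine ENNReal.inv_le_inv.2 (ENNReal.rpow_le_rpow (ENNReal.ofReal_le_ofReal ?_) hτ0)
    exact abs_le_norm_exp_sub_one (abs_le.2 ⟨hθ.1.le, hθ.2⟩)
  refine ⟨(∫⁻ θ in Ioc (-Real.pi) Real.pi,
    (ENNReal.ofReal ‖(Circle.exp θ : ℂ) - 1‖) ^ (-τ)).toReal + 1, by positivity, fun p => ?_⟩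
  rw [lintegral_norm_sub_eq (fun t => (ENNReal.ofReal t) ^ (-τ)) (by fun_prop) p]
  rw [ENNReal.ofReal_add ENNReal.toReal_nonneg zero_le_one, ENNReal.ofReal_toReal hint.ne]
  exact le_self_add

/-! ### Sublevel sets of `z ↦ ‖v + z‖ - 1` on the circle -/

lemma normSq_re_im (z : Circle) : (z : ℂ).re ^ 2 + (z : ℂ).im ^ 2 = 1 := by
  have := Circle.normSq_coe z
  rw [Complex.normSq_apply] at this
  linarith

lemma norm_sq_eq (v : ℂ) : ‖v‖ ^ 2 = v.re ^ 2 + v.im ^ 2 := by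
  rw [← Complex.normSq_eq_norm_sq, Complex.normSq_apply]
  ring

/-- `z₀` and its conjugate are the circle points with real part `Re z₀`. On the circle `z² + 1 = 2z
Re z`, so `(z - z₀)(z - z̄₀) = 2z(Re z - Re z₀)`. -/
lemma norm_sub_mul_norm_sub_inv (z z₀ : Circle) :
    ‖(z : ℂ) - z₀‖ * ‖(z : ℂ) - (z₀⁻¹ : Circle)‖ = 2 * |(z : ℂ).re - (z₀ : ℂ).re| := by
  rw [← norm_mul]
  have : ((z : ℂ) - z₀) * ((z : ℂ) - (z₀⁻¹ : Circle))
      = z * ((2 * ((z : ℂ).re - (z₀ : ℂ).re) : ℝ) : ℂ) := by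
    rw [Circle.coe_inv_eq_conj]
    have h1 := normSq_re_im z
    have h2 := normSq_re_im z₀
    apply Complex.ext
    · simp
      linear_combination h2 - h1
    · simp
      ring
  rw [this, norm_mul, Circle.norm_coe, one_mul, Complex.norm_real, Real.norm_eq_abs, abs_mul,
    abs_two]

lemma exists_circle_re_eq {c : ℝ} (h : |c| ≤ 1) : ∃ z : Circle, (z : ℂ).re = c := by
  refine ⟨Circle.exp (Real.arccos c), ?_⟩
  rw [Circle.coe_exp, Complex.exp_ofReal_mul_I_re, Real.cos_arccos (abs_le.1 h).1 (abs_le.1 h).2]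

lemma abs_re_circle_le (z : Circle) : |(z : ℂ).re| ≤ 1 :=
  (Complex.abs_re_le_norm _).trans (Circle.norm_coe z).le

lemma norm_circle_sub_one_sq (z : Circle) : ‖(z : ℂ) - 1‖ ^ 2 = 2 * (1 - (z : ℂ).re) := by
  have := normSq_re_im z
  rw [norm_sq_eq]
  simp
  linarith

/-- The circle point `-1`. -/
noncomputable def negOne : Circle := Circle.exp Real.pi

lemma coe_negOne : (negOne : ℂ) = -1 := by
  rw [negOne, Circle.coe_exp, Complex.exp_pi_mul_I]

lemma norm_circle_sub_negOne_sq (z : Circle) :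
    ‖(z : ℂ) - negOne‖ ^ 2 = 2 * (1 + (z : ℂ).re) := by
  have := normSq_re_im z
  rw [norm_sq_eq, coe_negOne]
  simp
  linarith

/-- For `|A| > 1` there is no circle point with real part `A`; the nearer of `1` and `-1`, counted
twice, takes over. -/
lemma exists_norm_sub_mul_norm_sub_le (A : ℝ) :
    ∃ z₁ z₂ : Circle, ∀ z : Circle, ‖(z : ℂ) - z₁‖ * ‖(z : ℂ) - z₂‖ ≤ 2 * |(z : ℂ).re - A| := by
  rcases le_or_gt |A| 1 with h | h
  · obtain ⟨z₀, h₀⟩ := exists_circle_re_eq h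
    exact ⟨z₀, z₀⁻¹, fun z => by rw [norm_sub_mul_norm_sub_inv, h₀]⟩
  · rcases lt_abs.1 h with h | h
    · refine ⟨1, 1, fun z => ?_⟩
      rw [← sq, Circle.coe_one, norm_circle_sub_one_sq]
      have := neg_le_abs ((z : ℂ).re - A)
      linarith
    · refine ⟨negOne, negOne, fun z => ?_⟩
      rw [← sq, norm_circle_sub_negOne_sq]
      have := le_abs_self ((z : ℂ).re - A)
      linarith

/-- For `B < 1` the two circle points of real part `-B` are at least `2√(1 - B)` apart, so `z` is
far from one of them and must be within `2η/√(1 - B)` of the other. For `B > 1` a nonempty set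
forces `B - 1 < η` and lies within `√(2η)` of `-1`, which is small enough because `B - 1 < η`. -/
lemma arc_abs_re_add_lt_le {B η : ℝ} (hB : 0 ≤ B) (hB1 : B ≠ 1) (hη : 0 < η) :
    arc {z : Circle | |(z : ℂ).re + B| < η} ≤ ENNReal.ofReal (4 * Real.pi * η / √|1 - B|) := by
  rcases lt_or_gt_of_ne hB1 with h | h
  · obtain ⟨z₀, h₀⟩ := exists_circle_re_eq (c := -B) (by rw [abs_neg, abs_of_nonneg hB]; exact h.le)
    have hs : 0 < √|1 - B| := Real.sqrt_pos.2 (abs_pos.2 (by linarith))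
    set t := 2 * η / √|1 - B| with ht
    have hsub : {z : Circle | |(z : ℂ).re + B| < η} ⊆
        {z : Circle | ‖(z : ℂ) - z₀‖ < t} ∪ {z : Circle | ‖(z : ℂ) - (z₀⁻¹ : Circle)‖ < t} := by
      intro z hz
      simp only [mem_ofPred_eq, mem_union] at hz ⊢
      by_contra! hcon
      have h1 := norm_sub_mul_norm_sub_inv z z₀
      rw [h₀, sub_neg_eq_add] at h1
      have h2 : 2 * √|1 - B| ≤ ‖(z : ℂ) - z₀‖ + ‖(z : ℂ) - (z₀⁻¹ : Circle)‖ := by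
        have h3 : ‖(z₀ : ℂ) - (z₀⁻¹ : Circle)‖ ≤ ‖(z : ℂ) - z₀‖ + ‖(z : ℂ) - (z₀⁻¹ : Circle)‖ := by
          rw [← norm_neg ((z : ℂ) - z₀), neg_sub]
          refine (le_of_eq ?_).trans (norm_add_le _ _)
          congr 1
          ring
        refine le_trans ?_ h3
        have h4 : ‖(z₀ : ℂ) - (z₀⁻¹ : Circle)‖ = 2 * |(z₀ : ℂ).im| := by
          rw [Circle.coe_inv_eq_conj, Complex.sub_conj]
          simp
        rw [h4]
        have h5 := normSq_re_im z₀
        rw [h₀] at h5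
        have h6 : √|1 - B| ≤ |(z₀ : ℂ).im| := by
          rw [← Real.sqrt_sq_eq_abs (z₀ : ℂ).im]
          apply Real.sqrt_le_sqrt
          rw [abs_of_pos (by linarith)]
          nlinarith
        linarith
      have h7 : t * √|1 - B| = 2 * η := by
        rw [ht]
        field_simp
      have h8 : t * √|1 - B| ≤ ‖(z : ℂ) - z₀‖ * ‖(z : ℂ) - (z₀⁻¹ : Circle)‖ := by
        have htp : 0 ≤ t := by positivity
        rcases le_total ‖(z : ℂ) - z₀‖ ‖(z : ℂ) - (z₀⁻¹ : Circle)‖ with h9 | h9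
        · exact mul_le_mul hcon.1 (by linarith) hs.le (norm_nonneg _)
        · rw [mul_comm ‖(z : ℂ) - z₀‖]
          exact mul_le_mul hcon.2 (by linarith) hs.le (norm_nonneg _)
      linarith
    refine (measure_mono hsub).trans ((measure_union_le _ _).trans ?_)
    refine (add_le_add (arc_chord_le _ _) (arc_chord_le _ _)).trans ?_
    have : 0 ≤ Real.pi * t := by
      have := Real.pi_pos
      positivity
    rw [← ENNReal.ofReal_add this this]
    apply le_of_eq
    congr 1
    rw [ht]
    ring
  · rcases eq_empty_or_nonempty {z : Circle | |(z : ℂ).re + B| < η} with he | ⟨q, hq⟩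
    · rw [he]
      simp
    · rw [mem_ofPred_eq] at hq
      have hBη : B - 1 < η := by
        have h1 := (abs_lt.1 hq).2
        have h2 := (abs_le.1 (abs_re_circle_le q)).1
        linarith
      have hsub : {z : Circle | |(z : ℂ).re + B| < η} ⊆
          {z : Circle | ‖(z : ℂ) - negOne‖ < √(2 * η)} := by
        intro z hz
        simp only [mem_ofPred_eq] at hz ⊢
        apply Real.lt_sqrt_of_sq_lt
        rw [norm_circle_sub_negOne_sq]
        have h1 := (abs_lt.1 hz).2
        linarith
      refine (measure_mono hsub).trans ((arc_chord_le _ _).trans (ENNReal.ofReal_le_ofReal ?_))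
      have hpos : 0 < B - 1 := by linarith
      rw [abs_sub_comm, abs_of_pos hpos, mul_assoc, mul_comm 4, mul_assoc, mul_div_assoc]
      refine mul_le_mul_of_nonneg_left ?_ Real.pi_pos.le
      rw [le_div_iff₀ (Real.sqrt_pos.2 hpos), ← Real.sqrt_mul (by positivity)]
      apply Real.sqrt_le_iff.2
      constructor
      · positivity
      · nlinarith

lemma norm_real_add_circle_sq (R : ℝ) (z : Circle) :
    ‖(R : ℂ) + z‖ ^ 2 = R ^ 2 + 2 * R * (z : ℂ).re + 1 := by
  have := normSq_re_im z
  rw [norm_sq_eq]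
  simp
  linear_combination this

lemma exists_polar (v : ℂ) : ∃ u : Circle, v = (‖v‖ : ℂ) * u := by
  refine ⟨Circle.exp (Complex.arg v), ?_⟩
  rw [Circle.coe_exp, Complex.norm_mul_exp_arg_mul_I]

/-- After rotating `v` to the positive axis, `‖v + z‖² - 1 = 2‖v‖(Re z + ‖v‖/2)`, so this is a
sublevel set of the real part. The weight vanishes where the two unit circles coincide (`v = 0`) or
are tangent (`‖v‖ = 2`). -/
lemma arc_abs_norm_add_sub_one_lt_le {v : ℂ} (hv : v ≠ 0) (hv2 : ‖v‖ ≠ 2) {r : ℝ} (hr : 0 < r)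
    (hr1 : r ≤ 1) :
    arc {z : Circle | |‖v + z‖ - 1| < r} ≤
      ENNReal.ofReal (6 * Real.pi * r / (‖v‖ * √|1 - ‖v‖ / 2|)) := by
  obtain ⟨u, hu⟩ := exists_polar v
  have hR : 0 < ‖v‖ := norm_pos_iff.2 hv
  have h1 : arc {z : Circle | |‖v + z‖ - 1| < r}
      = arc {z : Circle | |‖(‖v‖ : ℂ) + z‖ - 1| < r} := by
    rw [← measure_preimage_mul arc u]
    congr 1
    ext z
    simp only [mem_preimage, mem_ofPred_eq]
    have : v + ((u * z : Circle) : ℂ) = u * ((‖v‖ : ℂ) + z) := by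
      rw [Circle.coe_mul]
      linear_combination hu
    rw [this, norm_mul, Circle.norm_coe, one_mul]
  rw [h1]
  have h2 : {z : Circle | |‖(‖v‖ : ℂ) + z‖ - 1| < r} ⊆
      {z : Circle | |(z : ℂ).re + ‖v‖ / 2| < 3 * r / (2 * ‖v‖)} := by
    intro z hz
    simp only [mem_ofPred_eq] at hz ⊢
    rw [lt_div_iff₀ (by positivity)]
    have h3 : |(z : ℂ).re + ‖v‖ / 2| * (2 * ‖v‖) = |‖(‖v‖ : ℂ) + z‖ ^ 2 - 1| := by
      rw [norm_real_add_circle_sq, ← abs_of_pos (show 0 < 2 * ‖v‖ by positivity), ← abs_mul,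
        abs_of_pos (show 0 < 2 * ‖v‖ by positivity)]
      congr 1
      ring
    rw [h3]
    set y := ‖(‖v‖ : ℂ) + z‖ with hy
    have : y ^ 2 - 1 = (y - 1) * (y + 1) := by ring
    rw [this, abs_mul]
    have hy0 : 0 ≤ y := norm_nonneg _
    have h4 : y + 1 ≤ 3 := by linarith [(abs_lt.1 hz).2]
    rw [abs_of_pos (show 0 < y + 1 by linarith)]
    nlinarith [abs_nonneg (y - 1)]
  refine (measure_mono h2).trans ((arc_abs_re_add_lt_le (by positivity) ?_ (by positivity)).trans
    (le_of_eq ?_))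
  · intro h
    apply hv2
    linarith
  · congr 1
    field_simp
    ring

/-- The weight in `arc_abs_norm_add_sub_one_lt_le` at `v = w + a` degenerates at most linearly
near three points of the circle. -/
lemma exists_three_points (w : ℂ) :
    ∃ p : Fin 3 → Circle, ∀ a : Circle, ∃ k,
      ‖(a : ℂ) - p k‖ ≤ 5 * (‖w + a‖ * √|1 - ‖w + a‖ / 2|) := by
  obtain ⟨u, hu⟩ := exists_polar w
  set ρ := ‖w‖ with hρ
  -- This is the value of `Re(u⁻¹a)` at which `‖w + a‖² = ρ² + 2ρ Re(u⁻¹a) + 1` equals `4`. Of the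
  -- three points, `-u` handles `w + a` near `0`, and `u z₁`, `u z₂` handle `‖w + a‖` near `2`.
  obtain ⟨z₁, z₂, hz⟩ := exists_norm_sub_mul_norm_sub_le ((3 - ρ ^ 2) / (2 * ρ))
  refine ⟨![negOne * u, u * z₁, u * z₂], fun a => ?_⟩
  set R := ‖w + a‖ with hR
  have hR0 : 0 ≤ R := norm_nonneg _
  set s := √|1 - R / 2| with hs
  have hs0 : 0 ≤ s := Real.sqrt_nonneg _
  have h2 : ∀ p : Circle, ‖(a : ℂ) - p‖ ≤ 2 := fun p => by
    refine (norm_sub_le _ _).trans ?_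
    rw [Circle.norm_coe, Circle.norm_coe]
    norm_num
  have hss : s ^ 2 = |1 - R / 2| := Real.sq_sqrt (abs_nonneg _)
  have hp1 : ‖(a : ℂ) - (negOne * u : Circle)‖ ≤ 2 * R := by
    have h3 : ‖(a : ℂ) - (negOne * u : Circle)‖ ≤ ‖w + a‖ + ‖(1 - ρ : ℂ) * u‖ := by
      refine (le_of_eq ?_).trans (norm_add_le _ _)
      congr 1
      rw [Circle.coe_mul, coe_negOne]
      linear_combination -hu
    have h4 : ‖(1 - ρ : ℂ) * u‖ = |1 - ρ| := by
      rw [norm_mul, Circle.norm_coe, mul_one, ← Complex.ofReal_one, ← Complex.ofReal_sub,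
        Complex.norm_real, Real.norm_eq_abs]
    have h5 : |1 - ρ| ≤ R := by
      have h6 := abs_norm_sub_norm_le (a : ℂ) (-w)
      rw [Circle.norm_coe, norm_neg, sub_neg_eq_add, add_comm] at h6
      exact h6
    linarith
  rcases le_or_gt R 1 with hR1 | hR1
  · refine ⟨0, ?_⟩
    have h3 : (1 / 2 : ℝ) ≤ s := by
      apply Real.le_sqrt_of_sq_le
      rw [abs_of_pos (by linarith)]
      linarith
    simp only [Matrix.cons_val_zero]
    nlinarith
  -- In these cases the weight is at least `1/2` and chords have length at most `2`, so any point
  -- serves. What remains has `R < 3`, and `ρ ≥ 1/2` allows the division by `2ρ` in `hkey`.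
  by_cases hfar : 3 ≤ R ∨ ρ < 1 / 2
  · refine ⟨0, ?_⟩
    have h3 : (1 / 2 : ℝ) ≤ s := by
      apply Real.le_sqrt_of_sq_le
      rcases hfar with h | h
      · rw [abs_sub_comm, abs_of_pos (by linarith)]
        linarith
      · have h6 : R ≤ ρ + 1 := (norm_add_le _ _).trans (by rw [Circle.norm_coe])
        rw [abs_of_pos (by linarith)]
        linarith
    simp only [Matrix.cons_val_zero]
    have := h2 (negOne * u)
    nlinarith
  push Not at hfar
  obtain ⟨hR3, hρ2⟩ := hfar
  set b : Circle := u⁻¹ * a with hb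
  have hab : (a : ℂ) = u * b := by
    rw [hb, ← Circle.coe_mul]
    simp
  have hRsq : R ^ 2 = ρ ^ 2 + 2 * ρ * (b : ℂ).re + 1 := by
    rw [← norm_real_add_circle_sq, hR]
    congr 1
    have : w + a = u * ((ρ : ℂ) + b) := by
      rw [hab]
      linear_combination hu
    rw [this, norm_mul, Circle.norm_coe, one_mul]
  have hkey : ‖(b : ℂ) - z₁‖ * ‖(b : ℂ) - z₂‖ ≤ 20 * s ^ 2 := by
    refine (hz b).trans ?_
    have h3 : |(b : ℂ).re - (3 - ρ ^ 2) / (2 * ρ)| * (2 * ρ) = |R ^ 2 - 4| := by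
      rw [hRsq, ← abs_of_pos (show 0 < 2 * ρ by linarith), ← abs_mul,
        abs_of_pos (show 0 < 2 * ρ by linarith)]
      congr 1
      field_simp
      ring
    have h4 : |R ^ 2 - 4| ≤ 10 * s ^ 2 := by
      rw [hss]
      have : R ^ 2 - 4 = (1 - R / 2) * (-2 * (R + 2)) := by ring
      rw [this, abs_mul, mul_comm]
      refine mul_le_mul_of_nonneg_right ?_ (abs_nonneg _)
      rw [abs_mul, abs_neg, abs_two, abs_of_pos (by linarith)]
      linarith
    nlinarith [abs_nonneg ((b : ℂ).re - (3 - ρ ^ 2) / (2 * ρ))]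
  have hrot : ∀ z : Circle, ‖(a : ℂ) - (u * z : Circle)‖ = ‖(b : ℂ) - z‖ := fun z => by
    have : (a : ℂ) - (u * z : Circle) = u * (b - z) := by
      rw [Circle.coe_mul]
      linear_combination hab
    rw [this, norm_mul, Circle.norm_coe, one_mul]
  have hfin : ∀ x : ℝ, 0 ≤ x → x ^ 2 ≤ 20 * s ^ 2 → x ≤ 5 * (R * s) := fun x hx h => by
    have h3 : x ≤ 5 * s := by
      apply le_of_sq_le_sq _ (by positivity)
      nlinarith
    nlinarith
  rcases le_total ‖(b : ℂ) - z₁‖ ‖(b : ℂ) - z₂‖ with h | h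
  · refine ⟨1, ?_⟩
    simp only [Matrix.cons_val_one, Matrix.cons_val_zero]
    rw [hrot]
    exact hfin _ (norm_nonneg _) (by nlinarith [norm_nonneg ((b : ℂ) - z₁)])
  · refine ⟨2, ?_⟩
    simp only [Matrix.cons_val]
    rw [hrot]
    exact hfin _ (norm_nonneg _) (by nlinarith [norm_nonneg ((b : ℂ) - z₂)])

/-- The set of pairs `(a, z)` with `‖w + a + z‖` within `r` of `1` has measure `O(r ^ τ)`, `τ < 1`,
uniformly in `w`. -/
lemma exists_lintegral_arc_annulus_le {τ : ℝ} (hτ : τ < 1) (hτ0 : 0 ≤ τ) :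
    ∃ C : ℝ, 0 < C ∧ ∀ (w : ℂ) (r : ℝ), 0 < r → r ≤ 1 →
      ∫⁻ a : Circle, arc {z : Circle | |‖w + a + z‖ - 1| < r} ∂arc ≤ ENNReal.ofReal (C * r ^ τ) := by
  obtain ⟨C, hC, hCb⟩ := exists_lintegral_chord_rpow_le hτ hτ0
  have hpi := Real.pi_pos
  refine ⟨30 * Real.pi * (3 * C), by positivity, fun w r hr hr1 => ?_⟩
  obtain ⟨p, hp⟩ := exists_three_points w
  have hpt : ∀ a : Circle, arc {z : Circle | |‖w + a + z‖ - 1| < r} ≤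
      ENNReal.ofReal (30 * Real.pi * r ^ τ) * ∑ k, (ENNReal.ofReal ‖(a : ℂ) - p k‖) ^ (-τ) := by
    intro a
    obtain ⟨k, hk⟩ := hp a
    refine le_trans ?_ (mul_le_mul_right (Finset.single_le_sum
      (f := fun k => (ENNReal.ofReal ‖(a : ℂ) - p k‖) ^ (-τ)) (fun _ _ => zero_le)
      (Finset.mem_univ k)) _)
    set d := ‖(a : ℂ) - p k‖ with hd
    have hu : arc {z : Circle | |‖w + a + z‖ - 1| < r} ≤ ENNReal.ofReal (30 * Real.pi) := by
      refine (measure_mono (subset_univ _)).trans ?_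
      rw [arc_univ]
      exact ENNReal.ofReal_le_ofReal (by linarith)
    rcases (norm_nonneg ((a : ℂ) - p k)).eq_or_lt with h0 | h0
    · rw [← hd] at h0
      rw [← h0, ENNReal.ofReal_zero]
      rcases hτ0.eq_or_lt with ht | ht
      · rw [← ht]
        simpa using hu
      · rw [ENNReal.zero_rpow_of_neg (by linarith), ENNReal.mul_top]
        · exact le_top
        · have : 0 < 30 * Real.pi * r ^ τ := by positivity
          simpa using this
    · rw [← hd] at h0
      rw [ENNReal.ofReal_rpow_of_pos h0, ← ENNReal.ofReal_mul (by positivity)]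
      -- If `d ≤ r`, the total mass is enough because `(r/d) ^ τ ≥ 1`; if `r ≤ d`, the linear bound
      -- `r/d` is at most `(r/d) ^ τ`.
      rcases le_total d r with hdr | hdr
      · refine hu.trans (ENNReal.ofReal_le_ofReal ?_)
        rw [mul_assoc]
        refine le_mul_of_one_le_right (by positivity) ?_
        rw [Real.rpow_neg h0.le, ← div_eq_mul_inv, one_le_div (by positivity)]
        exact Real.rpow_le_rpow h0.le hdr hτ0
      · have hRs : 0 < ‖w + a‖ * √|1 - ‖w + a‖ / 2| := by nlinarith
        have hv : w + a ≠ 0 := by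
          intro h
          rw [h] at hRs
          simp at hRs
        have hv2 : ‖w + a‖ ≠ 2 := by
          intro h
          rw [h] at hRs
          simp at hRs
        refine (arc_abs_norm_add_sub_one_lt_le hv hv2 hr hr1).trans (ENNReal.ofReal_le_ofReal ?_)
        have h1 : 6 * Real.pi * r / (‖w + a‖ * √|1 - ‖w + a‖ / 2|) ≤ 30 * Real.pi * (r / d) := by
          rw [← mul_div_assoc, div_le_div_iff₀ hRs h0]
          have : 0 ≤ 6 * Real.pi * r := by positivity
          nlinarith
        refine h1.trans ?_
        rw [mul_assoc (30 * Real.pi)]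
        refine mul_le_mul_of_nonneg_left ?_ (by positivity)
        rw [Real.rpow_neg h0.le, ← div_eq_mul_inv, ← Real.div_rpow hr.le h0.le]
        refine (Real.rpow_le_rpow_of_exponent_ge (by positivity) ?_ hτ.le).trans' ?_
        · exact (div_le_one h0).2 hdr
        · rw [Real.rpow_one]
  refine (lintegral_mono hpt).trans ?_
  rw [lintegral_const_mul _ (by fun_prop), lintegral_finsetSum _ (fun _ _ => by fun_prop)]
  refine (mul_le_mul_right (Finset.sum_le_sum fun k _ => hCb (p k)) _).trans ?_
  rw [Finset.sum_const, Finset.card_univ, Fintype.card_fin, nsmul_eq_mul,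
    show ((3 : ℕ) : ℝ≥0∞) = ENNReal.ofReal 3 by simp, ← ENNReal.ofReal_mul (by norm_num),
    ← ENNReal.ofReal_mul (by positivity)]
  apply le_of_eq
  congr 1
  ring

/-! ### The positive fivefold convolution -/

/-- The indicator function of the disc of radius `r` about the origin. -/
noncomputable def discInd (r : ℝ) (v : ℂ) : ℝ≥0∞ := (Metric.ball (0 : ℂ) r).indicator 1 v

@[fun_prop]
lemma measurable_discInd (r : ℝ) : Measurable (discInd r) :=
  measurable_one.indicator measurableSet_ball

/-- `‖v + z‖ < r` puts `z` in an arc of length `O(r)` around `-v` and, since `‖z‖ = 1`, puts `v`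
within `r` of the unit circle. -/
lemma lintegral_discInd_add_le {v : ℂ} {r : ℝ} :
    ∫⁻ z : Circle, discInd r (v + z) ∂arc ≤
      ENNReal.ofReal (2 * Real.pi * r) *
        {v : ℂ | |‖v‖ - 1| < r}.indicator 1 v := by
  have h : ∀ z : Circle, discInd r (v + z) ≤
      {z : Circle | ‖(z : ℂ) - (-v)‖ < r}.indicator 1 z *
        {v : ℂ | |‖v‖ - 1| < r}.indicator 1 v := by
    intro z
    by_cases hz : ‖v + z‖ < r
    · have h1 : |‖v‖ - 1| < r := by
        have := abs_norm_sub_norm_le v (-(z : ℂ))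
        rw [norm_neg, Circle.norm_coe, sub_neg_eq_add] at this
        exact this.trans_lt hz
      have h2 : z ∈ {z : Circle | ‖(z : ℂ) - (-v)‖ < r} := by
        rw [mem_ofPred_eq, sub_neg_eq_add, add_comm]
        exact hz
      have h3 : v ∈ {v : ℂ | |‖v‖ - 1| < r} := h1
      rw [indicator_of_mem h2, indicator_of_mem h3]
      rw [Pi.one_apply, Pi.one_apply, one_mul, discInd]
      exact indicator_le_self' (f := (1 : ℂ → ℝ≥0∞)) (fun _ _ => zero_le) _
    · rw [discInd, indicator_of_notMem (by simpa using hz)]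
      exact zero_le
  refine (lintegral_mono h).trans ?_
  have hm : MeasurableSet {z : Circle | ‖(z : ℂ) - (-v)‖ < r} :=
    measurableSet_lt (by fun_prop) measurable_const
  rw [lintegral_mul_const _ (measurable_one.indicator hm), lintegral_indicator_one hm]
  exact mul_le_mul_left (arc_norm_sub_lt_le _ _) _

lemma lintegral_arc_neg (f : ℂ → ℝ≥0∞) :
    ∫⁻ x : Circle, f (-(x : ℂ)) ∂arc = ∫⁻ x : Circle, f x ∂arc := by
  rw [← lintegral_mul_left_eq_self (μ := arc) (fun x : Circle => f x) negOne]
  simp [coe_negOne]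

/-- A uniform bound for `σ * σ * σ` on discs of radius `r`. The innermost variable contributes `r`
and confines `w + a + b` to an annulus, to which the pair estimate applies. The exponent stays below
`2` because the density of `σ * σ * σ` is unbounded at the unit circle. -/
lemma exists_lintegral_three_discInd_le {τ : ℝ} (hτ : τ < 1) (hτ0 : 0 ≤ τ) :
    ∃ C : ℝ, 0 < C ∧ ∀ (w : ℂ) (r : ℝ), 0 < r → r ≤ 1 →
      ∫⁻ a : Circle, ∫⁻ b : Circle, ∫⁻ c : Circle, discInd r (w + a + b + c) ∂arc ∂arc ∂arc
        ≤ ENNReal.ofReal (C * (r * r ^ τ)) := by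
  obtain ⟨C, hC, h⟩ := exists_lintegral_arc_annulus_le hτ hτ0
  have hpi := Real.pi_pos
  refine ⟨2 * Real.pi * C, by positivity, fun w r hr hr1 => ?_⟩
  have h1 : ∀ a : Circle, ∫⁻ b : Circle, ∫⁻ c : Circle, discInd r (w + a + b + c) ∂arc ∂arc ≤
      ENNReal.ofReal (2 * Real.pi * r) * arc {z : Circle | |‖w + a + z‖ - 1| < r} := by
    intro a
    have hm : MeasurableSet {z : Circle | |‖w + a + z‖ - 1| < r} :=
      measurableSet_lt (by fun_prop) measurable_const
    rw [← lintegral_indicator_one hm, ← lintegral_const_mul _ (measurable_one.indicator hm)]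
    exact lintegral_mono fun b => lintegral_discInd_add_le
  refine (lintegral_mono h1).trans ?_
  rw [lintegral_const_mul' _ _ ENNReal.ofReal_ne_top]
  refine (mul_le_mul_right (h w r hr hr1) _).trans ?_
  rw [← ENNReal.ofReal_mul (by positivity)]
  apply le_of_eq
  congr 1
  ring

/-! ### Iterated integrals over five circles and the `L²` bound by Cauchy–Schwarz. -/

lemma lintegral_pi_succ {n : ℕ} (F : (Fin (n + 1) → Circle) → ℝ≥0∞) (hF : Measurable F) :
    ∫⁻ ω, F ω ∂(Measure.pi fun _ => arc) =
      ∫⁻ a, ∫⁻ ω, F (Matrix.vecCons a ω) ∂(Measure.pi fun _ : Fin n => arc) ∂arc := by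
  have h := (measurePreserving_piFinSuccAbove (fun _ : Fin (n + 1) => arc) 0).symm
  rw [← h.lintegral_comp hF, lintegral_prod]
  · congr! 5 with a ω
    ext i
    refine Fin.cases ?_ (fun j => ?_) i <;> simp [MeasurableEquiv.piFinSuccAbove]
  · exact (hF.comp h.measurable).aemeasurable

lemma measurable_vecCons {n : ℕ} :
    Measurable (fun p : Circle × (Fin n → Circle) => Matrix.vecCons p.1 p.2) := by
  rw [measurable_pi_iff]
  intro i
  refine Fin.cases ?_ (fun j => ?_) i
  · simpa using measurable_fst
  · simpa [Function.comp_def] using (measurable_pi_apply j).comp measurable_snd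

@[fun_prop]
lemma Measurable.vecCons {α : Type*} [MeasurableSpace α] {n : ℕ} {f : α → Circle}
    {g : α → Fin n → Circle} (hf : Measurable f) (hg : Measurable g) :
    Measurable fun x => (Matrix.vecCons (f x) (g x) : Fin (n + 1) → Circle) :=
  measurable_vecCons.comp (hf.prodMk hg)

lemma lintegral_pi_zero (F : (Fin 0 → Circle) → ℝ≥0∞) :
    ∫⁻ ω, F ω ∂(Measure.pi fun _ => arc) = F ![] := by
  rw [Measure.pi_of_empty _ ![], lintegral_dirac]

lemma lintegral_pi_five (F : (Fin 5 → Circle) → ℝ≥0∞) (hF : Measurable F) :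
    ∫⁻ ω, F ω ∂(Measure.pi fun _ => arc) =
      ∫⁻ a, ∫⁻ b, ∫⁻ c, ∫⁻ d, ∫⁻ e, F ![a, b, c, d, e] ∂arc ∂arc ∂arc ∂arc ∂arc := by
  rw [lintegral_pi_succ _ hF]
  congr! 2 with a
  rw [lintegral_pi_succ _ (by fun_prop)]
  congr! 2 with b
  rw [lintegral_pi_succ _ (by fun_prop)]
  congr! 2 with c
  rw [lintegral_pi_succ _ (by fun_prop)]
  congr! 2 with d
  rw [lintegral_pi_succ _ (by fun_prop)]
  congr! 2 with e
  rw [lintegral_pi_zero]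

lemma sq_lintegral_mul_le {α : Type*} [MeasurableSpace α] (μ : Measure α) {f g : α → ℝ≥0∞}
    (hf : Measurable f) (hg : Measurable g) :
    (∫⁻ x, f x * g x ∂μ) ^ 2 ≤ (∫⁻ x, f x ^ 2 ∂μ) * ∫⁻ x, g x ^ 2 ∂μ := by
  have h := ENNReal.lintegral_mul_le_Lp_mul_Lq μ (p := 2) (q := 2)
    (by constructor <;> norm_num) hf.aemeasurable hg.aemeasurable
  refine (pow_le_pow_left₀ zero_le h 2).trans ?_
  rw [mul_pow, ← ENNReal.rpow_natCast, ← ENNReal.rpow_natCast, ← ENNReal.rpow_mul,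
    ← ENNReal.rpow_mul]
  norm_num

/-- The fivefold positive convolution, tested on the disc of radius `r` about `x`. -/
noncomputable def posConv (h : Fin 5 → Circle → ℝ≥0∞) (r : ℝ) (x : ℂ) : ℝ≥0∞ :=
  ∫⁻ ω, (∏ i, h i (ω i)) * discInd r ((∑ i, (ω i : ℂ)) - x) ∂(Measure.pi fun _ : Fin 5 => arc)

lemma discInd_sq (r : ℝ) (v : ℂ) : discInd r v ^ 2 = discInd r v := by
  rw [discInd]
  by_cases h : v ∈ Metric.ball (0 : ℂ) r
  · rw [indicator_of_mem h]
    simp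
  · rw [indicator_of_notMem h]
    simp

/-- Cauchy–Schwarz with the functions split three against two; both factors keep the disc because
its indicator equals its square. Three circle variables are then free of functions in each factor:
`a, b, c` in the second, and `d, e` in the first together with `x` once it is integrated over the
circle. -/
lemma posConv_sq_le (h : Fin 5 → Circle → ℝ≥0∞) (hh : ∀ i, Measurable (h i)) (r : ℝ) (x : ℂ) :
    posConv h r x ^ 2 ≤
      (∫⁻ a, ∫⁻ b, ∫⁻ c, ∫⁻ d, ∫⁻ e, (h 0 a * h 1 b * h 2 c) ^ 2 *
          discInd r (a + b + c + d + e - x) ∂arc ∂arc ∂arc ∂arc ∂arc) *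
      (∫⁻ d, ∫⁻ e, ∫⁻ a, ∫⁻ b, ∫⁻ c, (h 3 d * h 4 e) ^ 2 *
          discInd r (a + b + c + d + e - x) ∂arc ∂arc ∂arc ∂arc ∂arc) := by
  have hind : ∀ ω : Fin 5 → Circle, (∏ i, h i (ω i)) * discInd r ((∑ i, (ω i : ℂ)) - x)
      = ((h 0 (ω 0) * h 1 (ω 1) * h 2 (ω 2)) * discInd r ((∑ i, (ω i : ℂ)) - x)) *
        ((h 3 (ω 3) * h 4 (ω 4)) * discInd r ((∑ i, (ω i : ℂ)) - x)) := by
    intro ω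
    rw [Fin.prod_univ_five]
    conv_lhs => rw [← discInd_sq]
    ring
  rw [posConv]
  simp_rw [hind]
  refine (sq_lintegral_mul_le _ (by fun_prop) (by fun_prop)).trans (le_of_eq ?_)
  simp_rw [mul_pow _ (discInd r _), discInd_sq]
  congr 1
  · rw [lintegral_pi_five _ (by fun_prop)]
    simp only [Fin.sum_univ_five]
    rfl
  -- The cyclic shift that makes coordinates `3` and `4` the outermost variables of integration.
  · let σ : Fin 5 ≃ Fin 5 := ⟨![2, 3, 4, 0, 1], ![3, 4, 0, 1, 2], by decide, by decide⟩
    have hσ := measurePreserving_piCongrLeft (fun _ : Fin 5 => arc) σ.symm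
    rw [← hσ.lintegral_comp (by fun_prop), lintegral_pi_five _ (by fun_prop)]
    have e : ∀ (ω : Fin 5 → Circle) i,
        MeasurableEquiv.piCongrLeft (fun _ : Fin 5 => Circle) σ.symm ω i = ω (σ i) := by
      intro ω i
      have := Equiv.piCongrLeft_apply_apply (fun _ : Fin 5 => Circle) σ.symm ω (σ i)
      rw [Equiv.symm_apply_apply] at this
      exact this
    simp only [e, Fin.sum_univ_five]
    rfl

lemma lintegral_three_const_mul (X : ℝ≥0∞) (G : Circle → Circle → Circle → ℝ≥0∞)
    (hG : Measurable fun p : Circle × Circle × Circle => G p.1 p.2.1 p.2.2) :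
    ∫⁻ a, ∫⁻ b, ∫⁻ c, X * G a b c ∂arc ∂arc ∂arc = X * ∫⁻ a, ∫⁻ b, ∫⁻ c, G a b c ∂arc ∂arc ∂arc := by
  have h1 : ∀ a b, Measurable fun c => G a b c := fun a b =>
    hG.comp (f := fun c => (a, b, c)) (by fun_prop)
  have h2 : ∀ a, Measurable fun b => ∫⁻ c, G a b c ∂arc := fun a =>
    Measurable.lintegral_prod_right' (f := fun p : Circle × Circle => G a p.1 p.2)
      (hG.comp (f := fun p : Circle × Circle => (a, p)) (by fun_prop))
  have h3 : Measurable fun a => ∫⁻ b, ∫⁻ c, G a b c ∂arc ∂arc := by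
    refine Measurable.lintegral_prod_right' (f := fun p : Circle × Circle =>
      ∫⁻ c, G p.1 p.2 c ∂arc) ?_
    have h4 : Measurable fun p : (Circle × Circle) × Circle => G p.1.1 p.1.2 p.2 :=
      hG.comp (f := fun p : (Circle × Circle) × Circle => (p.1.1, p.1.2, p.2)) (by fun_prop)
    exact h4.lintegral_prod_right'
  rw [← lintegral_const_mul _ h3]
  refine lintegral_congr fun a => ?_
  rw [← lintegral_const_mul _ (h2 a)]
  refine lintegral_congr fun b => ?_
  rw [← lintegral_const_mul _ (h1 a b)]

/-- Of the two Cauchy–Schwarz factors, the second is bounded uniformly in `x` and the first is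
integrated in `x`, where the reflection `x ↦ -x` supplies the third free variable. Each costs one
factor `D`. -/
lemma exists_lintegral_posConv_sq_le {τ : ℝ} (hτ : τ < 1) (hτ0 : 0 ≤ τ) :
    ∃ C : ℝ, 0 < C ∧ ∀ (h : Fin 5 → Circle → ℝ≥0∞), (∀ i, Measurable (h i)) → ∀ r : ℝ, 0 < r →
      r ≤ 1 → ∫⁻ x : Circle, posConv h r x ^ 2 ∂arc ≤
        ENNReal.ofReal (C * (r * r ^ τ)) ^ 2 * ∏ i, ∫⁻ z, h i z ^ 2 ∂arc := by
  obtain ⟨C, hC, hb⟩ := exists_lintegral_three_discInd_le hτ hτ0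
  refine ⟨C, hC, fun h hh r hr hr1 => ?_⟩
  set D := ENNReal.ofReal (C * (r * r ^ τ)) with hD
  have hsecond : ∀ x : Circle, (∫⁻ d, ∫⁻ e, ∫⁻ a, ∫⁻ b, ∫⁻ c, (h 3 d * h 4 e) ^ 2 *
      discInd r (a + b + c + d + e - x) ∂arc ∂arc ∂arc ∂arc ∂arc) ≤
      (∫⁻ z, h 3 z ^ 2 ∂arc) * (∫⁻ z, h 4 z ^ 2 ∂arc) * D := by
    intro x
    have h1 : ∀ d e : Circle, ∫⁻ a : Circle, ∫⁻ b : Circle, ∫⁻ c : Circle, (h 3 d * h 4 e) ^ 2 *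
        discInd r (a + b + c + d + e - x) ∂arc ∂arc ∂arc ≤ (h 3 d ^ 2 * D) * h 4 e ^ 2 := by
      intro d e
      have h2 := hb (d + e - x) r hr hr1
      have h3 : ∀ a b c : Circle, (h 3 d * h 4 e) ^ 2 * discInd r ((a : ℂ) + b + c + d + e - x) =
          (h 3 d * h 4 e) ^ 2 * discInd r ((d + e - x) + a + b + c) := by
        intros
        congr 2
        ring
      rw [lintegral_congr fun a => lintegral_congr fun b => lintegral_congr fun c => h3 a b c]
      refine (lintegral_three_const_mul _ _ (by fun_prop)).le.trans ?_
      refine (mul_le_mul_right h2 _).trans (le_of_eq ?_)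
      ring
    refine (lintegral_mono fun d => lintegral_mono fun e => h1 d e).trans ?_
    simp (discharger := fun_prop) only [lintegral_const_mul, lintegral_mul_const]
    apply le_of_eq
    ring
  have hfirst : ∫⁻ x : Circle, (∫⁻ a, ∫⁻ b, ∫⁻ c, ∫⁻ d, ∫⁻ e, (h 0 a * h 1 b * h 2 c) ^ 2 *
      discInd r (a + b + c + d + e - x) ∂arc ∂arc ∂arc ∂arc ∂arc) ∂arc ≤
      (∫⁻ z, h 0 z ^ 2 ∂arc) * (∫⁻ z, h 1 z ^ 2 ∂arc) * (∫⁻ z, h 2 z ^ 2 ∂arc) * D := by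
    have h1 : ∀ a b c : Circle, ∫⁻ x : Circle, ∫⁻ d : Circle, ∫⁻ e : Circle,
        (h 0 a * h 1 b * h 2 c) ^ 2 * discInd r (a + b + c + d + e - x) ∂arc ∂arc ∂arc ≤
        (h 0 a ^ 2 * D) * h 1 b ^ 2 * h 2 c ^ 2 := by
      intro a b c
      have h2 := hb (a + b + c) r hr hr1
      rw [← lintegral_arc_neg (fun x => ∫⁻ d : Circle, ∫⁻ e : Circle,
        discInd r (a + b + c + x + d + e) ∂arc ∂arc)] at h2
      have h3 : ∀ x d e : Circle, (h 0 a * h 1 b * h 2 c) ^ 2 *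
          discInd r ((a : ℂ) + b + c + d + e - x) =
          (h 0 a * h 1 b * h 2 c) ^ 2 * discInd r (a + b + c + -x + d + e) := by
        intros
        congr 2
        ring
      rw [lintegral_congr fun x => lintegral_congr fun d => lintegral_congr fun e => h3 x d e]
      refine (lintegral_three_const_mul _ _ (by fun_prop)).le.trans ?_
      refine (mul_le_mul_right h2 _).trans (le_of_eq ?_)
      ring
    rw [lintegral_lintegral_swap (Measurable.aemeasurable (by fun_prop))]
    refine (lintegral_mono (g := fun a => (h 0 a ^ 2 * D) * (∫⁻ z, h 1 z ^ 2 ∂arc) * ∫⁻ z, h 2 z ^ 2 ∂arc) fun a => ?_).trans ?_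
    · dsimp only
      rw [lintegral_lintegral_swap (Measurable.aemeasurable (by fun_prop))]
      refine (lintegral_mono (g := fun b => (h 0 a ^ 2 * D) * h 1 b ^ 2 * ∫⁻ z, h 2 z ^ 2 ∂arc) fun b => ?_).trans ?_
      · dsimp only
        rw [lintegral_lintegral_swap (Measurable.aemeasurable (by fun_prop))]
        refine (lintegral_mono fun c => h1 a b c).trans ?_
        simp (discharger := fun_prop) only [lintegral_const_mul, le_refl]
      · simp (discharger := fun_prop) only [lintegral_const_mul, lintegral_mul_const, le_refl]
    · simp (discharger := fun_prop) only [lintegral_mul_const]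
      apply le_of_eq
      ring
  refine (lintegral_mono fun x : Circle => (posConv_sq_le h hh r x).trans
    (mul_le_mul_right (hsecond x) _)).trans ?_
  rw [lintegral_mul_const _ (by fun_prop)]
  refine (mul_le_mul_left hfirst _).trans (le_of_eq ?_)
  rw [Fin.prod_univ_five]
  ring

/-! ### Decay of the Fourier transforms of `z ^ n dσ` -/

lemma integrable_of_continuous {X : Type*} [TopologicalSpace X] [CompactSpace X]
    [MeasurableSpace X] [OpensMeasurableSpace X] {μ : Measure X}
    [IsFiniteMeasure μ] {f : X → ℂ} (hf : Continuous f) : Integrable f μ :=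
  hf.integrable_of_hasCompactSupport (HasCompactSupport.of_compactSpace f)

/-- The Fourier transform of the measure `z ^ n dσ`. -/
noncomputable def circFT (n : ℤ) (ξ : ℂ) : ℂ :=
  ∫ z : Circle, (z : ℂ) ^ n *
    Complex.exp (((2 * Real.pi * inner ℝ (z : ℂ) ξ : ℝ) : ℂ) * Complex.I) ∂arc

@[fun_prop]
lemma continuous_circle_zpow (n : ℤ) : Continuous fun z : Circle => (z : ℂ) ^ n :=
  Continuous.zpow₀ (by fun_prop) n fun z => Or.inl z.coe_ne_zero

lemma norm_circle_zpow (z : Circle) (n : ℤ) : ‖(z : ℂ) ^ n‖ = 1 := by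
  rw [norm_zpow, Circle.norm_coe, one_zpow]

lemma inner_circle_mul (u : Circle) (z ξ : ℂ) : inner ℝ (u * z) (u * ξ) = inner ℝ z ξ := by
  have h := normSq_re_im u
  simp only [Complex.inner, Complex.mul_re, Complex.mul_im, map_mul, Complex.conj_re,
    Complex.conj_im]
  linear_combination (z.re * ξ.re + z.im * ξ.im) * h

/-- Rotational equivariance: it reduces estimates to real `ξ`, and with `u = e^{iπ/n}` it yields the
smallness for large `n`. -/
lemma circFT_mul (u : Circle) (n : ℤ) (ξ : ℂ) : circFT n (u * ξ) = (u : ℂ) ^ n * circFT n ξ := by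
  rw [circFT, circFT, ← integral_const_mul, ← integral_mul_left_eq_self _ u]
  refine integral_congr_ae (.of_forall fun z => ?_)
  simp only [Circle.coe_mul]
  rw [inner_circle_mul, mul_zpow]
  ring

lemma norm_circFT_le_two_pi (n : ℤ) (ξ : ℂ) : ‖circFT n ξ‖ ≤ 2 * Real.pi := by
  refine (norm_integral_le_of_norm_le_const (C := 1) (.of_forall fun z => ?_)).trans ?_
  · rw [norm_mul, norm_circle_zpow, Complex.norm_exp_ofReal_mul_I, one_mul]
  · rw [measureReal_def, arc_univ, ENNReal.toReal_ofReal Real.two_pi_pos.le, one_mul]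

lemma norm_circFT_eq (n : ℤ) (ξ : ℂ) :
    ‖circFT n ξ‖ = ‖∫ θ in (-Real.pi)..Real.pi,
      Complex.exp (((n * θ + 2 * Real.pi * ‖ξ‖ * Real.cos θ : ℝ) : ℂ) * Complex.I)‖ := by
  obtain ⟨u, hu⟩ := exists_polar ξ
  have h1 : circFT n ξ = (u : ℂ) ^ n * circFT n ‖ξ‖ := by
    rw [← circFT_mul, mul_comm, ← hu]
  rw [h1, norm_mul, norm_circle_zpow, one_mul, circFT, integral_arc _ (by fun_prop)]
  congr 1
  refine intervalIntegral.integral_congr fun θ _ => ?_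
  rw [Circle.coe_exp, ← Complex.exp_int_mul, ← Complex.exp_add]
  congr 1
  simp only [Complex.inner, Complex.mul_re, Complex.conj_re, Complex.conj_im, Complex.ofReal_re,
    Complex.ofReal_im, Complex.exp_ofReal_mul_I_re]
  push_cast
  ring

lemma integral_inv_sin_sq {η : ℝ} (h0 : 0 < η) (h1 : η ≤ 1) :
    (IntervalIntegrable (fun θ => 1 / Real.sin θ ^ 2) volume η (Real.pi - η)) ∧
    ∫ θ in η..(Real.pi - η), 1 / Real.sin θ ^ 2 ≤ 2 / Real.sin η := by
  have hpi := Real.pi_gt_three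
  have hs : ∀ θ ∈ uIcc η (Real.pi - η), 0 < Real.sin θ := by
    intro θ hθ
    rw [uIcc_of_le (by linarith)] at hθ
    exact Real.sin_pos_of_pos_of_lt_pi (by linarith [hθ.1]) (by linarith [hθ.2])
  have hi : IntervalIntegrable (fun θ => 1 / Real.sin θ ^ 2) volume η (Real.pi - η) := by
    apply ContinuousOn.intervalIntegrable
    exact continuousOn_const.div (by fun_prop) fun θ hθ => (pow_pos (hs θ hθ) 2).ne'
  refine ⟨hi, ?_⟩
  rw [intervalIntegral.integral_eq_sub_of_hasDerivAt (f := fun θ => -(Real.cos θ / Real.sin θ))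
    (fun θ hθ => ?_) hi]
  · have hη := hs η left_mem_uIcc
    rw [Real.cos_pi_sub, Real.sin_pi_sub]
    have : -(-Real.cos η / Real.sin η) - -(Real.cos η / Real.sin η)
        = 2 * Real.cos η / Real.sin η := by ring
    rw [this]
    exact div_le_div_of_nonneg_right (by linarith [Real.cos_le_one η]) hη.le
  · have h := ((Real.hasDerivAt_cos θ).div (Real.hasDerivAt_sin θ) (hs θ hθ).ne').neg
    refine h.congr_deriv ?_
    have := Real.sin_sq_add_cos_sq θ
    rw [← neg_div]
    congr 1
    linear_combination this

/-- Integration by parts away from the stationary points `0` and `π` of the phase `λ cos θ`. The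
character stays in the amplitude, so the constant grows only linearly in `n`, and the error is
controlled by `∫ 1/sin² ≤ 2/sin η`. -/
lemma norm_integral_middle_le (n : ℤ) {lam η : ℝ} (hl : 0 < lam) (h0 : 0 < η) (h1 : η ≤ 1) :
    ‖∫ θ in η..(Real.pi - η),
      Complex.exp (((n * θ + lam * Real.cos θ : ℝ) : ℂ) * Complex.I)‖ ≤
      (2 * (|(n : ℝ)| + 1) + 2) / (lam * Real.sin η) := by
  have hpi := Real.pi_gt_three
  have hs : ∀ θ ∈ uIcc η (Real.pi - η), 0 < Real.sin θ := by
    intro θ hθ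
    rw [uIcc_of_le (by linarith)] at hθ
    exact Real.sin_pos_of_pos_of_lt_pi (by linarith [hθ.1]) (by linarith [hθ.2])
  have hlC : (lam : ℂ) ≠ 0 := Complex.ofReal_ne_zero.2 hl.ne'
  have hsC : ∀ θ ∈ uIcc η (Real.pi - η), (Real.sin θ : ℂ) ≠ 0 := fun θ hθ =>
    Complex.ofReal_ne_zero.2 (hs θ hθ).ne'
  set u : ℝ → ℂ := fun θ =>
    Complex.exp ((n * θ : ℝ) * Complex.I) / (-(Complex.I * lam * Real.sin θ)) with hu
  set u' : ℝ → ℂ := fun θ => (n * Complex.I * Complex.exp ((n * θ : ℝ) * Complex.I) *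
    (-(Complex.I * lam * Real.sin θ)) - Complex.exp ((n * θ : ℝ) * Complex.I) *
      (-(Complex.I * lam * Real.cos θ))) / (-(Complex.I * lam * Real.sin θ)) ^ 2 with hu'
  set v : ℝ → ℂ := fun θ => Complex.exp ((lam * Real.cos θ : ℝ) * Complex.I) with hv
  set v' : ℝ → ℂ := fun θ => Complex.exp ((lam * Real.cos θ : ℝ) * Complex.I) *
    (-(Complex.I * lam * Real.sin θ)) with hv'
  have hden : ∀ θ ∈ uIcc η (Real.pi - η), -(Complex.I * lam * Real.sin θ) ≠ 0 := fun θ hθ => by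
    exact neg_ne_zero.2 (mul_ne_zero (mul_ne_zero Complex.I_ne_zero hlC) (hsC θ hθ))
  have hdu : ∀ θ ∈ uIcc η (Real.pi - η), HasDerivAt u (u' θ) θ := by
    intro θ hθ
    have ha : HasDerivAt (fun θ : ℝ => Complex.exp ((n * θ : ℝ) * Complex.I))
        (n * Complex.I * Complex.exp ((n * θ : ℝ) * Complex.I)) θ := by
      have h2 : HasDerivAt (fun θ : ℝ => ((n * θ : ℝ) : ℂ) * Complex.I) (n * Complex.I) θ := by
        have := (((hasDerivAt_id θ).const_mul (n : ℝ)).ofReal_comp).mul_const Complex.I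
        simpa using this
      have := h2.cexp
      rwa [mul_comm] at this
    have hb : HasDerivAt (fun θ : ℝ => -(Complex.I * lam * (Real.sin θ : ℂ)))
        (-(Complex.I * lam * Real.cos θ)) θ :=
      (((Real.hasDerivAt_sin θ).ofReal_comp).const_mul _).neg
    exact ha.div hb (hden θ hθ)
  have hdv : ∀ θ ∈ uIcc η (Real.pi - η), HasDerivAt v (v' θ) θ := by
    intro θ _
    have h2 : HasDerivAt (fun θ : ℝ => ((lam * Real.cos θ : ℝ) : ℂ) * Complex.I)
        (-(Complex.I * lam * Real.sin θ)) θ := by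
      have := (((Real.hasDerivAt_cos θ).const_mul lam).ofReal_comp).mul_const Complex.I
      refine this.congr_deriv ?_
      push_cast
      ring
    exact h2.cexp
  have hcu' : ContinuousOn u' (uIcc η (Real.pi - η)) := by
    refine ContinuousOn.div (by fun_prop) (by fun_prop) fun θ hθ => pow_ne_zero 2 (hden θ hθ)
  have hparts := intervalIntegral.integral_mul_deriv_eq_deriv_mul hdu hdv
    hcu'.intervalIntegrable (Continuous.intervalIntegrable (by fun_prop) _ _)
  have hint : ∫ θ in η..(Real.pi - η),
      Complex.exp (((n * θ + lam * Real.cos θ : ℝ) : ℂ) * Complex.I)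
      = ∫ θ in η..(Real.pi - η), u θ * v' θ := by
    refine intervalIntegral.integral_congr fun θ hθ => ?_
    simp only [hu, hv']
    rw [div_mul_eq_mul_div, eq_div_iff (hden θ hθ), ← mul_assoc, ← Complex.exp_add]
    congr 2
    push_cast
    ring
  have hnd : ∀ θ ∈ uIcc η (Real.pi - η), ‖-(Complex.I * lam * (Real.sin θ : ℂ))‖
      = lam * Real.sin θ := fun θ hθ => by
    rw [norm_neg, norm_mul, norm_mul, Complex.norm_I, one_mul, Complex.norm_real,
      Complex.norm_real, Real.norm_of_nonneg hl.le, Real.norm_of_nonneg (hs θ hθ).le]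
  have hsη := hs η left_mem_uIcc
  have hnuv : ∀ θ ∈ uIcc η (Real.pi - η), ‖u θ * v θ‖ = 1 / (lam * Real.sin θ) := fun θ hθ => by
    rw [norm_mul, hu, hv]
    simp only
    rw [norm_div, Complex.norm_exp_ofReal_mul_I, Complex.norm_exp_ofReal_mul_I, mul_one, hnd θ hθ]
  obtain ⟨hii, hile⟩ := integral_inv_sin_sq h0 h1
  have hbd : ‖∫ θ in η..(Real.pi - η), u' θ * v θ‖ ≤
      ∫ θ in η..(Real.pi - η), (|(n : ℝ)| + 1) / lam * (1 / Real.sin θ ^ 2) := by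
    refine intervalIntegral.norm_integral_le_of_norm_le (by linarith) (.of_forall fun θ hθ => ?_)
      (hii.const_mul _)
    have hθ' : θ ∈ uIcc η (Real.pi - η) := by
      rw [uIcc_of_le (by linarith)]
      exact Ioc_subset_Icc_self hθ
    have hsp := hs θ hθ'
    rw [norm_mul, hu', hv]
    simp only
    rw [Complex.norm_exp_ofReal_mul_I, mul_one, norm_div, norm_pow, hnd θ hθ']
    have hnum : ‖(n * Complex.I * Complex.exp ((n * θ : ℝ) * Complex.I) *
        (-(Complex.I * lam * Real.sin θ)) - Complex.exp ((n * θ : ℝ) * Complex.I) *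
        (-(Complex.I * lam * Real.cos θ)))‖ ≤ |(n : ℝ)| * lam + lam := by
      refine (norm_sub_le _ _).trans (add_le_add ?_ ?_)
      · rw [norm_mul, hnd θ hθ', norm_mul, norm_mul, Complex.norm_exp_ofReal_mul_I, Complex.norm_I,
          Complex.norm_intCast, mul_one, mul_one]
        refine mul_le_mul_of_nonneg_left ?_ (abs_nonneg _)
        nlinarith [Real.sin_le_one θ]
      · rw [norm_mul, Complex.norm_exp_ofReal_mul_I, one_mul, norm_neg, norm_mul, norm_mul,
          Complex.norm_I, one_mul, Complex.norm_real, Complex.norm_real,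
          Real.norm_of_nonneg hl.le, Real.norm_eq_abs]
        nlinarith [Real.abs_cos_le_one θ]
    refine (div_le_div_of_nonneg_right hnum (by positivity)).trans (le_of_eq ?_)
    field_simp
  rw [hint, hparts]
  have h3 : ∫ θ in η..(Real.pi - η), (|(n : ℝ)| + 1) / lam * (1 / Real.sin θ ^ 2) ≤
      (|(n : ℝ)| + 1) / lam * (2 / Real.sin η) := by
    rw [intervalIntegral.integral_const_mul]
    exact mul_le_mul_of_nonneg_left hile (by positivity)
  refine (norm_sub_le _ _).trans ((add_le_add (norm_sub_le _ _) (hbd.trans h3)).trans ?_)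
  rw [hnuv _ right_mem_uIcc, hnuv _ left_mem_uIcc, Real.sin_pi_sub]
  apply le_of_eq
  field_simp
  ring

lemma norm_integral_half_le (n : ℤ) {lam : ℝ} (hl : 1 ≤ lam) :
    ‖∫ θ in (0 : ℝ)..Real.pi,
      Complex.exp (((n * θ + lam * Real.cos θ : ℝ) : ℂ) * Complex.I)‖ ≤
      9 * (|(n : ℝ)| + 1) / √lam := by
  have hpi := Real.pi_gt_three
  have hpi' := Real.pi_lt_d2
  have hsq : 1 ≤ √lam := Real.one_le_sqrt.2 hl
  -- At this cut the trivial bound `η` for the two end pieces balances the bound of order `1/(λη)`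
  -- for the middle.
  set η := 1 / √lam with hη
  have h0 : 0 < η := by positivity
  have h1 : η ≤ 1 := (div_le_one (by linarith)).2 hsq
  have hc : ∀ a b : ℝ, IntervalIntegrable (fun θ : ℝ =>
      Complex.exp (((n * θ + lam * Real.cos θ : ℝ) : ℂ) * Complex.I)) volume a b := fun a b =>
    Continuous.intervalIntegrable (by fun_prop) _ _
  rw [← intervalIntegral.integral_add_adjacent_intervals (hc 0 η) (hc η Real.pi),
    ← intervalIntegral.integral_add_adjacent_intervals (hc η (Real.pi - η)) (hc _ Real.pi)]
  have hsmall : ∀ a b : ℝ, ‖∫ θ in a..b,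
      Complex.exp (((n * θ + lam * Real.cos θ : ℝ) : ℂ) * Complex.I)‖ ≤ 1 * |b - a| :=
    fun a b => intervalIntegral.norm_integral_le_of_norm_le_const fun θ _ => by
      rw [Complex.norm_exp_ofReal_mul_I]
  have e1 := hsmall 0 η
  have e2 := hsmall (Real.pi - η) Real.pi
  have e3 := norm_integral_middle_le n (by linarith) h0 h1 (lam := lam)
  rw [sub_zero, abs_of_pos h0, one_mul] at e1
  rw [sub_sub_cancel, abs_of_pos h0, one_mul] at e2
  have e4 : (2 * (|(n : ℝ)| + 1) + 2) / (lam * Real.sin η) ≤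
      (2 * (|(n : ℝ)| + 1) + 2) * (Real.pi / 2) * η := by
    have hsin : 2 / Real.pi * η ≤ Real.sin η := Real.mul_le_sin h0.le (by linarith)
    have hsp : 0 < 2 / Real.pi * η := by positivity
    rw [mul_assoc, div_eq_mul_inv]
    refine mul_le_mul_of_nonneg_left ?_ (by positivity)
    have hle : lam * (2 / Real.pi * η) ≤ lam * Real.sin η :=
      mul_le_mul_of_nonneg_left hsin (by linarith)
    refine (inv_anti₀ (by positivity) hle).trans (le_of_eq ?_)
    have : lam = 1 / η ^ 2 := by
      rw [hη, div_pow, Real.sq_sqrt (by linarith)]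
      simp
    rw [this]
    field_simp
  refine (norm_add_le _ _).trans ((add_le_add le_rfl (norm_add_le _ _)).trans ?_)
  have e5 : 9 * (|(n : ℝ)| + 1) / √lam = 9 * (|(n : ℝ)| + 1) * η := by
    rw [hη]
    ring
  rw [e5]
  have hn : 0 ≤ |(n : ℝ)| * η := by positivity
  nlinarith

/-- Stationary phase, at a cost linear in the order. Five such factors decay like `|ξ|^(-5/2)`,
which is integrable on the plane with room to spare. -/
lemma norm_circFT_le (n : ℤ) (ξ : ℂ) :
    ‖circFT n ξ‖ ≤ 18 * (1 + |(n : ℝ)|) * (1 + ‖ξ‖) ^ (-(1 / 2) : ℝ) := by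
  have hpi := Real.pi_gt_three
  have hpi' := Real.pi_lt_d2
  have hx := norm_nonneg ξ
  rw [Real.rpow_neg (by positivity), ← Real.sqrt_eq_rpow, ← div_eq_mul_inv]
  have hs : 0 < √(1 + ‖ξ‖) := Real.sqrt_pos.2 (by positivity)
  rcases le_or_gt 1 ‖ξ‖ with h | h
  · rw [norm_circFT_eq]
    have hc : ∀ a b : ℝ, IntervalIntegrable (fun θ : ℝ =>
        Complex.exp (((n * θ + 2 * Real.pi * ‖ξ‖ * Real.cos θ : ℝ) : ℂ) * Complex.I))
        volume a b := fun a b => Continuous.intervalIntegrable (by fun_prop) _ _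
    rw [← intervalIntegral.integral_add_adjacent_intervals (hc _ 0) (hc 0 _)]
    have hl : 1 ≤ 2 * Real.pi * ‖ξ‖ := by nlinarith
    have e1 := norm_integral_half_le n hl
    have e2 := norm_integral_half_le (-n) hl
    have e3 : ∫ θ in (-Real.pi)..0,
        Complex.exp (((n * θ + 2 * Real.pi * ‖ξ‖ * Real.cos θ : ℝ) : ℂ) * Complex.I) =
        ∫ θ in (0 : ℝ)..Real.pi, Complex.exp
          ((((-n : ℤ) * θ + 2 * Real.pi * ‖ξ‖ * Real.cos θ : ℝ) : ℂ) * Complex.I) := by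
      have := intervalIntegral.integral_comp_neg (a := 0) (b := Real.pi) (fun θ : ℝ =>
        Complex.exp (((n * θ + 2 * Real.pi * ‖ξ‖ * Real.cos θ : ℝ) : ℂ) * Complex.I))
      rw [neg_zero] at this
      rw [← this]
      refine intervalIntegral.integral_congr fun θ _ => ?_
      simp
    rw [e3]
    rw [show |((-n : ℤ) : ℝ)| = |(n : ℝ)| by simp] at e2
    refine (norm_add_le _ _).trans ((add_le_add e2 e1).trans ?_)
    have h5 : √(1 + ‖ξ‖) ≤ √(2 * Real.pi * ‖ξ‖) := Real.sqrt_le_sqrt (by nlinarith)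
    have h6 : 9 * (|(n : ℝ)| + 1) / √(2 * Real.pi * ‖ξ‖) ≤ 9 * (|(n : ℝ)| + 1) / √(1 + ‖ξ‖) :=
      div_le_div_of_nonneg_left (by positivity) hs h5
    have h7 : 18 * (1 + |(n : ℝ)|) / √(1 + ‖ξ‖) = 9 * (|(n : ℝ)| + 1) / √(1 + ‖ξ‖) +
      9 * (|(n : ℝ)| + 1) / √(1 + ‖ξ‖) := by ring
    linarith
  · refine (norm_circFT_le_two_pi n ξ).trans ?_
    rw [le_div_iff₀ hs]
    have : √(1 + ‖ξ‖) ≤ 2 := Real.sqrt_le_iff.2 ⟨by norm_num, by linarith⟩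
    nlinarith [abs_nonneg (n : ℝ)]

/-! ### Decay that is uniform in the order of the character, and decay in the order itself. -/

lemma exp_ofReal_mul_I_mul_conj (a b : ℝ) :
    Complex.exp (a * Complex.I) * (starRingEnd ℂ) (Complex.exp (b * Complex.I))
      = Complex.exp ((a - b : ℝ) * Complex.I) := by
  rw [← Complex.exp_conj, ← Complex.exp_add]
  congr 1
  simp
  ring

/-- Substituting `z ↦ yz` in the double integral over `z` and `y` collapses the characters to `z ^
n` and turns the phase into `⟨y, conj(z - 1)ξ⟩`. The `y` integral is then the order-zero transform,
whose decay does not involve `n`. -/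
lemma circFT_mul_conj (n : ℤ) (ξ : ℂ) :
    circFT n ξ * (starRingEnd ℂ) (circFT n ξ) =
      ∫ z : Circle, (z : ℂ) ^ n * circFT 0 ((starRingEnd ℂ) ((z : ℂ) - 1) * ξ) ∂arc := by
  have h1 : ∀ y : Circle, circFT n ξ * (starRingEnd ℂ) ((y : ℂ) ^ n *
      Complex.exp (((2 * Real.pi * inner ℝ (y : ℂ) ξ : ℝ) : ℂ) * Complex.I)) =
      ∫ z : Circle, (z : ℂ) ^ n * Complex.exp (((2 * Real.pi *
        inner ℝ (y : ℂ) ((starRingEnd ℂ) ((z : ℂ) - 1) * ξ) : ℝ) : ℂ) * Complex.I) ∂arc := by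
    intro y
    rw [circFT, ← integral_mul_const, ← integral_mul_left_eq_self _ y]
    refine integral_congr_ae (.of_forall fun z => ?_)
    simp only [Circle.coe_mul, map_mul]
    have h2 : ((y : ℂ) * z) ^ n * (starRingEnd ℂ) ((y : ℂ) ^ n) = (z : ℂ) ^ n := by
      rw [mul_zpow, mul_right_comm, Complex.mul_conj, Complex.normSq_eq_norm_sq, norm_circle_zpow]
      simp
    have h3 : inner ℝ ((y : ℂ) * z) ξ - inner ℝ (y : ℂ) ξ
        = inner ℝ (y : ℂ) ((starRingEnd ℂ) ((z : ℂ) - 1) * ξ) := by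
      simp only [Complex.inner, map_mul, map_sub, Complex.mul_re, Complex.mul_im, Complex.conj_re,
        Complex.conj_im, Complex.sub_re, Complex.sub_im, map_one, Complex.one_re, Complex.one_im]
      ring
    calc _ = ((y : ℂ) * z) ^ n * (starRingEnd ℂ) ((y : ℂ) ^ n) *
          (Complex.exp (((2 * Real.pi * inner ℝ ((y : ℂ) * z) ξ : ℝ) : ℂ) * Complex.I) *
          (starRingEnd ℂ) (Complex.exp (((2 * Real.pi * inner ℝ (y : ℂ) ξ : ℝ) : ℂ) *
            Complex.I))) := by ring
      _ = _ := by
        rw [h2, exp_ofReal_mul_I_mul_conj, ← mul_sub, h3]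
  have h4 : circFT n ξ * (starRingEnd ℂ) (circFT n ξ) = ∫ y : Circle, circFT n ξ *
      (starRingEnd ℂ) ((y : ℂ) ^ n *
        Complex.exp (((2 * Real.pi * inner ℝ (y : ℂ) ξ : ℝ) : ℂ) * Complex.I)) ∂arc := by
    rw [integral_const_mul, integral_conj]
    rfl
  rw [h4, integral_congr_ae (.of_forall h1), integral_integral_swap]
  · refine integral_congr_ae (.of_forall fun z => ?_)
    simp only
    rw [integral_const_mul, circFT]
    simp
  · refine integrable_of_continuous (Continuous.mul ?_ ?_)
    · exact (continuous_circle_zpow n).comp continuous_snd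
    · fun_prop

/-- In the autocorrelation identity the integrand is at most `18 (|z - 1||ξ|)^(-1/2)`, integrable in
`z` uniformly in `n`. Taking the square root leaves half of the exponent `1/2`. -/
lemma exists_norm_circFT_le_uniform :
    ∃ C : ℝ, 1 ≤ C ∧ ∀ (n : ℤ) (ξ : ℂ), ‖circFT n ξ‖ ≤ C * (1 + ‖ξ‖) ^ (-(1 / 4) : ℝ) := by
  obtain ⟨C, hC, hb⟩ := exists_lintegral_chord_rpow_le (τ := 1 / 2) (by norm_num) (by norm_num)
  have hpi' := Real.pi_lt_d2
  refine ⟨14 + √(36 * C), by linarith [Real.sqrt_nonneg (36 * C)], fun n ξ => ?_⟩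
  rw [Real.rpow_neg (by positivity), ← div_eq_mul_inv]
  have hx := norm_nonneg ξ
  have hs := Real.sqrt_nonneg (36 * C)
  rcases le_or_gt 1 ‖ξ‖ with h | h
  · have hsq : ‖circFT n ξ‖ ^ 2 ≤ 18 * C * ‖ξ‖ ^ (-(1 / 2) : ℝ) := by
      have h1 : ‖circFT n ξ‖ ^ 2 = ‖∫ z : Circle, (z : ℂ) ^ n *
          circFT 0 ((starRingEnd ℂ) ((z : ℂ) - 1) * ξ) ∂arc‖ := by
        rw [← circFT_mul_conj, norm_mul, RCLike.norm_conj, sq]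
      rw [h1]
      have h2 := enorm_integral_le_lintegral_enorm (μ := arc) (fun z : Circle => (z : ℂ) ^ n *
          circFT 0 ((starRingEnd ℂ) ((z : ℂ) - 1) * ξ))
      rw [← ENNReal.ofReal_le_ofReal_iff (by positivity), ofReal_norm]
      refine h2.trans ?_
      have h3 : ∀ z : Circle, ‖(z : ℂ) ^ n * circFT 0 ((starRingEnd ℂ) ((z : ℂ) - 1) * ξ)‖ₑ ≤
          ENNReal.ofReal (18 * ‖ξ‖ ^ (-(1 / 2) : ℝ)) *
            (ENNReal.ofReal ‖(z : ℂ) - (1 : Circle)‖) ^ (-(1 / 2) : ℝ) := by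
        intro z
        rw [Circle.coe_one]
        rcases (norm_nonneg ((z : ℂ) - 1)).eq_or_lt with h0 | h0
        · rw [← h0, ENNReal.ofReal_zero, ENNReal.zero_rpow_of_neg (by norm_num), ENNReal.mul_top]
          · exact le_top
          · have : 0 < 18 * ‖ξ‖ ^ (-(1 / 2) : ℝ) := by positivity
            simpa using this
        · rw [ENNReal.ofReal_rpow_of_pos h0, ← ENNReal.ofReal_mul (by positivity), ← ofReal_norm]
          apply ENNReal.ofReal_le_ofReal
          rw [norm_mul, norm_circle_zpow, one_mul, mul_assoc, ← Real.mul_rpow hx h0.le]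
          refine (norm_circFT_le _ _).trans ?_
          rw [norm_mul, RCLike.norm_conj, Int.cast_zero, abs_zero, add_zero, mul_one,
            mul_comm ‖ξ‖]
          refine mul_le_mul_of_nonneg_left ?_ (by norm_num)
          apply Real.rpow_le_rpow_of_nonpos (by positivity) (by linarith) (by norm_num)
      refine (lintegral_mono h3).trans ?_
      rw [lintegral_const_mul' _ _ ENNReal.ofReal_ne_top]
      refine (mul_le_mul_right (hb 1) _).trans (le_of_eq ?_)
      rw [← ENNReal.ofReal_mul (by positivity)]
      congr 1
      ring
    have h5 : ‖circFT n ξ‖ * (1 + ‖ξ‖) ^ (1 / 4 : ℝ) ≤ √(36 * C) := by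
      apply Real.le_sqrt_of_sq_le
      rw [mul_pow, ← Real.rpow_natCast ((1 + ‖ξ‖) ^ (1 / 4 : ℝ)), ← Real.rpow_mul (by positivity)]
      norm_num
      have h6 : (1 + ‖ξ‖) ^ (1 / 2 : ℝ) ≤ 2 * ‖ξ‖ ^ (1 / 2 : ℝ) := by
        have : (2 : ℝ) * ‖ξ‖ ^ (1 / 2 : ℝ) = (4 * ‖ξ‖) ^ (1 / 2 : ℝ) := by
          rw [Real.mul_rpow (by norm_num) hx, ← Real.sqrt_eq_rpow 4,
            show (4 : ℝ) = 2 ^ 2 by norm_num, Real.sqrt_sq (by norm_num)]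
        rw [this]
        exact Real.rpow_le_rpow (by positivity) (by linarith) (by norm_num)
      have h7 : ‖ξ‖ ^ (-(1 / 2) : ℝ) * ‖ξ‖ ^ (1 / 2 : ℝ) = 1 := by
        rw [← Real.rpow_add (by linarith)]
        norm_num
      calc ‖circFT n ξ‖ ^ 2 * (1 + ‖ξ‖) ^ (1 / 2 : ℝ)
          ≤ (18 * C * ‖ξ‖ ^ (-(1 / 2) : ℝ)) * (2 * ‖ξ‖ ^ (1 / 2 : ℝ)) :=
            mul_le_mul hsq h6 (by positivity) (by positivity)
        _ = 36 * C * (‖ξ‖ ^ (-(1 / 2) : ℝ) * ‖ξ‖ ^ (1 / 2 : ℝ)) := by ring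
        _ = 36 * C := by rw [h7, mul_one]
    rw [le_div_iff₀ (by positivity)]
    linarith
  · refine (norm_circFT_le_two_pi n ξ).trans ?_
    rw [le_div_iff₀ (by positivity)]
    have : (1 + ‖ξ‖) ^ (1 / 4 : ℝ) ≤ 2 := by
      refine (Real.rpow_le_rpow_of_exponent_le (by linarith) (show (1 / 4 : ℝ) ≤ 1 by norm_num)).trans ?_
      rw [Real.rpow_one]
      linarith
    nlinarith [Real.pi_pos]

lemma norm_exp_ofReal_mul_I_sub_le (a b : ℝ) :
    ‖Complex.exp (a * Complex.I) - Complex.exp (b * Complex.I)‖ ≤ |a - b| := by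
  have : Complex.exp (a * Complex.I) - Complex.exp (b * Complex.I) =
      Complex.exp (b * Complex.I) * (Complex.exp (Complex.I * (a - b : ℝ)) - 1) := by
    rw [mul_sub, ← Complex.exp_add, mul_one]
    congr 2
    push_cast
    ring
  rw [this, norm_mul, Complex.norm_exp_ofReal_mul_I, one_mul]
  exact Real.norm_exp_I_mul_ofReal_sub_one_le

/-- Rotation by `w = e^{iπ/n}` reverses the sign of `z ^ n`, so `2 circFT n ξ = circFT n ξ - circFT
n (wξ)`, and `wξ` differs from `ξ` by at most `π|ξ|/|n|`. -/
lemma norm_circFT_le_div (n : ℤ) (hn : n ≠ 0) (ξ : ℂ) :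
    ‖circFT n ξ‖ ≤ 2 * Real.pi ^ 3 * ‖ξ‖ / |(n : ℝ)| := by
  have hnR : (n : ℝ) ≠ 0 := by exact_mod_cast hn
  have hpi := Real.pi_pos
  set w := Circle.exp (Real.pi / n) with hw
  have hwn : (w : ℂ) ^ n = -1 := by
    rw [hw, Circle.coe_exp, ← Complex.exp_int_mul, ← Complex.exp_pi_mul_I]
    congr 1
    push_cast
    field_simp
  have h1 : (2 : ℂ) * circFT n ξ = circFT n ξ - circFT n (w * ξ) := by
    rw [circFT_mul, hwn]
    ring
  have h2 : ‖circFT n ξ - circFT n (w * ξ)‖ ≤ (2 * Real.pi * (Real.pi / |(n : ℝ)| * ‖ξ‖)) *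
      (2 * Real.pi) := by
    rw [circFT, circFT, ← integral_sub (integrable_of_continuous (by fun_prop))
      (integrable_of_continuous (by fun_prop))]
    refine (norm_integral_le_of_norm_le_const (.of_forall fun z => ?_)).trans
      (le_of_eq (by rw [measureReal_def, arc_univ, ENNReal.toReal_ofReal Real.two_pi_pos.le]))
    rw [← mul_sub, norm_mul, norm_circle_zpow, one_mul]
    refine (norm_exp_ofReal_mul_I_sub_le _ _).trans ?_
    rw [← mul_sub, ← inner_sub_right, abs_mul, abs_of_pos Real.two_pi_pos]
    refine mul_le_mul_of_nonneg_left ?_ Real.two_pi_pos.le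
    refine (abs_real_inner_le_norm _ _).trans ?_
    rw [Circle.norm_coe, one_mul, show ξ - w * ξ = (1 - w) * ξ by ring, norm_mul]
    refine mul_le_mul_of_nonneg_right ?_ (norm_nonneg _)
    have := norm_exp_ofReal_mul_I_sub_le 0 (Real.pi / n)
    rw [Complex.ofReal_zero, zero_mul, Complex.exp_zero, zero_sub, abs_neg, abs_div,
      abs_of_pos hpi] at this
    rw [hw, Circle.coe_exp]
    exact this
  have h3 : 2 * ‖circFT n ξ‖ ≤ (2 * Real.pi * (Real.pi / |(n : ℝ)| * ‖ξ‖)) * (2 * Real.pi) := by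
    rw [← h1, norm_mul] at h2
    simpa using h2
  have h4 : (2 * Real.pi * (Real.pi / |(n : ℝ)| * ‖ξ‖)) * (2 * Real.pi) =
      2 * (2 * Real.pi ^ 3 * ‖ξ‖ / |(n : ℝ)|) := by ring
  linarith

/-- Geometric mean of the bounds `(1 + |ξ|)/(1 + |n|)` and `(1 + |ξ|)^(-1/4)` with weights `1/10`
and `9/10`; the exponent of `1 + |ξ|` is `1/10 - 9/40 = -1/8`. -/
lemma exists_norm_circFT_le_mixed :
    ∃ C : ℝ, 1 ≤ C ∧ ∀ (n : ℤ) (ξ : ℂ), ‖circFT n ξ‖ ≤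
      C * (1 + |(n : ℝ)|) ^ (-(1 / 10) : ℝ) * (1 + ‖ξ‖) ^ (-(1 / 8) : ℝ) := by
  obtain ⟨C, hC, hb⟩ := exists_norm_circFT_le_uniform
  have hpi := Real.pi_gt_three
  set D := max C (4 * Real.pi ^ 3) with hD
  have hD1 : 1 ≤ D := hC.trans (le_max_left _ _)
  refine ⟨D, hD1, fun n ξ => ?_⟩
  have hx := norm_nonneg ξ
  rcases eq_or_ne n 0 with rfl | hn
  · refine (hb _ _).trans ?_
    simp only [Int.cast_zero, abs_zero, add_zero, Real.one_rpow, mul_one]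
    refine mul_le_mul (le_max_left _ _) ?_ (by positivity) (by positivity)
    exact Real.rpow_le_rpow_of_exponent_le (by linarith) (by norm_num)
  · have hn1 : 1 ≤ |(n : ℝ)| := by
      exact_mod_cast Int.one_le_abs hn
    have h1 : ‖circFT n ξ‖ ≤ D * ((1 + ‖ξ‖) * (1 + |(n : ℝ)|)⁻¹) := by
      refine (norm_circFT_le_div n hn ξ).trans ?_
      rw [← div_eq_mul_inv, ← mul_div_assoc, div_le_div_iff₀ (by positivity) (by positivity)]
      have h2 : 4 * Real.pi ^ 3 ≤ D := le_max_right _ _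
      have h3 : 0 < Real.pi ^ 3 := by positivity
      calc 2 * Real.pi ^ 3 * ‖ξ‖ * (1 + |(n : ℝ)|) ≤ 2 * Real.pi ^ 3 * (1 + ‖ξ‖) * (2 * |(n : ℝ)|) := by
            gcongr <;> linarith
        _ = 4 * Real.pi ^ 3 * (1 + ‖ξ‖) * |(n : ℝ)| := by ring
        _ ≤ D * (1 + ‖ξ‖) * |(n : ℝ)| := by gcongr
    have h2 : ‖circFT n ξ‖ ≤ D * (1 + ‖ξ‖) ^ (-(1 / 4) : ℝ) :=
      (hb n ξ).trans (mul_le_mul_of_nonneg_right (le_max_left _ _) (by positivity))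
    have h3 : ‖circFT n ξ‖ = ‖circFT n ξ‖ ^ (1 / 10 : ℝ) * ‖circFT n ξ‖ ^ (9 / 10 : ℝ) := by
      rw [← Real.rpow_add_of_nonneg (norm_nonneg _) (by norm_num) (by norm_num)]
      norm_num
    rw [h3]
    calc ‖circFT n ξ‖ ^ (1 / 10 : ℝ) * ‖circFT n ξ‖ ^ (9 / 10 : ℝ)
        ≤ (D * ((1 + ‖ξ‖) * (1 + |(n : ℝ)|)⁻¹)) ^ (1 / 10 : ℝ) *
          (D * (1 + ‖ξ‖) ^ (-(1 / 4) : ℝ)) ^ (9 / 10 : ℝ) := by gcongr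
      _ = (D ^ (1 / 10 : ℝ) * D ^ (9 / 10 : ℝ)) * (1 + |(n : ℝ)|) ^ (-(1 / 10) : ℝ) *
          ((1 + ‖ξ‖) ^ (1 / 10 : ℝ) * ((1 + ‖ξ‖) ^ (-(1 / 4) : ℝ)) ^ (9 / 10 : ℝ)) := by
        rw [Real.mul_rpow (by positivity) (by positivity),
          Real.mul_rpow (by positivity) (by positivity),
          Real.mul_rpow (by positivity) (by positivity), Real.inv_rpow (by positivity),
          Real.rpow_neg (by positivity : 0 ≤ 1 + |(n : ℝ)|)]
        ring
      _ = _ := by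
        rw [← Real.rpow_add (by linarith), ← Real.rpow_mul (by positivity),
          ← Real.rpow_add (by positivity)]
        norm_num

/-! ### The fivefold convolution of characters -/

open scoped FourierTransform SchwartzMap

/-- The product of five copies of arc length measure. -/
noncomputable abbrev arc5 : Measure (Fin 5 → Circle) := Measure.pi fun _ => arc

/-- The product of five Fourier transforms of characters. -/
noncomputable def prodFT (ν : Fin 5 → ℤ) (ξ : ℂ) : ℂ := ∏ i, circFT (ν i) ξ

/-- The density of the convolution of the measures `z ^ ν i dσ`, `i < 5`. -/
noncomputable def charDensity (ν : Fin 5 → ℤ) : ℂ → ℂ := 𝓕 (prodFT ν)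

@[fun_prop]
lemma continuous_circFT (n : ℤ) : Continuous (circFT n) := by
  refine continuous_of_dominated (bound := fun _ => 1) (fun ξ => ?_) (fun ξ => ?_)
    (integrable_const _) (.of_forall fun z => by fun_prop)
  · exact Continuous.aestronglyMeasurable (by fun_prop)
  · refine .of_forall fun z => ?_
    rw [norm_mul, norm_circle_zpow, Complex.norm_exp_ofReal_mul_I, one_mul]

lemma continuous_prodFT (ν : Fin 5 → ℤ) : Continuous (prodFT ν) := by
  unfold prodFT
  fun_prop

lemma integrable_one_add_norm_rpow {s : ℝ} (hs : s < -2) :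
    Integrable (fun ξ : ℂ => (1 + ‖ξ‖) ^ s) := by
  have := integrable_one_add_norm (E := ℂ) (μ := volume) (r := -s)
    (by rw [Complex.finrank_real_complex]; norm_num; linarith)
  simpa using this

lemma norm_prodFT_le (ν : Fin 5 → ℤ) (ξ : ℂ) :
    ‖prodFT ν ξ‖ ≤ 18 ^ 5 * (∏ i, (1 + |(ν i : ℝ)|)) * (1 + ‖ξ‖) ^ (-(5 / 2) : ℝ) := by
  rw [prodFT, norm_prod]
  refine (Finset.prod_le_prod (fun _ _ => norm_nonneg _) fun i _ => norm_circFT_le (ν i) ξ).trans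
    (le_of_eq ?_)
  rw [Finset.prod_mul_distrib, Finset.prod_mul_distrib, Finset.prod_const, Finset.prod_const,
    Finset.card_univ, Fintype.card_fin, ← Real.rpow_natCast ((1 + ‖ξ‖) ^ _),
    ← Real.rpow_mul (by positivity)]
  norm_num

lemma integrable_prodFT (ν : Fin 5 → ℤ) : Integrable (prodFT ν) := by
  refine ((integrable_one_add_norm_rpow (s := -(5 / 2)) (by norm_num)).const_mul
    (18 ^ 5 * (∏ i, (1 + |(ν i : ℝ)|)))).mono' (continuous_prodFT ν).aestronglyMeasurable
    (.of_forall fun ξ => norm_prodFT_le ν ξ)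

lemma continuous_charDensity (ν : Fin 5 → ℤ) : Continuous (charDensity ν) :=
  VectorFourier.fourierIntegral_continuous Real.continuous_fourierChar
    (by exact continuous_inner) (integrable_prodFT ν)

lemma integral_fourier_mul_prodFT (ν : Fin 5 → ℤ) (φ : 𝓢(ℂ, ℂ)) :
    ∫ ξ, 𝓕 (φ : ℂ → ℂ) ξ * prodFT ν ξ = ∫ y, φ y * charDensity ν y := by
  have := VectorFourier.integral_fourierIntegral_smul_eq_flip (L := innerₗ ℂ)
    Real.continuous_fourierChar continuous_inner φ.integrable (integrable_prodFT ν) (μ := volume)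
  rw [flip_innerₗ] at this
  exact this

/-- Writing `φ` by Fourier inversion and applying Fubini factors the left side into five transforms.
This justifies calling `charDensity` the density of the convolution. -/
lemma integral_char_mul_schwartz (ν : Fin 5 → ℤ) (φ : 𝓢(ℂ, ℂ)) :
    ∫ ω, (∏ i, (ω i : ℂ) ^ ν i) * φ (∑ i, (ω i : ℂ)) ∂arc5 = ∫ y, φ y * charDensity ν y := by
  rw [← integral_fourier_mul_prodFT]
  have hF : Integrable (𝓕 (φ : ℂ → ℂ)) := by
    rw [← SchwartzMap.fourier_coe]
    exact (𝓕 φ).integrable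
  have hFc : Continuous (𝓕 (φ : ℂ → ℂ)) := by
    rw [← SchwartzMap.fourier_coe]
    exact (𝓕 φ).continuous
  have hinv : ∀ y, φ y = ∫ ξ, Complex.exp (((2 * Real.pi * inner ℝ ξ y : ℝ) : ℂ) * Complex.I) *
      𝓕 (φ : ℂ → ℂ) ξ := by
    intro y
    have := congrFun (φ.continuous.fourierInv_fourier_eq φ.integrable hF) y
    rw [← this, Real.fourierInv_eq']
    simp
  have h1 : ∀ ω : Fin 5 → Circle, (∏ i, (ω i : ℂ) ^ ν i) * φ (∑ i, (ω i : ℂ)) =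
      ∫ ξ, 𝓕 (φ : ℂ → ℂ) ξ * ∏ i, ((ω i : ℂ) ^ ν i *
        Complex.exp (((2 * Real.pi * inner ℝ (ω i : ℂ) ξ : ℝ) : ℂ) * Complex.I)) := by
    intro ω
    rw [hinv, ← integral_const_mul]
    refine integral_congr_ae (.of_forall fun ξ => ?_)
    beta_reduce
    rw [Finset.prod_mul_distrib, ← Complex.exp_sum, ← Finset.sum_mul, ← Complex.ofReal_sum,
      ← Finset.mul_sum, ← sum_inner, real_inner_comm]
    ring
  rw [integral_congr_ae (.of_forall h1), integral_integral_swap]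
  · refine integral_congr_ae (.of_forall fun ξ => ?_)
    beta_reduce
    rw [integral_const_mul]
    congr 1
    exact integral_fintype_prod_eq_prod (fun i (z : Circle) => (z : ℂ) ^ ν i *
        Complex.exp (((2 * Real.pi * inner ℝ (z : ℂ) ξ : ℝ) : ℂ) * Complex.I))
  · refine (hF.norm.comp_snd arc5).mono' ?_ (.of_forall fun p => ?_)
    · refine Continuous.aestronglyMeasurable ?_
      refine (hFc.comp continuous_snd).mul (continuous_finsetProd _ fun i _ => Continuous.mul ?_ ?_)
      · exact (continuous_circle_zpow (ν i)).comp ((continuous_apply i).comp continuous_fst)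
      · have : Continuous fun p : (Fin 5 → Circle) × ℂ => (p.1 i : ℂ) := by
          fun_prop
        fun_prop
    · simp only [Function.uncurry]
      rw [norm_mul, norm_prod, Finset.prod_eq_one, mul_one]
      intro i _
      rw [norm_mul, norm_circle_zpow, Complex.norm_exp_ofReal_mul_I, one_mul]

/-- The convolution of the measures `f i dσ` evaluated on the disc of radius `r` about `x`. -/
noncomputable def convBall (f : Fin 5 → Circle → ℂ) (r : ℝ) (x : ℂ) : ℂ :=
  ∫ ω in {ω : Fin 5 → Circle | ∑ i, (ω i : ℂ) ∈ Metric.ball x r}, ∏ i, f i (ω i) ∂arc5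

@[fun_prop]
lemma measurable_sum_circle : Measurable fun ω : Fin 5 → Circle => ∑ i, (ω i : ℂ) := by
  fun_prop

lemma measurableSet_sum_mem_ball (x : ℂ) (r : ℝ) :
    MeasurableSet {ω : Fin 5 → Circle | ∑ i, (ω i : ℂ) ∈ Metric.ball x r} :=
  measurable_sum_circle measurableSet_ball

/-- Smooth approximations of the indicator of a disc from inside. -/
lemma exists_schwartz_tendsto_indicator_ball (x : ℂ) {r : ℝ} (hr : 0 < r) :
    ∃ φ : ℕ → 𝓢(ℂ, ℂ), (∀ k y, ‖φ k y‖ ≤ (Metric.ball x r).indicator (fun _ => (1 : ℝ)) y) ∧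
      ∀ y, Tendsto (fun k => φ k y) atTop (𝓝 ((Metric.ball x r).indicator (fun _ => (1 : ℂ)) y)) := by
  have hk : ∀ k : ℕ, 0 < r * (1 - 2 / (k + 3)) := fun k => by
    have : (2 : ℝ) / (k + 3) < 1 := by
      rw [div_lt_one (by positivity)]
      have : (0 : ℝ) ≤ k := k.cast_nonneg
      linarith
    exact mul_pos hr (by linarith)
  have hk2 : ∀ k : ℕ, r * (1 - 2 / (k + 3)) < r := fun k => by
    have : (0 : ℝ) < 2 / (k + 3) := by positivity
    nlinarith
  let b : ℕ → ContDiffBump x := fun k => ⟨r * (1 - 2 / (k + 3)), r, hk k, hk2 k⟩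
  have hcs : ∀ k, HasCompactSupport fun y => ((b k y : ℝ) : ℂ) := fun k =>
    (b k).hasCompactSupport.comp_left (g := fun t : ℝ => (t : ℂ)) Complex.ofReal_zero
  have hcd : ∀ k, ContDiff ℝ (⊤ : ℕ∞) fun y => ((b k y : ℝ) : ℂ) := fun k =>
    Complex.ofRealCLM.contDiff.comp (b k).contDiff
  have hzero : ∀ k y, y ∉ Metric.ball x r → b k y = 0 := fun k y hy =>
    (b k).zero_of_le_dist (by simpa using hy)
  refine ⟨fun k => (hcs k).toSchwartzMap (hcd k), fun k y => ?_, fun y => ?_⟩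
  · simp only [HasCompactSupport.toSchwartzMap_toFun, Complex.norm_real]
    rw [Real.norm_of_nonneg (b k).nonneg]
    by_cases hy : y ∈ Metric.ball x r
    · rw [indicator_of_mem hy]
      exact (b k).le_one
    · rw [indicator_of_notMem hy, hzero k y hy]
  · simp only [HasCompactSupport.toSchwartzMap_toFun]
    by_cases hy : y ∈ Metric.ball x r
    · rw [indicator_of_mem hy]
      refine tendsto_const_nhds.congr' ?_
      have hlim : Tendsto (fun k : ℕ => r * (1 - 2 / ((k : ℝ) + 3))) atTop (𝓝 (r * (1 - 0))) := by
        refine Tendsto.const_mul r (Tendsto.const_sub 1 ?_)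
        refine Tendsto.div_atTop tendsto_const_nhds ?_
        exact tendsto_atTop_add_const_right _ _ tendsto_natCast_atTop_atTop
      rw [sub_zero, mul_one] at hlim
      filter_upwards [hlim.eventually (lt_mem_nhds (Metric.mem_ball.1 hy))] with k hk'
      rw [(b k).one_of_mem_closedBall (Metric.mem_closedBall.2 hk'.le), Complex.ofReal_one]
    · rw [indicator_of_notMem hy]
      refine tendsto_const_nhds.congr fun k => ?_
      rw [hzero k y hy, Complex.ofReal_zero]

lemma continuous_prod_zpow (ν : Fin 5 → ℤ) :
    Continuous fun ω : Fin 5 → Circle => ∏ i, (ω i : ℂ) ^ ν i :=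
  continuous_finsetProd _ fun i _ => (continuous_circle_zpow (ν i)).comp (continuous_apply i)

lemma norm_prod_zpow (ν : Fin 5 → ℤ) (ω : Fin 5 → Circle) : ‖∏ i, (ω i : ℂ) ^ ν i‖ = 1 := by
  rw [norm_prod]
  exact Finset.prod_eq_one fun i _ => norm_circle_zpow _ _

lemma convBall_char (ν : Fin 5 → ℤ) (x : ℂ) {r : ℝ} (hr : 0 < r) :
    convBall (fun i z => (z : ℂ) ^ ν i) r x = ∫ y in Metric.ball x r, charDensity ν y := by
  obtain ⟨φ, hφb, hφt⟩ := exists_schwartz_tendsto_indicator_ball x hr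
  have hle1 : ∀ y, (Metric.ball x r).indicator (fun _ => (1 : ℝ)) y ≤ 1 := fun y =>
    indicator_le_self' (f := fun _ => (1 : ℝ)) (fun _ _ => zero_le_one) y
  have hL : Tendsto (fun k => ∫ ω, (∏ i, (ω i : ℂ) ^ ν i) * φ k (∑ i, (ω i : ℂ)) ∂arc5) atTop
      (𝓝 (∫ ω, (∏ i, (ω i : ℂ) ^ ν i) *
        (Metric.ball x r).indicator (fun _ => (1 : ℂ)) (∑ i, (ω i : ℂ)) ∂arc5)) := by
    refine tendsto_integral_of_dominated_convergence (fun _ => 1) (fun k => ?_) (integrable_const _)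
      (fun k => .of_forall fun ω => ?_) (.of_forall fun ω => (hφt _).const_mul _)
    · exact (continuous_prod_zpow ν).aestronglyMeasurable.mul
        ((φ k).continuous.measurable.comp measurable_sum_circle).aestronglyMeasurable
    · rw [norm_mul, norm_prod_zpow, one_mul]
      exact (hφb k _).trans (hle1 _)
  have hR : Tendsto (fun k => ∫ y, φ k y * charDensity ν y) atTop
      (𝓝 (∫ y, (Metric.ball x r).indicator (fun _ => (1 : ℂ)) y * charDensity ν y)) := by
    refine tendsto_integral_of_dominated_convergence
      (fun y => (Metric.ball x r).indicator (fun y => ‖charDensity ν y‖) y) (fun k => ?_) ?_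
      (fun k => .of_forall fun y => ?_) (.of_forall fun y => (hφt _).mul_const _)
    · exact ((φ k).continuous.mul (continuous_charDensity ν)).aestronglyMeasurable
    · rw [integrable_indicator_iff measurableSet_ball]
      exact ((continuous_charDensity ν).norm.continuousOn.integrableOn_compact
        (isCompact_closedBall x r)).mono_set Metric.ball_subset_closedBall
    · rw [norm_mul]
      refine (mul_le_mul_of_nonneg_right (hφb k y) (norm_nonneg _)).trans (le_of_eq ?_)
      by_cases hy : y ∈ Metric.ball x r
      · rw [indicator_of_mem hy, indicator_of_mem hy, one_mul]
      · rw [indicator_of_notMem hy, indicator_of_notMem hy, zero_mul]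
  have := tendsto_nhds_unique (hL.congr fun k => integral_char_mul_schwartz ν (φ k)) hR
  rw [convBall, ← integral_indicator (measurableSet_sum_mem_ball x r),
    ← integral_indicator measurableSet_ball]
  convert this using 2
  · ext ω
    by_cases hy : ∑ i, (ω i : ℂ) ∈ Metric.ball x r
    · rw [indicator_of_mem hy, indicator_of_mem (by exact hy), mul_one]
    · rw [indicator_of_notMem hy, indicator_of_notMem (by exact hy), mul_zero]
  · ext y
    by_cases hy : y ∈ Metric.ball x r
    · rw [indicator_of_mem hy, indicator_of_mem hy, one_mul]
    · rw [indicator_of_notMem hy, indicator_of_notMem hy, zero_mul]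

/-! ### Hölder continuity of the densities and the size of the multiplier. -/

lemma charDensity_eq (ν : Fin 5 → ℤ) (x : ℂ) : charDensity ν x =
    ∫ ξ, Complex.exp (((-2 * Real.pi * inner ℝ ξ x : ℝ) : ℂ) * Complex.I) * prodFT ν ξ := by
  rw [charDensity, Real.fourier_eq']
  rfl

lemma norm_exp_sub_exp_le_rpow (a b : ℝ) :
    ‖Complex.exp (a * Complex.I) - Complex.exp (b * Complex.I)‖ ≤ 2 * |a - b| ^ (1 / 4 : ℝ) := by
  rcases le_or_gt |a - b| 1 with h | h
  · refine (norm_exp_ofReal_mul_I_sub_le a b).trans ?_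
    have h1 : |a - b| ^ (1 : ℝ) ≤ |a - b| ^ (1 / 4 : ℝ) :=
      Real.rpow_le_rpow_of_exponent_ge' (abs_nonneg _) h (by norm_num) (by norm_num)
    rw [Real.rpow_one] at h1
    linarith [abs_nonneg (a - b)]
  · refine (norm_sub_le _ _).trans ?_
    rw [Complex.norm_exp_ofReal_mul_I, Complex.norm_exp_ofReal_mul_I]
    have := Real.one_le_rpow h.le (show (0 : ℝ) ≤ 1 / 4 by norm_num)
    linarith

/-- The decay `|ξ|^(-5/2)` can give up a power `1/4` and remain integrable, since `-9/4 < -2`. That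
power pays for the Hölder exponent. -/
lemma exists_norm_charDensity_sub_le : ∃ C : ℝ, 0 < C ∧ ∀ (ν : Fin 5 → ℤ) (x y : ℂ),
    ‖charDensity ν x - charDensity ν y‖ ≤
      C * (∏ i, (1 + |(ν i : ℝ)|)) * ‖x - y‖ ^ (1 / 4 : ℝ) := by
  have hint := integrable_one_add_norm_rpow (s := -(9 / 4)) (by norm_num)
  have hI : 0 ≤ ∫ ξ : ℂ, (1 + ‖ξ‖) ^ (-(9 / 4) : ℝ) := integral_nonneg fun ξ => by positivity
  refine ⟨8 * 18 ^ 5 * (∫ ξ : ℂ, (1 + ‖ξ‖) ^ (-(9 / 4) : ℝ)) + 1, by positivity, fun ν x y => ?_⟩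
  have hpi := Real.pi_lt_d2
  have hint2 : ∀ x, Integrable fun ξ : ℂ =>
      Complex.exp (((-2 * Real.pi * inner ℝ ξ x : ℝ) : ℂ) * Complex.I) * prodFT ν ξ := fun x => by
    refine (integrable_prodFT ν).norm.mono' ?_ (.of_forall fun ξ => ?_)
    · have := continuous_prodFT ν
      exact Continuous.aestronglyMeasurable (by fun_prop)
    · rw [norm_mul, Complex.norm_exp_ofReal_mul_I, one_mul]
  set Q := ∏ i, (1 + |(ν i : ℝ)|) with hQ
  have hQ0 : 0 ≤ Q := Finset.prod_nonneg fun i _ => by positivity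
  rw [charDensity_eq, charDensity_eq, ← integral_sub (hint2 x) (hint2 y)]
  refine (norm_integral_le_of_norm_le (hint.const_mul (8 * 18 ^ 5 * Q * ‖x - y‖ ^ (1 / 4 : ℝ)))
    (.of_forall fun ξ => ?_)).trans ?_
  · rw [← sub_mul, norm_mul]
    have h1 := norm_exp_sub_exp_le_rpow (-2 * Real.pi * inner ℝ ξ x) (-2 * Real.pi * inner ℝ ξ y)
    have h2 : |-2 * Real.pi * inner ℝ ξ x - -2 * Real.pi * inner ℝ ξ y| ≤
        16 * ((1 + ‖ξ‖) * ‖x - y‖) := by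
      rw [← mul_sub, ← inner_sub_right, abs_mul, abs_mul, abs_neg, abs_two,
        abs_of_pos Real.pi_pos]
      have := abs_real_inner_le_norm ξ (x - y)
      have h3 : ‖ξ‖ * ‖x - y‖ ≤ (1 + ‖ξ‖) * ‖x - y‖ :=
        mul_le_mul_of_nonneg_right (by linarith) (norm_nonneg _)
      exact mul_le_mul (by linarith) (this.trans h3) (abs_nonneg _) (by norm_num)
    have h3 : |-2 * Real.pi * inner ℝ ξ x - -2 * Real.pi * inner ℝ ξ y| ^ (1 / 4 : ℝ) ≤
        2 * ((1 + ‖ξ‖) ^ (1 / 4 : ℝ) * ‖x - y‖ ^ (1 / 4 : ℝ)) := by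
      refine (Real.rpow_le_rpow (abs_nonneg _) h2 (by norm_num)).trans (le_of_eq ?_)
      rw [Real.mul_rpow (by norm_num) (by positivity), Real.mul_rpow (by positivity) (by positivity),
        show (16 : ℝ) = 2 ^ (4 : ℝ) by norm_num, ← Real.rpow_mul (by norm_num)]
      norm_num
    have h4 := norm_prodFT_le ν ξ
    rw [← hQ] at h4
    have h5 : (1 + ‖ξ‖) ^ (-(9 / 4) : ℝ) = (1 + ‖ξ‖) ^ (1 / 4 : ℝ) * (1 + ‖ξ‖) ^ (-(5 / 2) : ℝ) := by
      rw [← Real.rpow_add (by positivity)]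
      norm_num
    calc _ ≤ (2 * (2 * ((1 + ‖ξ‖) ^ (1 / 4 : ℝ) * ‖x - y‖ ^ (1 / 4 : ℝ)))) *
          (18 ^ 5 * Q * (1 + ‖ξ‖) ^ (-(5 / 2) : ℝ)) :=
          mul_le_mul (by linarith) h4 (norm_nonneg _) (by positivity)
      _ = 4 * 18 ^ 5 * Q * ‖x - y‖ ^ (1 / 4 : ℝ) * (1 + ‖ξ‖) ^ (-(9 / 4) : ℝ) := by
        rw [h5]
        ring
      _ ≤ _ := by gcongr; norm_num
  · rw [integral_const_mul]
    have h6 : 0 ≤ Q * ‖x - y‖ ^ (1 / 4 : ℝ) := by positivity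
    nlinarith

/-- The Fourier multiplier of the restricted fivefold convolution. -/
noncomputable def kern (ν : Fin 5 → ℤ) : ℂ := charDensity ν 1

/-- The mixed bound is applied to factor `i` and stationary phase to the other four. The total decay
`-1/8 - 2 = -17/8` is still integrable, and the `i`-th frequency gains instead of losing. -/
lemma exists_norm_kern_le : ∃ C : ℝ, 0 < C ∧ ∀ (ν : Fin 5 → ℤ) (i : Fin 5),
    ‖kern ν‖ ≤ C * (1 + |(ν i : ℝ)|) ^ (-(1 / 10) : ℝ) *
      ∏ j : Fin 4, (1 + |(ν (i.succAbove j) : ℝ)|) := by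
  obtain ⟨D, hD, hDb⟩ := exists_norm_circFT_le_mixed
  have hint := integrable_one_add_norm_rpow (s := -(17 / 8)) (by norm_num)
  have hI : 0 ≤ ∫ ξ : ℂ, (1 + ‖ξ‖) ^ (-(17 / 8) : ℝ) := integral_nonneg fun ξ => by positivity
  refine ⟨D * 18 ^ 4 * (∫ ξ : ℂ, (1 + ‖ξ‖) ^ (-(17 / 8) : ℝ)) + 1, by positivity, fun ν i => ?_⟩
  set Q := ∏ j : Fin 4, (1 + |(ν (i.succAbove j) : ℝ)|) with hQ
  have hQ0 : 0 ≤ Q := Finset.prod_nonneg fun i _ => by positivity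
  rw [kern, charDensity_eq]
  refine (norm_integral_le_of_norm_le (hint.const_mul
    (D * 18 ^ 4 * Q * (1 + |(ν i : ℝ)|) ^ (-(1 / 10) : ℝ))) (.of_forall fun ξ => ?_)).trans ?_
  · rw [norm_mul, Complex.norm_exp_ofReal_mul_I, one_mul, prodFT, Fin.prod_univ_succAbove _ i,
      norm_mul, norm_prod]
    have h1 : ∏ j : Fin 4, ‖circFT (ν (i.succAbove j)) ξ‖ ≤
        18 ^ 4 * Q * (1 + ‖ξ‖) ^ (-2 : ℝ) := by
      refine (Finset.prod_le_prod (fun _ _ => norm_nonneg _)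
        fun j _ => norm_circFT_le (ν (i.succAbove j)) ξ).trans (le_of_eq ?_)
      rw [Finset.prod_mul_distrib, Finset.prod_mul_distrib, Finset.prod_const, Finset.prod_const,
        Finset.card_univ, Fintype.card_fin, ← Real.rpow_natCast ((1 + ‖ξ‖) ^ _),
        ← Real.rpow_mul (by positivity)]
      norm_num
      exact Or.inl rfl
    have h5 : (1 + ‖ξ‖) ^ (-(17 / 8) : ℝ) = (1 + ‖ξ‖) ^ (-(1 / 8) : ℝ) * (1 + ‖ξ‖) ^ (-2 : ℝ) := by
      rw [← Real.rpow_add (by positivity)]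
      norm_num
    refine (mul_le_mul (hDb (ν i) ξ) h1 (Finset.prod_nonneg fun _ _ => norm_nonneg _)
      (by positivity)).trans (le_of_eq ?_)
    rw [h5]
    ring
  · rw [integral_const_mul]
    have h6 : 0 ≤ (1 + |(ν i : ℝ)|) ^ (-(1 / 10) : ℝ) * Q := by positivity
    nlinarith

/-- The average of the convolution of the measures `f i dσ` over the disc of radius `r`
about `x`. -/
noncomputable def convAvg (f : Fin 5 → Circle → ℂ) (r : ℝ) (x : ℂ) : ℂ :=
  convBall f r x / ((volume.real (Metric.ball x r) : ℝ) : ℂ)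

lemma volume_real_ball_complex (x : ℂ) {r : ℝ} (hr : 0 < r) :
    volume.real (Metric.ball x r) = r ^ 2 * Real.pi := by
  rw [measureReal_def, Complex.volume_ball]
  simp [hr.le]

/-- Rotating all five variables by `x` carries the disc about `1` to the disc about `x` and
multiplies the integrand by `x ^ ∑ ν i`. -/
lemma convAvg_char_circle (ν : Fin 5 → ℤ) {r : ℝ} (hr : 0 < r) (x : Circle) :
    convAvg (fun i z => (z : ℂ) ^ ν i) r x =
      convAvg (fun i z => (z : ℂ) ^ ν i) r 1 * (x : ℂ) ^ (∑ i, ν i) := by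
  rw [convAvg, convAvg, volume_real_ball_complex _ hr, volume_real_ball_complex _ hr,
    div_mul_eq_mul_div]
  congr 1
  rw [convBall, convBall, ← integral_indicator (measurableSet_sum_mem_ball _ r),
    ← integral_indicator (measurableSet_sum_mem_ball _ r), ← integral_mul_const,
    ← integral_mul_left_eq_self _ (fun _ : Fin 5 => x)]
  refine integral_congr_ae (.of_forall fun ω => ?_)
  have hmem : (fun _ : Fin 5 => x) * ω ∈
      {ω : Fin 5 → Circle | ∑ i, (ω i : ℂ) ∈ Metric.ball (x : ℂ) r} ↔
      ω ∈ {ω : Fin 5 → Circle | ∑ i, (ω i : ℂ) ∈ Metric.ball (1 : ℂ) r} := by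
    simp only [mem_ofPred_eq, Pi.mul_apply, Circle.coe_mul, ← Finset.mul_sum, mem_ball_iff_norm]
    rw [show (x : ℂ) * ∑ i, (ω i : ℂ) - x = x * (∑ i, (ω i : ℂ) - 1) by ring, norm_mul,
      Circle.norm_coe, one_mul]
  beta_reduce
  by_cases h : ω ∈ {ω : Fin 5 → Circle | ∑ i, (ω i : ℂ) ∈ Metric.ball (1 : ℂ) r}
  · rw [indicator_of_mem h, indicator_of_mem (hmem.2 h)]
    simp only [Pi.mul_apply, Circle.coe_mul, mul_zpow, Finset.prod_mul_distrib]
    rw [mul_comm]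
    congr 1
    induction (Finset.univ : Finset (Fin 5)) using Finset.induction_on with
    | empty => simp
    | insert a s ha ih =>
      rw [Finset.prod_insert ha, Finset.sum_insert ha, ih, zpow_add₀ x.coe_ne_zero]
  · rw [indicator_of_notMem h, indicator_of_notMem (fun h' => h (hmem.1 h')), zero_mul]

lemma exists_norm_convAvg_char_sub_kern_le : ∃ C : ℝ, 0 < C ∧ ∀ (ν : Fin 5 → ℤ) (r : ℝ), 0 < r →
    ‖convAvg (fun i z => (z : ℂ) ^ ν i) r 1 - kern ν‖ ≤
      C * (∏ i, (1 + |(ν i : ℝ)|)) * r ^ (1 / 4 : ℝ) := by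
  obtain ⟨C, hC, hb⟩ := exists_norm_charDensity_sub_le
  refine ⟨C, hC, fun ν r hr => ?_⟩
  set Q := ∏ i, (1 + |(ν i : ℝ)|) with hQ
  have hQ0 : 0 ≤ Q := Finset.prod_nonneg fun i _ => by positivity
  have hv : 0 < volume.real (Metric.ball (1 : ℂ) r) := by
    rw [volume_real_ball_complex _ hr]
    have := Real.pi_pos
    positivity
  have hvC : ((volume.real (Metric.ball (1 : ℂ) r) : ℝ) : ℂ) ≠ 0 :=
    Complex.ofReal_ne_zero.2 hv.ne'
  have hfin : volume (Metric.ball (1 : ℂ) r) < ∞ := measure_ball_lt_top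
  have hi : IntegrableOn (charDensity ν) (Metric.ball 1 r) :=
    ((continuous_charDensity ν).continuousOn.integrableOn_compact
        (isCompact_closedBall 1 r)).mono_set Metric.ball_subset_closedBall
  have h1 : convAvg (fun i z => (z : ℂ) ^ ν i) r 1 - kern ν =
      (∫ y in Metric.ball (1 : ℂ) r, (charDensity ν y - charDensity ν 1)) /
        ((volume.real (Metric.ball (1 : ℂ) r) : ℝ) : ℂ) := by
    rw [convAvg, convBall_char ν 1 hr, integral_sub hi (integrableOn_const hfin.ne), setIntegral_const,
      sub_div, kern, Complex.real_smul, mul_div_cancel_left₀ _ hvC]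
  rw [h1, norm_div, Complex.norm_real, Real.norm_of_nonneg hv.le, div_le_iff₀ hv]
  refine norm_setIntegral_le_of_norm_le_const hfin fun y hy => ?_
  refine (hb ν y 1).trans (mul_le_mul_of_nonneg_left ?_ (by positivity))
  exact Real.rpow_le_rpow (norm_nonneg _) (mem_ball_iff_norm.1 hy).le (by norm_num)

/-! ### Fourier series in `L²` of the circle -/

/-- The normalized character `x ^ n / √(2π)`. -/
noncomputable def circMono (n : ℤ) (x : Circle) : ℂ := ((√(2 * Real.pi))⁻¹ : ℝ) * (x : ℂ) ^ n

@[fun_prop]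
lemma continuous_circMono (n : ℤ) : Continuous (circMono n) := by
  unfold circMono
  fun_prop

lemma memLp_of_continuous {f : Circle → ℂ} (hf : Continuous f) {p : ℝ≥0∞} : MemLp f p arc := by
  obtain ⟨C, hC⟩ := isCompact_univ.exists_bound_of_continuousOn hf.continuousOn
  exact MemLp.of_bound hf.aestronglyMeasurable C (.of_forall fun x => hC x (mem_univ x))

lemma memLp_circMono (n : ℤ) : MemLp (circMono n) 2 arc := memLp_of_continuous (by fun_prop)

lemma star_circMono (n : ℤ) (x : Circle) : (starRingEnd ℂ) (circMono n x) = circMono (-n) x := by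
  rw [circMono, circMono, map_mul, Complex.conj_ofReal, map_zpow₀, ← Circle.coe_inv_eq_conj,
    Circle.coe_inv, inv_zpow']

lemma circMono_mul_circMono (m n : ℤ) (x : Circle) :
    circMono m x * circMono n x = ((2 * Real.pi)⁻¹ : ℝ) * (x : ℂ) ^ (m + n) := by
  have : (√(2 * Real.pi))⁻¹ * (√(2 * Real.pi))⁻¹ = (2 * Real.pi)⁻¹ := by
    rw [← mul_inv, Real.mul_self_sqrt Real.two_pi_pos.le]
  rw [circMono, circMono, zpow_add₀ x.coe_ne_zero, ← this]
  push_cast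
  ring

lemma integral_circle_zpow (n : ℤ) :
    ∫ x : Circle, (x : ℂ) ^ n ∂arc = if n = 0 then ((2 * Real.pi : ℝ) : ℂ) else 0 := by
  split_ifs with h
  · subst h
    simp [measureReal_def, arc_univ, Real.pi_pos.le]
  · have := norm_circFT_le_div n h 0
    rw [norm_zero, mul_zero, zero_div, norm_le_zero_iff, circFT] at this
    simpa using this

/-- The Fourier coefficients of `f` with respect to the characters `circMono n`. -/
noncomputable def hat (f : Circle → ℂ) (n : ℤ) : ℂ := ∫ x, f x * circMono (-n) x ∂arc

lemma hat_circMono (m n : ℤ) : hat (circMono m) n = if m = n then 1 else 0 := by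
  have hpi := Real.pi_pos
  simp_rw [hat, circMono_mul_circMono]
  rw [integral_const_mul, integral_circle_zpow]
  rcases eq_or_ne m n with h | h
  · rw [if_pos (by rw [h]; ring), if_pos h, ← Complex.ofReal_mul, inv_mul_cancel₀ (by positivity),
      Complex.ofReal_one]
  · rw [if_neg (fun h' => h (by linarith)), if_neg h, mul_zero]

/-- The normalized characters in `L²`. -/
noncomputable def monoLp (n : ℤ) : Lp ℂ 2 arc := (memLp_circMono n).toLp _

lemma inner_monoLp (f : Lp ℂ 2 arc) (n : ℤ) : inner ℂ (monoLp n) f = hat f n := by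
  rw [L2.inner_def, hat]
  refine integral_congr_ae ?_
  filter_upwards [(memLp_circMono n).coeFn_toLp] with x hx
  rw [RCLike.inner_apply, monoLp, hx, star_circMono]

lemma hat_congr {f g : Circle → ℂ} (h : f =ᵐ[arc] g) : hat f = hat g := by
  ext n
  refine integral_congr_ae ?_
  filter_upwards [h] with x hx
  rw [hx]

lemma orthonormal_monoLp : Orthonormal ℂ monoLp := by
  classical
  rw [orthonormal_iff_ite]
  intro m n
  rw [inner_monoLp, monoLp, hat_congr (memLp_circMono n).coeFn_toLp, hat_circMono]
  simp [eq_comm]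

/-- Completeness of the characters, transported from the Fourier basis of `AddCircle (2π)`. -/
lemma ae_eq_zero_of_hat_eq_zero {f : Circle → ℂ} (hf : MemLp f 2 arc) (h : ∀ n, hat f n = 0) :
    f =ᵐ[arc] 0 := by
  have hpi := Real.pi_pos
  have hmp := measurePreserving_toCircle
  have hc : MemLp (f ∘ AddCircle.toCircle) 2 (volume : Measure (AddCircle (2 * Real.pi))) :=
    hf.comp_measurePreserving hmp
  have hc' := memLp_haarAddCircle_iff.2 hc
  have hcoef : ∀ n, fourierCoeff (f ∘ AddCircle.toCircle : AddCircle (2 * Real.pi) → ℂ) n = 0 := by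
    intro n
    have h1 : ∫ t : AddCircle (2 * Real.pi), f (AddCircle.toCircle t) *
        circMono (-n) (AddCircle.toCircle t) = hat f n := by
      rw [hat, ← hmp.map_eq, integral_map hmp.measurable.aemeasurable]
      rw [hmp.map_eq]
      exact hf.1.mul (continuous_circMono _).aestronglyMeasurable
    rw [h n] at h1
    rw [fourierCoeff, AddCircle.integral_haarAddCircle]
    have h2 : ∀ t : AddCircle (2 * Real.pi), fourier (-n) t • (f ∘ AddCircle.toCircle) t =
        ((√(2 * Real.pi) : ℝ) : ℂ) * (f (AddCircle.toCircle t) *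
        circMono (-n) (AddCircle.toCircle t)) := by
      intro t
      rw [circMono, fourier_apply, AddCircle.toCircle_zsmul, Circle.coe_zpow, smul_eq_mul,
        Function.comp_apply]
      have : ((√(2 * Real.pi) : ℝ) : ℂ) ≠ 0 :=
        Complex.ofReal_ne_zero.2 (Real.sqrt_pos.2 (by positivity)).ne'
      push_cast
      field_simp
    simp_rw [h2]
    rw [integral_const_mul, h1, mul_zero, smul_zero]
  have hz : hc'.toLp _ = 0 := by
    apply (fourierBasis (T := 2 * Real.pi)).repr.injective
    rw [map_zero]
    ext n
    rw [fourierBasis_repr, fourierCoeff_congr_ae hc'.coeFn_toLp, hcoef]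
    rfl
  have hae : (f ∘ AddCircle.toCircle) =ᵐ[(AddCircle.haarAddCircle : Measure (AddCircle (2 * Real.pi)))] 0 :=
    hc'.coeFn_toLp.symm.trans (by rw [hz]; exact Lp.coeFn_zero ..)
  have hae2 : (f ∘ AddCircle.toCircle) =ᵐ[(volume : Measure (AddCircle (2 * Real.pi)))] 0 := by
    rw [AddCircle.volume_eq_smul_haarAddCircle]
    exact Measure.ae_smul_measure hae _
  rw [← hmp.map_eq]
  -- Almost everywhere statements pass through the image measure for measurable sets, so `f` is
  -- replaced by a strongly measurable representative.
  obtain ⟨g, hg, hfg⟩ := hf.1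
  have hfg' : f =ᵐ[Measure.map AddCircle.toCircle (volume : Measure (AddCircle (2 * Real.pi)))] g := by
    rw [hmp.map_eq]
    exact hfg
  refine hfg'.trans ?_
  have hms : MeasurableSet {x | g x = (0 : Circle → ℂ) x} :=
    hg.measurableSet_eq_fun stronglyMeasurable_zero
  rw [EventuallyEq, ae_map_iff hmp.measurable.aemeasurable hms]
  filter_upwards [hae2, ae_of_ae_map hmp.measurable.aemeasurable hfg'] with t h1 h2
  rw [← h2]
  exact h1

/-- The Hilbert basis of normalized characters. -/
noncomputable def circBasis : HilbertBasis ℤ ℂ (Lp ℂ 2 arc) :=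
  HilbertBasis.mkOfOrthogonalEqBot orthonormal_monoLp <| by
    rw [Submodule.eq_bot_iff]
    intro f hf
    refine (Lp.eq_zero_iff_ae_eq_zero).2 (ae_eq_zero_of_hat_eq_zero (Lp.memLp f) fun n => ?_)
    rw [← inner_monoLp]
    exact (Submodule.mem_orthogonal _ _).1 hf _ (Submodule.subset_span (mem_range_self n))

lemma circBasis_apply (n : ℤ) : circBasis n = monoLp n := by
  rw [circBasis, HilbertBasis.coe_mkOfOrthogonalEqBot]

lemma circBasis_repr (f : Lp ℂ 2 arc) (n : ℤ) : circBasis.repr f n = hat f n := by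
  rw [HilbertBasis.repr_apply_apply, circBasis_apply, inner_monoLp]

lemma hasSum_sq_hat_Lp (f : Lp ℂ 2 arc) : HasSum (fun n => ‖hat f n‖ ^ 2) (‖f‖ ^ 2) := by
  have h := lp.hasSum_norm (p := 2) (by norm_num) (circBasis.repr f)
  simp only [circBasis_repr, ENNReal.toReal_ofNat, Real.rpow_ofNat,
    LinearIsometryEquiv.norm_map] at h
  exact h

lemma hat_toLp {f : Circle → ℂ} (hf : MemLp f 2 arc) : hat (hf.toLp f) = hat f :=
  hat_congr hf.coeFn_toLp

lemma hasSum_sq_hat {f : Circle → ℂ} (hf : MemLp f 2 arc) :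
    HasSum (fun n => ‖hat f n‖ ^ 2) ((eLpNorm f 2 arc).toReal ^ 2) := by
  have := hasSum_sq_hat_Lp (hf.toLp f)
  rwa [hat_toLp, Lp.norm_toLp] at this

lemma exists_hat_eq {c : ℤ → ℂ} (hc : Summable fun n => ‖c n‖ ^ 2) :
    ∃ g : Circle → ℂ, MemLp g 2 arc ∧ hat g = c := by
  have hm : Memℓp c 2 := (memℓp_gen_iff (by norm_num)).2 (by simpa using hc)
  refine ⟨circBasis.repr.symm ⟨c, hm⟩, Lp.memLp _, ?_⟩
  ext n
  rw [← circBasis_repr, LinearIsometryEquiv.apply_symm_apply]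

lemma hat_star {f : Circle → ℂ} (n : ℤ) :
    hat (fun x => (starRingEnd ℂ) (f x)) n = (starRingEnd ℂ) (hat f (-n)) := by
  rw [hat, hat, ← integral_conj]
  refine integral_congr_ae (.of_forall fun x => ?_)
  simp only [map_mul, star_circMono, neg_neg]

/-- Parseval in bilinear form, the shape of the pairing in `HasWeakRotDeriv`. -/
lemma hasSum_hat_mul_hat {f g : Circle → ℂ} (hf : MemLp f 2 arc) (hg : MemLp g 2 arc) :
    HasSum (fun n => hat f n * hat g (-n)) (∫ x, f x * g x ∂arc) := by
  have hs : MemLp (fun x => (starRingEnd ℂ) (g x)) 2 arc := hg.star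
  have h := circBasis.hasSum_inner_mul_inner (hs.toLp _) (hf.toLp f)
  have h1 : inner ℂ (hs.toLp _) (hf.toLp f) = ∫ x, f x * g x ∂arc := by
    rw [L2.inner_def]
    refine integral_congr_ae ?_
    filter_upwards [hs.coeFn_toLp, hf.coeFn_toLp] with x h1 h2
    rw [h1, h2, RCLike.inner_apply, Complex.conj_conj]
  rw [h1] at h
  refine (congrArg (fun u => HasSum u _) (funext fun n => ?_)).mpr h
  rw [← inner_conj_symm _ (circBasis n), circBasis_apply, inner_monoLp, inner_monoLp, hat_toLp,
    hat_toLp, hat_star, Complex.conj_conj, mul_comm]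

lemma hat_rotate (f : Circle → ℂ) (t : ℝ) (n : ℤ) :
    hat (fun x => f (Circle.exp t * x)) n = Complex.exp ((n * t : ℝ) * Complex.I) * hat f n := by
  rw [hat, hat, ← integral_mul_left_eq_self (fun x => f x * circMono (-n) x) (Circle.exp t),
    ← integral_const_mul]
  refine integral_congr_ae (.of_forall fun x => ?_)
  beta_reduce
  rw [circMono, circMono, Circle.coe_mul, mul_zpow, Circle.coe_exp, ← Complex.exp_int_mul]
  have : Complex.exp ((n * t : ℝ) * Complex.I) * Complex.exp ((-n : ℤ) * (t * Complex.I)) = 1 := by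
    rw [← Complex.exp_add]
    convert Complex.exp_zero
    push_cast
    ring
  linear_combination (-f (Circle.exp t * x) * ((√(2 * Real.pi))⁻¹ : ℝ) * (x : ℂ) ^ (-n)) * this

/-! ### Derivatives along rotations -/

lemma circMono_exp (n : ℤ) (θ : ℝ) : circMono n (Circle.exp θ) =
    ((√(2 * Real.pi))⁻¹ : ℝ) * Complex.exp ((n * θ : ℝ) * Complex.I) := by
  rw [circMono, Circle.coe_exp, ← Complex.exp_int_mul]
  congr 2
  push_cast
  ring

lemma hasDerivAt_circMono_exp (n : ℤ) (θ : ℝ) :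
    HasDerivAt (fun θ : ℝ => circMono n (Circle.exp θ))
      (n * Complex.I * circMono n (Circle.exp θ)) θ := by
  simp_rw [circMono_exp]
  have h2 : HasDerivAt (fun θ : ℝ => ((n * θ : ℝ) : ℂ) * Complex.I) (n * Complex.I) θ := by
    have := (((hasDerivAt_id θ).const_mul (n : ℝ)).ofReal_comp).mul_const Complex.I
    simpa using this
  refine (h2.cexp.const_mul _).congr_deriv ?_
  ring

lemma isSmooth_circMono (n : ℤ) : IsSmooth (circMono n) := by
  unfold IsSmooth
  simp_rw [circMono_exp]
  refine contDiff_const.mul (Complex.contDiff_exp.comp ?_)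
  exact (Complex.ofRealCLM.contDiff.comp (contDiff_const.mul contDiff_id)).mul contDiff_const

lemma rotDeriv_exp (φ : Circle → ℂ) (θ : ℝ) :
    rotDeriv φ (Circle.exp θ) = deriv (fun t : ℝ => φ (Circle.exp t)) θ := by
  rw [rotDeriv]
  have : (fun t : ℝ => φ (Circle.exp t * Circle.exp θ)) =
      fun t => (fun t : ℝ => φ (Circle.exp t)) (t + θ) := by
    ext t
    beta_reduce
    rw [Circle.exp_add]
  rw [this, deriv_comp_add_const (fun t : ℝ => φ (Circle.exp t)), zero_add]

lemma circle_exp_surjective : Function.Surjective Circle.exp := fun z =>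
  ⟨Complex.arg z, Circle.exp_arg z⟩

lemma isQuotientMap_circle_exp : Topology.IsQuotientMap Circle.exp :=
  isLocalHomeomorph_circleExp.isOpenMap.isQuotientMap Circle.exp.continuous circle_exp_surjective

lemma rotDeriv_circMono (n : ℤ) (x : Circle) :
    rotDeriv (circMono n) x = n * Complex.I * circMono n x := by
  obtain ⟨θ, rfl⟩ := circle_exp_surjective x
  rw [rotDeriv_exp, (hasDerivAt_circMono_exp n θ).deriv]

lemma IsSmooth.continuous {φ : Circle → ℂ} (h : IsSmooth φ) : Continuous φ :=
  isQuotientMap_circle_exp.continuous_iff.2 (ContDiff.continuous h)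

lemma IsSmooth.continuous_rotDeriv {φ : Circle → ℂ} (h : IsSmooth φ) : Continuous (rotDeriv φ) := by
  refine isQuotientMap_circle_exp.continuous_iff.2 ?_
  have : rotDeriv φ ∘ Circle.exp = deriv (fun t : ℝ => φ (Circle.exp t)) := by
    ext θ
    exact rotDeriv_exp φ θ
  rw [this]
  exact ContDiff.continuous_deriv h (by simp)

lemma hat_rotDeriv {φ : Circle → ℂ} (h : IsSmooth φ) (n : ℤ) :
    hat (rotDeriv φ) n = n * Complex.I * hat φ n := by
  have hd := h.continuous_rotDeriv
  have hc := h.continuous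
  rw [hat, hat, integral_arc _ (by fun_prop), integral_arc _ (by fun_prop),
    ← intervalIntegral.integral_const_mul]
  have hp : ∀ θ ∈ uIcc (-Real.pi) Real.pi, HasDerivAt (fun t : ℝ => φ (Circle.exp t))
      (rotDeriv φ (Circle.exp θ)) θ := fun θ _ => by
    rw [rotDeriv_exp]
    exact (ContDiff.differentiable h (by simp)).differentiableAt.hasDerivAt
  have := intervalIntegral.integral_deriv_mul_eq_sub hp
    (fun θ _ => hasDerivAt_circMono_exp (-n) θ)
    (Continuous.intervalIntegrable (by fun_prop) _ _)
    (Continuous.intervalIntegrable (by fun_prop) _ _)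
  have hper : Circle.exp (-Real.pi) = Circle.exp Real.pi := by
    have := Circle.periodic_exp (-Real.pi)
    rw [← this]
    congr 1
    ring
  rw [hper, sub_self, intervalIntegral.integral_add
    (Continuous.intervalIntegrable (by fun_prop) _ _)
    (Continuous.intervalIntegrable (by fun_prop) _ _)] at this
  rw [eq_neg_of_add_eq_zero_left this, ← intervalIntegral.integral_neg]
  refine intervalIntegral.integral_congr fun θ _ => ?_
  push_cast
  ring

lemma HasWeakRotDeriv.hat_eq {f g : Circle → ℂ} (h : HasWeakRotDeriv f g) (n : ℤ) :
    hat g n = n * Complex.I * hat f n := by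
  have := h (circMono (-n)) (isSmooth_circMono _)
  rw [← neg_eq_iff_eq_neg] at this
  rw [hat, ← this, hat, ← integral_neg, ← integral_const_mul]
  refine integral_congr_ae (.of_forall fun x => ?_)
  beta_reduce
  rw [rotDeriv_circMono]
  push_cast
  ring

lemma hasWeakRotDeriv_of_hat {f g : Circle → ℂ} (hf : MemLp f 2 arc) (hg : MemLp g 2 arc)
    (h : ∀ n, hat g n = n * Complex.I * hat f n) : HasWeakRotDeriv f g := by
  intro φ hφ
  have h1 := hasSum_hat_mul_hat hf (memLp_of_continuous hφ.continuous_rotDeriv)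
  have h2 := (hasSum_hat_mul_hat hg (memLp_of_continuous hφ.continuous)).neg
  refine h1.unique ((congrArg (fun u => HasSum u _) (funext fun n => ?_)).mpr h2)
  rw [hat_rotDeriv hφ, h]
  push_cast
  ring

/-! ### The spaces `𝓗^s` in terms of Fourier coefficients -/

/-- Sobolev regularity of order `s` of a sequence of Fourier coefficients. -/
def SobolevSummable (s : ℝ) (c : ℤ → ℂ) : Prop :=
  Summable fun n : ℤ => (1 + |(n : ℝ)|) ^ (2 * s) * ‖c n‖ ^ 2

lemma hat_sub {f g : Circle → ℂ} (hf : MemLp f 2 arc) (hg : MemLp g 2 arc) (n : ℤ) :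
    hat (fun x => f x - g x) n = hat f n - hat g n := by
  rw [hat, hat, hat, ← integral_sub]
  · simp_rw [sub_mul]
  · exact (hf.integrable_mul (memLp_circMono (-n)))
  · exact (hg.integrable_mul (memLp_circMono (-n)))

lemma memLp_rotate {f : Circle → ℂ} (hf : MemLp f 2 arc) (t : ℝ) :
    MemLp (fun x => f (Circle.exp t * x)) 2 arc :=
  hf.comp_measurePreserving (measurePreserving_mul_left arc (Circle.exp t))

lemma hasSum_sq_hat_rotate_sub {f : Circle → ℂ} (hf : MemLp f 2 arc) (t : ℝ) :
    HasSum (fun n : ℤ => ‖Complex.exp ((n * t : ℝ) * Complex.I) - 1‖ ^ 2 * ‖hat f n‖ ^ 2)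
      ((eLpNorm (fun x => f (Circle.exp t * x) - f x) 2 arc).toReal ^ 2) := by
  have h := hasSum_sq_hat ((memLp_rotate hf t).sub hf)
  refine (congrArg (fun u => HasSum u _) (funext fun n => ?_)).mpr h
  have : hat ((fun x => f (Circle.exp t * x)) - f) n =
      (Complex.exp ((n * t : ℝ) * Complex.I) - 1) * hat f n := by
    have h2 := hat_sub (memLp_rotate hf t) hf n
    rw [hat_rotate] at h2
    rw [sub_mul, one_mul, ← h2]
    rfl
  rw [this, norm_mul, mul_pow]

lemma norm_exp_mul_I_sub_one (u : ℝ) : ‖Complex.exp (u * Complex.I) - 1‖ = 2 * |Real.sin (u / 2)| := by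
  rw [← norm_exp_sub_one, Circle.coe_exp]

lemma half_le_norm_exp_sub_one {u : ℝ} (h1 : 1 ≤ |u|) (h2 : |u| ≤ 2) :
    (1 / 2 : ℝ) ≤ ‖Complex.exp (u * Complex.I) - 1‖ := by
  rw [norm_exp_mul_I_sub_one]
  have hpi := Real.pi_gt_three
  have hpi' := Real.pi_le_four
  have h := Real.mul_abs_le_abs_sin (x := u / 2) (by rw [abs_div, abs_two]; linarith)
  rw [abs_div, abs_two] at h
  have h3 : (1 / 2 : ℝ) ≤ 2 / Real.pi := by
    rw [div_le_div_iff₀ (by norm_num) Real.pi_pos]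
    linarith
  nlinarith

lemma norm_exp_sub_one_le_rpow {α : ℝ} (h0 : 0 ≤ α) (h1 : α ≤ 1) (u : ℝ) :
    ‖Complex.exp (u * Complex.I) - 1‖ ≤ 2 * |u| ^ α := by
  rcases le_or_gt |u| 1 with h | h
  · have h2 := norm_exp_ofReal_mul_I_sub_le u 0
    rw [Complex.ofReal_zero, zero_mul, Complex.exp_zero, sub_zero] at h2
    have h3 : |u| ^ (1 : ℝ) ≤ |u| ^ α := Real.rpow_le_rpow_of_exponent_ge' (abs_nonneg _) h h0 h1
    rw [Real.rpow_one] at h3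
    linarith [abs_nonneg u]
  · refine (norm_sub_le _ _).trans ?_
    rw [Complex.norm_exp_ofReal_mul_I, norm_one]
    have := Real.one_le_rpow h.le h0
    linarith

lemma norm_hat_iterate {D : ℕ → Circle → ℂ} {k : ℕ}
    (h : ∀ m < k, HasWeakRotDeriv (D m) (D (m + 1))) (n : ℤ) {m : ℕ} (hm : m ≤ k) :
    ‖hat (D m) n‖ = |(n : ℝ)| ^ m * ‖hat (D 0) n‖ := by
  induction m with
  | zero => simp
  | succ m ih =>
    rw [(h m (by omega)).hat_eq, norm_mul, norm_mul, Complex.norm_I, mul_one, ih (by omega),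
      Complex.norm_intCast, pow_succ]
    ring

lemma summable_of_tsum_ofReal_lt_top {f : ℤ → ℝ} (hf : ∀ n, 0 ≤ f n)
    (h : ∑' n, ENNReal.ofReal (f n) < ∞) : Summable f := by
  have := ENNReal.summable_toReal h.ne
  simpa [ENNReal.toReal_ofReal, hf] using this

/-- Dyadic characterization: an `L²`-Hölder function has square summable coefficients against
any smaller power weight. -/
lemma tsum_dyadic_lt_top {α σ : ℝ} (hσ : σ < α) {g : Circle → ℂ} (hg : MemLp g 2 arc)
    (hh : L2Holder α g) :
    ∑' n : ℤ, ∑' j : ℕ, ENNReal.ofReal ((2 : ℝ) ^ (2 * σ * j) *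
      (‖Complex.exp ((n * (2 : ℝ) ^ (-(j : ℝ)) : ℝ) * Complex.I) - 1‖ ^ 2 * ‖hat g n‖ ^ 2)) < ∞ := by
  obtain ⟨C, hC⟩ := hh
  rw [ENNReal.tsum_comm]
  -- For fixed `j`, Parseval and the Hölder bound at `t = 2^(-j)` give `C² 2^(2(σ - α)j)`, a
  -- convergent geometric series in `j`.
  have h1 : ∀ j : ℕ, ∑' n : ℤ, ENNReal.ofReal ((2 : ℝ) ^ (2 * σ * j) *
      (‖Complex.exp ((n * (2 : ℝ) ^ (-(j : ℝ)) : ℝ) * Complex.I) - 1‖ ^ 2 * ‖hat g n‖ ^ 2)) ≤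
      ENNReal.ofReal (C ^ 2 * ((2 : ℝ) ^ (2 * (σ - α))) ^ j) := by
    intro j
    have hs := hasSum_sq_hat_rotate_sub hg ((2 : ℝ) ^ (-(j : ℝ)))
    rw [← ENNReal.ofReal_tsum_of_nonneg (fun n => by positivity) (hs.summable.mul_left _),
      tsum_mul_left, hs.tsum_eq]
    apply ENNReal.ofReal_le_ofReal
    have ht0 : 0 < (2 : ℝ) ^ (-(j : ℝ)) := by positivity
    have ht1 : (2 : ℝ) ^ (-(j : ℝ)) ≤ 1 :=
      Real.rpow_le_one_of_one_le_of_nonpos (by norm_num) (by simp)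
    have h2 := hC ((2 : ℝ) ^ (-(j : ℝ))) (abs_pos.2 ht0.ne') (by rwa [abs_of_pos ht0])
    rw [abs_of_pos ht0] at h2
    have h3 : (eLpNorm (fun x => g (Circle.exp ((2 : ℝ) ^ (-(j : ℝ))) * x) - g x) 2 arc).toReal ≤
        |C| * ((2 : ℝ) ^ (-(j : ℝ))) ^ α := by
      refine ENNReal.toReal_le_of_le_ofReal (by positivity) (h2.trans (ENNReal.ofReal_le_ofReal ?_))
      exact mul_le_mul_of_nonneg_right (le_abs_self C) (by positivity)
    refine (mul_le_mul_of_nonneg_left (pow_le_pow_left₀ ENNReal.toReal_nonneg h3 2)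
      (by positivity)).trans (le_of_eq ?_)
    rw [mul_pow, sq_abs, ← Real.rpow_mul (by norm_num), ← Real.rpow_natCast ((2 : ℝ) ^ (_ : ℝ)) 2,
      ← Real.rpow_mul (by norm_num), ← Real.rpow_natCast ((2 : ℝ) ^ (2 * (σ - α))), ← Real.rpow_mul (by norm_num), mul_left_comm,
      ← Real.rpow_add (by norm_num)]
    congr 2
    push_cast
    ring
  refine (ENNReal.tsum_le_tsum h1).trans_lt ?_
  have hlt : (2 : ℝ) ^ (2 * (σ - α)) < 1 :=
    Real.rpow_lt_one_of_one_lt_of_neg (by norm_num) (by linarith)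
  exact (((summable_geometric_of_lt_one (by positivity) hlt).mul_left (C ^ 2)).tsum_ofReal_lt_top)

/-- A Hölder bound is a supremum over dyadic scales, and square summability follows at the price of
any positive amount of regularity. Only the derivative of top order `k` enters, where the remaining
weight `s' - k` may be negative. -/
lemma MemH.sobolevSummable {s s' : ℝ} (hs' : 0 ≤ s') (hss : s' < s) {f : Circle → ℂ}
    (h : MemH s f) : SobolevSummable s' (hat f) := by
  obtain ⟨D, hD0, hmem, hweak, hhol⟩ := h
  set k := ⌊s⌋₊ with hk
  have hsum := tsum_dyadic_lt_top (σ := s' - k) (α := s - k) (by linarith) (hmem k le_rfl)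
    (hhol k le_rfl)
  refine summable_of_tsum_ofReal_lt_top (fun n => by positivity) ?_
  have hpt : ∀ n : ℤ, ENNReal.ofReal ((1 + |(n : ℝ)|) ^ (2 * s') * ‖hat f n‖ ^ 2) ≤
      ENNReal.ofReal (4 ^ (2 * s' + 1)) * ∑' j : ℕ, ENNReal.ofReal ((2 : ℝ) ^ (2 * (s' - k) * j) *
      (‖Complex.exp ((n * (2 : ℝ) ^ (-(j : ℝ)) : ℝ) * Complex.I) - 1‖ ^ 2 * ‖hat (D k) n‖ ^ 2)) +
      (if n = 0 then ENNReal.ofReal (‖hat f 0‖ ^ 2) else 0) := by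
    intro n
    rcases eq_or_ne n 0 with rfl | hn
    · simp
    · rw [if_neg hn, add_zero]
      -- With `2^j ≤ |n| ≤ 2^(j+1)`, rotation by `2^(-j)` turns the `n`-th character by an angle in
      -- absolute value between `1` and `2`, hence moves it by at least `1/2`.
      set j := Nat.log 2 n.natAbs with hj
      refine le_trans ?_ (mul_le_mul_right (ENNReal.le_tsum j) _)
      rw [← ENNReal.ofReal_mul (by positivity)]
      apply ENNReal.ofReal_le_ofReal
      have hlo : (2 : ℝ) ^ (j : ℝ) ≤ |(n : ℝ)| := by
        rw [Real.rpow_natCast, ← Int.cast_abs, Int.abs_eq_natAbs, Int.cast_natCast]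
        exact_mod_cast Nat.pow_log_le_self 2 (Int.natAbs_ne_zero.2 hn)
      have hhi : |(n : ℝ)| ≤ 2 * (2 : ℝ) ^ (j : ℝ) := by
        rw [Real.rpow_natCast, ← Int.cast_abs, Int.abs_eq_natAbs, Int.cast_natCast]
        have := (Nat.lt_pow_succ_log_self (b := 2) (by norm_num) n.natAbs).le
        rw [pow_succ, mul_comm] at this
        exact_mod_cast this
      have hP : 0 < (2 : ℝ) ^ (j : ℝ) := by positivity
      have hinv : (2 : ℝ) ^ (-(j : ℝ)) = ((2 : ℝ) ^ (j : ℝ))⁻¹ := Real.rpow_neg (by norm_num) _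
      have hu : |n * (2 : ℝ) ^ (-(j : ℝ))| = |(n : ℝ)| / (2 : ℝ) ^ (j : ℝ) := by
        rw [abs_mul, hinv, abs_of_pos (inv_pos.2 hP), div_eq_mul_inv]
      have hosc := half_le_norm_exp_sub_one (u := n * (2 : ℝ) ^ (-(j : ℝ)))
        (by rw [hu, one_le_div hP]; exact hlo) (by rw [hu, div_le_iff₀ hP]; exact hhi)
      have hosc2 : (1 : ℝ) / 4 ≤
          ‖Complex.exp ((n * (2 : ℝ) ^ (-(j : ℝ)) : ℝ) * Complex.I) - 1‖ ^ 2 := by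
        nlinarith
      have hw : (1 + |(n : ℝ)|) ^ (2 * s') ≤ 4 ^ (2 * s') * (2 : ℝ) ^ (2 * s' * j) := by
        have h1 : 1 + |(n : ℝ)| ≤ 4 * (2 : ℝ) ^ (j : ℝ) := by
          have : 1 ≤ (2 : ℝ) ^ (j : ℝ) := Real.one_le_rpow (by norm_num) (by positivity)
          linarith
        refine (Real.rpow_le_rpow (by positivity) h1 (by positivity)).trans (le_of_eq ?_)
        rw [Real.mul_rpow (by norm_num) hP.le, ← Real.rpow_mul (by norm_num), mul_comm (j : ℝ)]
      have hb : ‖hat f n‖ ^ 2 ≤ (2 : ℝ) ^ (-(2 * k * j : ℝ)) * ‖hat (D k) n‖ ^ 2 := by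
        rw [norm_hat_iterate hweak n le_rfl, hD0, mul_pow, ← mul_assoc]
        refine le_mul_of_one_le_left (by positivity) ?_
        rw [Real.rpow_neg (by norm_num), ← div_eq_inv_mul, one_le_div (by positivity)]
        have h1 : ((2 : ℝ) ^ (j : ℝ)) ^ k ≤ |(n : ℝ)| ^ k := pow_le_pow_left₀ hP.le hlo k
        refine le_trans (le_of_eq ?_) (pow_le_pow_left₀ (by positivity) h1 2)
        rw [← Real.rpow_natCast, ← Real.rpow_natCast, ← Real.rpow_mul (by norm_num),
          ← Real.rpow_mul (by norm_num)]
        congr 1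
        push_cast
        ring
      calc (1 + |(n : ℝ)|) ^ (2 * s') * ‖hat f n‖ ^ 2
          ≤ (4 ^ (2 * s') * (2 : ℝ) ^ (2 * s' * j)) *
            ((2 : ℝ) ^ (-(2 * k * j : ℝ)) * ‖hat (D k) n‖ ^ 2) :=
            mul_le_mul hw hb (by positivity) (by positivity)
        _ = 4 ^ (2 * s' + 1) * ((2 : ℝ) ^ (2 * (s' - k) * j) * (1 / 4 * ‖hat (D k) n‖ ^ 2)) := by
          rw [Real.rpow_add_one (by norm_num), show 2 * (s' - k) * j = 2 * s' * j + -(2 * k * j : ℝ) by ring,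
            Real.rpow_add (by norm_num)]
          ring
        _ ≤ _ := by gcongr
  refine (ENNReal.tsum_le_tsum hpt).trans_lt ?_
  rw [ENNReal.tsum_add, ENNReal.tsum_mul_left, tsum_ite_eq]
  exact ENNReal.add_lt_top.2 ⟨ENNReal.mul_lt_top ENNReal.ofReal_lt_top hsum, ENNReal.ofReal_lt_top⟩

/-- No regularity is lost in this direction: `|e^{inτ} - 1| ≤ 2|nτ|^α` with `α = t - k`, and `|n|^α
|n|^m` is within the weight for `m ≤ k`. -/
lemma memH_of_sobolevSummable {t : ℝ} (ht : 0 ≤ t) {f : Circle → ℂ} (hf : MemLp f 2 arc)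
    (h : SobolevSummable t (hat f)) : MemH t f := by
  set k := ⌊t⌋₊ with hk
  have hkt : (k : ℝ) ≤ t := Nat.floor_le ht
  have htk : t < k + 1 := Nat.lt_floor_add_one t
  have hwt : ∀ m ≤ k, ∀ n : ℤ, (|(n : ℝ)| ^ m) ^ 2 ≤ (1 + |(n : ℝ)|) ^ (2 * t) := by
    intro m hm n
    have h1 : |(n : ℝ)| ^ m ≤ (1 + |(n : ℝ)|) ^ t := by
      refine (pow_le_pow_left₀ (abs_nonneg _)
        (show |(n : ℝ)| ≤ 1 + |(n : ℝ)| by linarith) m).trans ?_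
      rw [← Real.rpow_natCast]
      refine Real.rpow_le_rpow_of_exponent_le (by linarith [abs_nonneg (n : ℝ)]) ?_
      exact (Nat.cast_le.2 hm).trans hkt
    refine (pow_le_pow_left₀ (by positivity) h1 2).trans (le_of_eq ?_)
    rw [← Real.rpow_natCast, ← Real.rpow_mul (by positivity), mul_comm]
    norm_num
  have hex : ∀ m ≤ k, ∃ g : Circle → ℂ, MemLp g 2 arc ∧
      hat g = fun n => (n * Complex.I) ^ m * hat f n := by
    intro m hm
    apply exists_hat_eq
    refine Summable.of_nonneg_of_le (fun n => by positivity) (fun n => ?_) h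
    rw [norm_mul, norm_pow, norm_mul, Complex.norm_I, mul_one, Complex.norm_intCast, mul_pow]
    exact mul_le_mul_of_nonneg_right (hwt m hm n) (by positivity)
  choose! G hG1 hG2 using hex
  -- `MemH` asks for `D 0 = f` as functions, whereas `G 0` is only determined almost everywhere.
  set D : ℕ → Circle → ℂ := fun m => if m = 0 then f else G m with hD
  have hDm : ∀ m ≤ k, MemLp (D m) 2 arc ∧ ∀ n, hat (D m) n = (n * Complex.I) ^ m * hat f n := by
    intro m hm
    rcases eq_or_ne m 0 with rfl | h0
    · refine ⟨by simpa [hD] using hf, fun n => by simp [hD]⟩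
    · rw [hD]
      simp only [h0, if_false]
      exact ⟨hG1 m hm, fun n => by rw [hG2 m hm]⟩
  refine ⟨D, by simp [hD], fun m hm => (hDm m hm).1, fun m hm => ?_, fun m hm => ?_⟩
  · refine hasWeakRotDeriv_of_hat (hDm m hm.le).1 (hDm (m + 1) hm).1 fun n => ?_
    rw [(hDm m hm.le).2, (hDm (m + 1) hm).2, pow_succ]
    ring
  · set α := t - k with hα
    set S := ∑' n : ℤ, (1 + |(n : ℝ)|) ^ (2 * t) * ‖hat f n‖ ^ 2 with hS
    have hS0 : 0 ≤ S := tsum_nonneg fun n => by positivity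
    have hα0 : 0 ≤ α := by linarith
    have hα1 : α ≤ 1 := by linarith
    refine ⟨2 * √S, fun τ _ _ => ?_⟩
    have hs := hasSum_sq_hat_rotate_sub (hDm m hm).1 τ
    have hfin : eLpNorm (fun x => D m (Circle.exp τ * x) - D m x) 2 arc < ∞ :=
      ((memLp_rotate (hDm m hm).1 τ).sub (hDm m hm).1).2
    rw [← ENNReal.ofReal_toReal hfin.ne]
    apply ENNReal.ofReal_le_ofReal
    apply le_of_sq_le_sq _ (by positivity)
    rw [← hs.tsum_eq, mul_pow, mul_pow, Real.sq_sqrt hS0, hS, ← tsum_mul_left, ← tsum_mul_right]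
    refine hs.summable.tsum_le_tsum (fun n => ?_) ((h.mul_left _).mul_right _)
    rw [(hDm m hm).2, norm_mul, norm_pow, norm_mul, Complex.norm_I, mul_one, Complex.norm_intCast,
      mul_pow]
    have h1 := norm_exp_sub_one_le_rpow hα0 hα1 (n * τ)
    rw [abs_mul, Real.mul_rpow (abs_nonneg _) (abs_nonneg _)] at h1
    have h2 : |(n : ℝ)| ^ α * |(n : ℝ)| ^ m ≤ (1 + |(n : ℝ)|) ^ t := by
      have hb : (1 : ℝ) ≤ 1 + |(n : ℝ)| := by linarith [abs_nonneg (n : ℝ)]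
      calc |(n : ℝ)| ^ α * |(n : ℝ)| ^ m ≤ (1 + |(n : ℝ)|) ^ α * (1 + |(n : ℝ)|) ^ m := by
            gcongr <;> linarith
        _ ≤ (1 + |(n : ℝ)|) ^ α * (1 + |(n : ℝ)|) ^ k := by gcongr
        _ = (1 + |(n : ℝ)|) ^ t := by
          rw [← Real.rpow_natCast, ← Real.rpow_add (by linarith), hα, sub_add_cancel]
    have h3 : (1 + |(n : ℝ)|) ^ (2 * t) = ((1 + |(n : ℝ)|) ^ t) ^ 2 := by
      rw [← Real.rpow_natCast, ← Real.rpow_mul (by positivity), mul_comm]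
      norm_num
    calc ‖Complex.exp ((n * τ : ℝ) * Complex.I) - 1‖ ^ 2 * ((|(n : ℝ)| ^ m) ^ 2 * ‖hat f n‖ ^ 2)
        ≤ (2 * (|(n : ℝ)| ^ α * |τ| ^ α)) ^ 2 * ((|(n : ℝ)| ^ m) ^ 2 * ‖hat f n‖ ^ 2) := by gcongr
      _ = 4 * (|(n : ℝ)| ^ α * |(n : ℝ)| ^ m) ^ 2 * ‖hat f n‖ ^ 2 * (|τ| ^ α) ^ 2 := by ring
      _ ≤ 4 * ((1 + |(n : ℝ)|) ^ t) ^ 2 * ‖hat f n‖ ^ 2 * (|τ| ^ α) ^ 2 := by gcongr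
      _ = _ := by
        rw [h3]
        ring

/-! ### `L²` bounds for the averages of fivefold convolutions -/

lemma eLpNorm_two_sq {α E : Type*} [MeasurableSpace α] [NormedAddCommGroup E] (μ : Measure α)
    (f : α → E) : eLpNorm f 2 μ ^ 2 = ∫⁻ x, ‖f x‖ₑ ^ 2 ∂μ := by
  have := eLpNorm_nnreal_pow_eq_lintegral (f := f) (μ := μ) (p := 2) (by norm_num)
  simpa using this

lemma enorm_convBall_le (f : Fin 5 → Circle → ℂ) (r : ℝ) (x : ℂ) :
    ‖convBall f r x‖ₑ ≤ posConv (fun i z => ‖f i z‖ₑ) r x := by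
  rw [convBall, ← integral_indicator (measurableSet_sum_mem_ball x r)]
  refine (enorm_integral_le_lintegral_enorm _).trans (lintegral_mono fun ω => ?_)
  by_cases h : ω ∈ {ω : Fin 5 → Circle | ∑ i, (ω i : ℂ) ∈ Metric.ball x r}
  · rw [indicator_of_mem h]
    have h' : (∑ i, (ω i : ℂ)) - x ∈ Metric.ball (0 : ℂ) r := by
      rw [mem_ball_zero_iff]
      exact mem_ball_iff_norm.1 h
    rw [discInd, indicator_of_mem h', Pi.one_apply, mul_one]
    simp only [enorm_eq_nnnorm, nnnorm_prod, ENNReal.ofNNReal_finsetProd, le_refl]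
  · rw [indicator_of_notMem h]
    simp

/-- The positive convolution is bounded by `r ^ (2 - κ)` (take `τ = 1 - κ`), and division by the
area of the disc leaves the loss `r ^ (-κ)`. -/
lemma exists_eLpNorm_convAvg_le {κ : ℝ} (h0 : 0 < κ) (h1 : κ ≤ 1) :
    ∃ C : ℝ, 0 < C ∧ ∀ f : Fin 5 → Circle → ℂ, (∀ i, Measurable (f i)) → ∀ r : ℝ, 0 < r → r ≤ 1 →
      eLpNorm (fun x : Circle => convAvg f r x) 2 arc ≤
        ENNReal.ofReal (C * r ^ (-κ)) * ∏ i, eLpNorm (f i) 2 arc := by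
  obtain ⟨C, hC, hb⟩ := exists_lintegral_posConv_sq_le (τ := 1 - κ) (by linarith) (by linarith)
  refine ⟨C, hC, fun f hf r hr hr1 => ?_⟩
  have hpi := Real.pi_gt_three
  refine (ENNReal.pow_le_pow_left_iff two_ne_zero).1 ?_
  rw [eLpNorm_two_sq]
  have hpt : ∀ x : Circle, ‖convAvg f r x‖ₑ ^ 2 ≤
      ENNReal.ofReal ((r ^ 2)⁻¹) ^ 2 * posConv (fun i z => ‖f i z‖ₑ) r x ^ 2 := by
    intro x
    rw [← mul_pow]
    refine pow_le_pow_left₀ zero_le ?_ 2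
    rw [convAvg, div_eq_inv_mul, enorm_mul]
    refine mul_le_mul' ?_ (enorm_convBall_le f r x)
    rw [volume_real_ball_complex _ hr, ← ofReal_norm, norm_inv, Complex.norm_real,
      Real.norm_of_nonneg (by positivity)]
    refine ENNReal.ofReal_le_ofReal (inv_anti₀ (by positivity) ?_)
    nlinarith [sq_nonneg r]
  refine (lintegral_mono hpt).trans ?_
  rw [lintegral_const_mul' _ _ (by finiteness)]
  refine (mul_le_mul_right (hb _ (fun i => (hf i).enorm) r hr hr1) _).trans (le_of_eq ?_)
  rw [← mul_assoc, ← mul_pow, ← ENNReal.ofReal_mul (by positivity), mul_pow, ← Finset.prod_pow]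
  congr 1
  · congr 2
    rw [sub_eq_add_neg, Real.rpow_add hr, Real.rpow_one]
    field_simp
  · refine Finset.prod_congr rfl fun i _ => ?_
    rw [eLpNorm_two_sq]

lemma integrable_prod_five {f : Fin 5 → Circle → ℂ} (hf : ∀ i, MemLp (f i) 2 arc) :
    Integrable (fun ω : Fin 5 → Circle => ∏ i, f i (ω i)) arc5 :=
  Integrable.fintype_prod fun i => (hf i).integrable (by norm_num)

lemma aestronglyMeasurable_convAvg {f : Fin 5 → Circle → ℂ} (hf : ∀ i, Measurable (f i)) {r : ℝ}
    (hr : 0 < r) : AEStronglyMeasurable (fun x : Circle => convAvg f r x) arc := by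
  have h1 : Measurable fun p : Circle × (Fin 5 → Circle) =>
      ({p : Circle × (Fin 5 → Circle) | ∑ i, (p.2 i : ℂ) ∈ Metric.ball (p.1 : ℂ) r}.indicator
        (fun p => ∏ i, f i (p.2 i)) p) := by
    refine Measurable.indicator (by fun_prop) ?_
    simp only [Metric.mem_ball]
    exact measurableSet_lt (by fun_prop) measurable_const
  have h2 := (h1.stronglyMeasurable.integral_prod_right' (ν := arc5))
  have h3 : (fun x : Circle => convAvg f r x) = fun x : Circle =>
      (∫ ω, ({p : Circle × (Fin 5 → Circle) | ∑ i, (p.2 i : ℂ) ∈ Metric.ball (p.1 : ℂ) r}.indicator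
        (fun p => ∏ i, f i (p.2 i)) (x, ω)) ∂arc5) / ((r ^ 2 * Real.pi : ℝ) : ℂ) := by
    ext x
    rw [convAvg, volume_real_ball_complex _ hr, convBall,
      ← integral_indicator (measurableSet_sum_mem_ball _ r)]
    rfl
  rw [h3]
  exact (h2.measurable.div_const _).aestronglyMeasurable

/-- The `i`-th family in the telescoping expansion of a difference of products. -/
noncomputable def teleFamily (f g : Circle → ℂ) (i j : Fin 5) : Circle → ℂ :=
  if j < i then g else if j = i then f - g else f

lemma prod_sub_prod_eq_sum_tele (f g : Circle → ℂ) (ω : Fin 5 → Circle) :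
    ∏ j, f (ω j) - ∏ j, g (ω j) = ∑ i, ∏ j, teleFamily f g i j (ω j) := by
  simp only [teleFamily, Fin.sum_univ_five, Fin.prod_univ_five]
  simp
  ring

lemma memLp_teleFamily {f g : Circle → ℂ} (hf : MemLp f 2 arc) (hg : MemLp g 2 arc) (i j : Fin 5) :
    MemLp (teleFamily f g i j) 2 arc := by
  unfold teleFamily
  split_ifs
  exacts [hg, hf.sub hg, hf]

lemma convAvg_sub_eq_sum {f g : Circle → ℂ} (hf : MemLp f 2 arc) (hg : MemLp g 2 arc) (r : ℝ)
    (x : ℂ) : convAvg (fun _ => f) r x - convAvg (fun _ => g) r x =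
      ∑ i, convAvg (teleFamily f g i) r x := by
  simp only [convAvg]
  rw [← sub_div, ← Finset.sum_div]
  congr 1
  simp only [convBall]
  rw [← integral_sub (integrable_prod_five fun _ => hf).integrableOn
    (integrable_prod_five fun _ => hg).integrableOn, ← integral_finsetSum]
  · exact integral_congr_ae (.of_forall fun ω => prod_sub_prod_eq_sum_tele f g ω)
  · exact fun i _ => (integrable_prod_five (memLp_teleFamily hf hg i)).integrableOn

/-- Telescoping: each of five terms contains `f - g` once and four factors of norm at most `A`. -/
lemma exists_eLpNorm_convAvg_sub_le {κ : ℝ} (h0 : 0 < κ) (h1 : κ ≤ 1) :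
    ∃ C : ℝ, 0 < C ∧ ∀ f g : Circle → ℂ, Measurable f → Measurable g → MemLp f 2 arc →
      MemLp g 2 arc → ∀ A : ℝ≥0∞, eLpNorm f 2 arc ≤ A → eLpNorm g 2 arc ≤ A →
      ∀ r : ℝ, 0 < r → r ≤ 1 →
      eLpNorm (fun x : Circle => convAvg (fun _ => f) r x - convAvg (fun _ => g) r x) 2 arc ≤
        ENNReal.ofReal (C * r ^ (-κ)) * (eLpNorm (f - g) 2 arc * A ^ 4) := by
  obtain ⟨C, hC, hb⟩ := exists_eLpNorm_convAvg_le h0 h1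
  refine ⟨5 * C, by positivity, fun f g hf hg hf2 hg2 A hfA hgA r hr hr1 => ?_⟩
  have hm : ∀ i j, Measurable (teleFamily f g i j) := fun i j => by
    unfold teleFamily
    split_ifs
    exacts [hg, hf.sub hg, hf]
  have h2 : (fun x : Circle => convAvg (fun _ => f) r x - convAvg (fun _ => g) r x) =
      ∑ i, fun x : Circle => convAvg (teleFamily f g i) r x := by
    ext x
    rw [convAvg_sub_eq_sum hf2 hg2, Finset.sum_apply]
  rw [h2]
  refine (eLpNorm_sum_le (fun i _ => aestronglyMeasurable_convAvg (hm i) hr) (by norm_num)).trans ?_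
  have h3 : ∀ i : Fin 5, eLpNorm (fun x : Circle => convAvg (teleFamily f g i) r x) 2 arc ≤
      ENNReal.ofReal (C * r ^ (-κ)) * (eLpNorm (f - g) 2 arc * A ^ 4) := by
    intro i
    refine (hb _ (hm i) r hr hr1).trans (mul_le_mul_right ?_ _)
    rw [Fin.prod_univ_succAbove _ i]
    refine mul_le_mul' (le_of_eq ?_) ?_
    · simp [teleFamily]
    · refine (Finset.prod_le_prod' (g := fun _ => A) fun j _ => ?_).trans (le_of_eq (by simp))
      have : i.succAbove j ≠ i := Fin.succAbove_ne i j
      simp only [teleFamily, this, if_false]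
      split_ifs
      exacts [hgA, hfA]
  refine (Finset.sum_le_sum fun i _ => h3 i).trans (le_of_eq ?_)
  rw [Finset.sum_const, Finset.card_univ, Fintype.card_fin, nsmul_eq_mul,
    show ((5 : ℕ) : ℝ≥0∞) = ENNReal.ofReal 5 by simp, ← mul_assoc,
    ← ENNReal.ofReal_mul (by norm_num), mul_assoc 5]

lemma prod_ae_congr {f g : Circle → ℂ} (h : f =ᵐ[arc] g) :
    (fun ω : Fin 5 → Circle => ∏ i, f (ω i)) =ᵐ[arc5] fun ω => ∏ i, g (ω i) := by
  have : ∀ i : Fin 5, ∀ᵐ ω : Fin 5 → Circle ∂arc5, f (ω i) = g (ω i) := fun i =>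
    (Measure.quasiMeasurePreserving_eval (fun _ : Fin 5 => arc) i).ae h
  filter_upwards [ae_all_iff.2 this] with ω hω
  exact Finset.prod_congr rfl fun i _ => hω i

/-- Allows `f` to be replaced by a measurable representative, as the `L²` bounds for averages
require. -/
lemma conv5_ball_div {f g : Circle → ℂ} (hf : MemLp f 2 arc) (h : f =ᵐ[arc] g) (x : ℂ) (r : ℝ) :
    conv5 f (Metric.ball x r) / ((volume.real (Metric.ball x r) : ℝ) : ℂ) =
      convAvg (fun _ => g) r x := by
  rw [convAvg, conv5, VectorMeasure.map_apply _ measurable_sum_circle measurableSet_ball,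
    withDensityᵥ_apply (integrable_prod_five fun _ => hf)
      (measurable_sum_circle measurableSet_ball)]
  congr 1
  exact integral_congr_ae (ae_restrict_of_ae (prod_ae_congr h))

/-! ### The five-linear form on trigonometric polynomials -/

/-- The integers of absolute value at most `N`. -/
noncomputable abbrev freq (N : ℕ) : Finset ℤ := Finset.Icc (-(N : ℤ)) N

lemma mem_freq {N : ℕ} {n : ℤ} : n ∈ freq N ↔ |(n : ℝ)| ≤ N := by
  rw [Finset.mem_Icc, abs_le]
  constructor
  · rintro ⟨h1, h2⟩
    exact ⟨by exact_mod_cast h1, by exact_mod_cast h2⟩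
  · rintro ⟨h1, h2⟩
    exact ⟨by exact_mod_cast h1, by exact_mod_cast h2⟩

lemma card_freq (N : ℕ) : ((freq N).card : ℝ) = 2 * N + 1 := by
  rw [Int.card_Icc]
  have : ((N : ℤ) + 1 - -(N : ℤ)).toNat = 2 * N + 1 := by omega
  rw [this]
  push_cast
  ring

/-- The trigonometric polynomial of degree at most `N` with coefficients `a`. -/
noncomputable def trig (a : ℤ → ℂ) (N : ℕ) (x : Circle) : ℂ := ∑ n ∈ freq N, a n * circMono n x

/-- The `ℓ²` norm of the coefficients of degree at most `N`. -/
noncomputable def coeffNorm (a : ℤ → ℂ) (N : ℕ) : ℝ := √(∑ n ∈ freq N, ‖a n‖ ^ 2)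

/-- The function with Fourier multiplier `w` applied to five sequences of coefficients. -/
noncomputable def fiveSum (w : (Fin 5 → ℤ) → ℂ) (a : Fin 5 → ℤ → ℂ) (N : ℕ) : Lp ℂ 2 arc :=
  ∑ ν ∈ Fintype.piFinset fun _ : Fin 5 => freq N, (w ν * ∏ i, a i (ν i)) • monoLp (∑ i, ν i)

lemma coeffNorm_nonneg (a : ℤ → ℂ) (N : ℕ) : 0 ≤ coeffNorm a N := Real.sqrt_nonneg _

@[fun_prop]
lemma continuous_trig (a : ℤ → ℂ) (N : ℕ) : Continuous (trig a N) := by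
  unfold trig
  fun_prop

/-- The shift `k` is the sum of the four frequencies held fixed while the fifth varies; distinct `n`
still give orthogonal outputs. -/
lemma norm_sum_smul_monoLp (s : Finset ℤ) (c : ℤ → ℂ) (k : ℤ) :
    ‖∑ n ∈ s, c n • monoLp (n + k)‖ = √(∑ n ∈ s, ‖c n‖ ^ 2) := by
  have hv : Orthonormal ℂ fun n : ℤ => monoLp (n + k) :=
    orthonormal_monoLp.comp (fun n => n + k) (add_left_injective k)
  rw [eq_comm, Real.sqrt_eq_iff_eq_sq (Finset.sum_nonneg fun _ _ => by positivity) (norm_nonneg _)]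
  have h := hv.inner_sum c c s
  rw [inner_self_eq_norm_sq_to_K] at h
  have h2 : ((‖∑ n ∈ s, c n • monoLp (n + k)‖ ^ 2 : ℝ) : ℂ) = ((∑ n ∈ s, ‖c n‖ ^ 2 : ℝ) : ℂ) := by
    push_cast
    refine h.trans (Finset.sum_congr rfl fun n _ => ?_)
    rw [mul_comm, Complex.mul_conj, Complex.normSq_eq_norm_sq]
    push_cast
    rfl
  exact_mod_cast h2.symm

lemma coeFn_sum_smul_monoLp {ι : Type*} (s : Finset ι) (c : ι → ℂ) (k : ι → ℤ) :
    (∑ n ∈ s, c n • monoLp (k n) : Lp ℂ 2 arc) =ᵐ[arc] fun x => ∑ n ∈ s, c n * circMono (k n) x := by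
  classical
  induction s using Finset.induction_on with
  | empty =>
    simp only [Finset.sum_empty]
    exact Lp.coeFn_zero ..
  | insert a s ha ih =>
    simp only [Finset.sum_insert ha]
    filter_upwards [Lp.coeFn_add (c a • monoLp (k a)) (∑ n ∈ s, c n • monoLp (k n)),
      Lp.coeFn_smul (c a) (monoLp (k a)), (memLp_circMono (k a)).coeFn_toLp, ih] with x h1 h2 h3 h4
    rw [h1, Pi.add_apply, h2, Pi.smul_apply, h4, monoLp, h3, smul_eq_mul]

lemma eLpNorm_trig (a : ℤ → ℂ) (N : ℕ) :
    eLpNorm (trig a N) 2 arc = ENNReal.ofReal (coeffNorm a N) := by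
  have h := norm_sum_smul_monoLp (freq N) a 0
  simp only [add_zero] at h
  rw [coeffNorm, ← h, Lp.norm_def, ENNReal.ofReal_toReal (Lp.eLpNorm_ne_top _)]
  exact (eLpNorm_congr_ae (coeFn_sum_smul_monoLp (freq N) a fun n => n)).symm

lemma sum_norm_le_coeffNorm {a : ℤ → ℂ} {N L : ℕ} (h : ∀ n ∈ freq N, a n ≠ 0 → |(n : ℝ)| ≤ L) :
    ∑ n ∈ freq N, ‖a n‖ ≤ √(2 * L + 1) * coeffNorm a N := by
  classical
  have h1 : ∑ n ∈ freq N, ‖a n‖ = ∑ n ∈ freq N with n ∈ freq L, ‖a n‖ := by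
    rw [Finset.sum_filter]
    refine Finset.sum_congr rfl fun n hn => ?_
    split_ifs with hL
    · rfl
    · rw [norm_eq_zero]
      by_contra h0
      exact hL (mem_freq.2 (h n hn h0))
  rw [h1, coeffNorm, ← Real.sqrt_mul (by positivity)]
  apply Real.le_sqrt_of_sq_le
  refine sq_sum_le_card_mul_sum_sq.trans ?_
  refine mul_le_mul ?_ ?_ (Finset.sum_nonneg fun _ _ => by positivity) (by positivity)
  · rw [← card_freq]
    exact_mod_cast Finset.card_le_card fun n hn => (Finset.mem_filter.1 hn).2
  · exact Finset.sum_le_sum_of_subset_of_nonneg (Finset.filter_subset _ _) fun _ _ _ => by positivity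

/-- The normalization constant of the five-linear form. -/
noncomputable def normConst : ℂ := (((√(2 * Real.pi))⁻¹ : ℝ) : ℂ) ^ 4

lemma norm_normConst_le : ‖normConst‖ ≤ 1 := by
  rw [normConst, norm_pow, Complex.norm_real, Real.norm_of_nonneg (by positivity)]
  refine pow_le_one₀ (by positivity) (inv_le_one_of_one_le₀ ?_)
  rw [Real.one_le_sqrt]
  linarith [Real.pi_gt_three]

lemma prod_circMono (ν : Fin 5 → ℤ) (ω : Fin 5 → Circle) :
    ∏ i, circMono (ν i) (ω i) = (((√(2 * Real.pi))⁻¹ : ℝ) : ℂ) ^ 5 * ∏ i, (ω i : ℂ) ^ ν i := by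
  simp only [circMono, Finset.prod_mul_distrib, Finset.prod_const, Finset.card_univ,
    Fintype.card_fin]

/-- Of the five normalizing factors of the inputs, four make up `normConst` and the fifth normalizes
the output character. -/
lemma convAvg_trig (a : Fin 5 → ℤ → ℂ) (N : ℕ) {r : ℝ} (hr : 0 < r) (x : Circle) :
    convAvg (fun i => trig (a i) N) r x =
      ∑ ν ∈ Fintype.piFinset fun _ : Fin 5 => freq N,
        (normConst * convAvg (fun i z => (z : ℂ) ^ ν i) r 1 * ∏ i, a i (ν i)) *
          circMono (∑ i, ν i) x := by
  have h1 : ∀ ω : Fin 5 → Circle, ∏ i, trig (a i) N (ω i) =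
      ∑ ν ∈ Fintype.piFinset fun _ : Fin 5 => freq N,
        ((((√(2 * Real.pi))⁻¹ : ℝ) : ℂ) ^ 5 * ∏ i, a i (ν i)) * ∏ i, (ω i : ℂ) ^ ν i := by
    intro ω
    simp only [trig]
    rw [Finset.prod_univ_sum]
    refine Finset.sum_congr rfl fun ν _ => ?_
    rw [Finset.prod_mul_distrib, prod_circMono]
    ring
  rw [convAvg, convBall]
  simp_rw [h1]
  rw [integral_finsetSum, Finset.sum_div]
  · refine Finset.sum_congr rfl fun ν _ => ?_
    have h2 := convAvg_char_circle ν hr x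
    rw [integral_const_mul, mul_div_assoc]
    rw [convAvg, convBall] at h2
    rw [h2, circMono, normConst]
    ring
  · exact fun ν _ => ((integrable_of_continuous (continuous_prod_zpow ν)).const_mul _).integrableOn

lemma coeFn_fiveSum_convAvg (a : Fin 5 → ℤ → ℂ) (N : ℕ) {r : ℝ} (hr : 0 < r) :
    (fiveSum (fun ν => normConst * convAvg (fun i z => (z : ℂ) ^ ν i) r 1) a N) =ᵐ[arc]
      fun x : Circle => convAvg (fun i => trig (a i) N) r x := by
  refine (coeFn_sum_smul_monoLp _ _ _).trans (.of_forall fun x => ?_)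
  beta_reduce
  rw [convAvg_trig a N hr x]

lemma norm_monoLp (n : ℤ) : ‖monoLp n‖ = 1 := orthonormal_monoLp.1 n

/-- A crude termwise estimate: the Hölder constants contribute `(2N)^5`, and passing from `ℓ¹` to
`ℓ²` contributes at most `(3N)^5`. Any power of `N` would do, since `r` is later chosen as a power
of `N`. -/
lemma exists_norm_fiveSum_sub_le : ∃ C : ℝ, 0 < C ∧ ∀ (a : Fin 5 → ℤ → ℂ) (N : ℕ), 1 ≤ N →
    ∀ r : ℝ, 0 < r →
    ‖fiveSum (fun ν => normConst * convAvg (fun i z => (z : ℂ) ^ ν i) r 1) a N -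
      fiveSum (fun ν => normConst * kern ν) a N‖ ≤
      C * (r ^ (1 / 4 : ℝ) * N ^ 10) * ∏ i, coeffNorm (a i) N := by
  obtain ⟨C, hC, hb⟩ := exists_norm_convAvg_char_sub_kern_le
  refine ⟨C * 2 ^ 5 * 3 ^ 5, by positivity, fun a N hN r hr => ?_⟩
  have hNR : (1 : ℝ) ≤ N := by exact_mod_cast hN
  rw [fiveSum, fiveSum, ← Finset.sum_sub_distrib]
  refine (norm_sum_le _ _).trans ?_
  have h1 : ∀ ν ∈ Fintype.piFinset fun _ : Fin 5 => freq N,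
      ‖(normConst * convAvg (fun i z => (z : ℂ) ^ ν i) r 1 * ∏ i, a i (ν i)) • monoLp (∑ i, ν i) -
        (normConst * kern ν * ∏ i, a i (ν i)) • monoLp (∑ i, ν i)‖ ≤
      C * (2 * N) ^ 5 * r ^ (1 / 4 : ℝ) * ∏ i, ‖a i (ν i)‖ := by
    intro ν hν
    rw [← sub_smul, ← sub_mul, ← mul_sub, norm_smul, norm_mul, norm_mul, norm_monoLp, mul_one,
      norm_prod]
    refine mul_le_mul_of_nonneg_right ?_ (Finset.prod_nonneg fun _ _ => norm_nonneg _)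
    refine (mul_le_of_le_one_left (norm_nonneg _) norm_normConst_le).trans ((hb ν r hr).trans ?_)
    refine mul_le_mul_of_nonneg_right (mul_le_mul_of_nonneg_left ?_ hC.le) (by positivity)
    refine (Finset.prod_le_prod (g := fun _ => 2 * (N : ℝ)) (fun _ _ => by positivity)
      fun i _ => ?_).trans (le_of_eq (by simp))
    have := mem_freq.1 (Fintype.mem_piFinset.1 hν i)
    linarith
  refine (Finset.sum_le_sum h1).trans ?_
  rw [← Finset.mul_sum, ← Finset.prod_univ_sum (fun _ : Fin 5 => freq N) (fun i n => ‖a i n‖)]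
  have h2 : ∏ i, ∑ n ∈ freq N, ‖a i n‖ ≤ ∏ i : Fin 5, ((3 * N) * coeffNorm (a i) N) := by
    refine Finset.prod_le_prod (fun i _ => Finset.sum_nonneg fun _ _ => norm_nonneg _) fun i _ => ?_
    refine (sum_norm_le_coeffNorm (fun n hn _ => mem_freq.1 hn)).trans
      (mul_le_mul_of_nonneg_right ?_ (coeffNorm_nonneg _ _))
    rw [Real.sqrt_le_iff]
    constructor
    · positivity
    · nlinarith
  refine (mul_le_mul_of_nonneg_left h2 (by positivity)).trans (le_of_eq ?_)
  rw [Finset.prod_mul_distrib, Finset.prod_const, Finset.card_univ, Fintype.card_fin]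
  ring

/-- The five-linear form is bounded on `L²` up to an arbitrarily small power of the degree. -/
lemma exists_norm_fiveSum_kern_le {η : ℝ} (h0 : 0 < η) (h1 : η ≤ 1) :
    ∃ C : ℝ, 0 < C ∧ ∀ (a : Fin 5 → ℤ → ℂ) (N : ℕ), 1 ≤ N →
      ‖fiveSum (fun ν => normConst * kern ν) a N‖ ≤
        C * (N : ℝ) ^ η * ∏ i, coeffNorm (a i) N := by
  obtain ⟨C₁, hC₁, hb₁⟩ := exists_norm_fiveSum_sub_le
  obtain ⟨C₂, hC₂, hb₂⟩ := exists_eLpNorm_convAvg_le (κ := η / 40) (by positivity) (by linarith)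
  refine ⟨C₁ + C₂, by positivity, fun a N hN => ?_⟩
  have hNR : (1 : ℝ) ≤ N := by exact_mod_cast hN
  have hN0 : (0 : ℝ) < N := by linarith
  -- Then `r^(1/4) N^10 = 1` makes the error harmless, and the loss `r^(-η/40)` for averages is
  -- exactly `N ^ η`.
  set r : ℝ := (N : ℝ) ^ (-40 : ℝ) with hr
  have hr0 : 0 < r := by positivity
  have hr1 : r ≤ 1 := Real.rpow_le_one_of_one_le_of_nonpos hNR (by norm_num)
  set P := ∏ i, coeffNorm (a i) N with hP
  have hP0 : 0 ≤ P := Finset.prod_nonneg fun i _ => coeffNorm_nonneg _ _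
  have e1 := hb₁ a N hN r hr0
  have e2 : ‖fiveSum (fun ν => normConst * convAvg (fun i z => (z : ℂ) ^ ν i) r 1) a N‖ ≤
      C₂ * (N : ℝ) ^ η * P := by
    have h2 := hb₂ (fun i => trig (a i) N) (fun i => (continuous_trig _ _).measurable) r hr0 hr1
    simp only [eLpNorm_trig] at h2
    rw [Lp.norm_def, eLpNorm_congr_ae (coeFn_fiveSum_convAvg a N hr0)]
    refine ENNReal.toReal_le_of_le_ofReal (by positivity) (h2.trans (le_of_eq ?_))
    rw [← ENNReal.ofReal_prod_of_nonneg (fun i _ => coeffNorm_nonneg _ _),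
      ← ENNReal.ofReal_mul (by positivity), hr, ← Real.rpow_mul hN0.le]
    congr 4
    ring
  have e3 : r ^ (1 / 4 : ℝ) * (N : ℝ) ^ 10 = 1 := by
    rw [hr, ← Real.rpow_mul hN0.le, ← Real.rpow_natCast, ← Real.rpow_add hN0]
    norm_num
  rw [e3, mul_one] at e1
  have e4 : 1 ≤ (N : ℝ) ^ η := Real.one_le_rpow hNR h0.le
  have e5 := norm_le_norm_add_norm_sub'
    (fiveSum (fun ν => normConst * kern ν) a N)
    (fiveSum (fun ν => normConst * convAvg (fun i z => (z : ℂ) ^ ν i) r 1) a N)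
  rw [norm_sub_rev] at e5
  have e6 : C₁ * P ≤ C₁ * (N : ℝ) ^ η * P := by
    rw [mul_assoc]
    exact mul_le_mul_of_nonneg_left (le_mul_of_one_le_left hP0 e4) hC₁.le
  calc _ ≤ _ := e5
    _ ≤ C₂ * (N : ℝ) ^ η * P + C₁ * P := add_le_add e2 e1
    _ ≤ _ := by linarith

lemma sum_piFinset_insertNth {M : Type*} [AddCommMonoid M] (S : Finset ℤ) (i : Fin 5)
    (g : (Fin 5 → ℤ) → M) :
    ∑ ν ∈ Fintype.piFinset (fun _ : Fin 5 => S), g ν =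
      ∑ μ ∈ Fintype.piFinset (fun _ : Fin 4 => S), ∑ n ∈ S,
        g (i.insertNth (α := fun _ => ℤ) n μ) := by
  rw [Finset.sum_comm, ← Finset.sum_product']
  refine (Finset.sum_equiv (Fin.insertNthEquiv (fun _ => ℤ) i) (fun p => ?_) fun p _ => rfl).symm
  simp only [Finset.mem_product, Fintype.mem_piFinset, Fin.insertNthEquiv_apply]
  rw [Fin.forall_iff_succAbove i]
  simp

/-- The five-linear form gains a power of the frequency when four of the functions have low
frequency. -/
lemma exists_norm_fiveSum_kern_gain : ∃ C : ℝ, 0 < C ∧ ∀ (a : Fin 5 → ℤ → ℂ) (i : Fin 5) (N L : ℕ)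
    (M : ℝ), 1 ≤ L → 0 ≤ M → (∀ n ∈ freq N, a i n ≠ 0 → M ≤ |(n : ℝ)|) →
      (∀ j, j ≠ i → ∀ n ∈ freq N, a j n ≠ 0 → |(n : ℝ)| ≤ L) →
      ‖fiveSum (fun ν => normConst * kern ν) a N‖ ≤
        C * ((1 + M) ^ (-(1 / 10) : ℝ) * L ^ 8) * ∏ j, coeffNorm (a j) N := by
  obtain ⟨C, hC, hb⟩ := exists_norm_kern_le
  refine ⟨C * 2 ^ 4 * 3 ^ 4, by positivity, fun a i N L M hL hM hai haj => ?_⟩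
  have hLR : (1 : ℝ) ≤ L := by exact_mod_cast hL
  set D := C * (1 + M) ^ (-(1 / 10) : ℝ) * (2 * L) ^ 4 with hD
  have hD0 : 0 ≤ D := by positivity
  -- With the four low frequencies fixed, the outputs are orthonormal in `n`, so the high input
  -- enters through its `ℓ²` norm without loss. Only the low inputs are summed in `ℓ¹`, whence
  -- `(2L)^4 (3L)^4`.
  have hinner : ∀ μ ∈ Fintype.piFinset (fun _ : Fin 4 => freq N),
      ‖∑ n ∈ freq N, (normConst * kern (i.insertNth (α := fun _ => ℤ) n μ) *
        ∏ j, a j ((i.insertNth (α := fun _ => ℤ) n μ : Fin 5 → ℤ) j)) •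
          monoLp (∑ j, (i.insertNth (α := fun _ => ℤ) n μ : Fin 5 → ℤ) j)‖ ≤
      D * coeffNorm (a i) N * ∏ j : Fin 4, ‖a (i.succAbove j) (μ j)‖ := by
    intro μ hμ
    simp only [Fin.prod_univ_succAbove _ i, Fin.sum_univ_succAbove _ i, Fin.insertNth_apply_same,
      Fin.insertNth_apply_succAbove]
    rw [norm_sum_smul_monoLp]
    rw [coeffNorm, ← Real.sqrt_sq hD0, ← Real.sqrt_mul (by positivity),
      ← Real.sqrt_sq (Finset.prod_nonneg fun (j : Fin 4) _ => norm_nonneg (a (i.succAbove j) (μ j))),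
      ← Real.sqrt_mul (by positivity)]
    apply Real.sqrt_le_sqrt
    rw [Finset.mul_sum, Finset.sum_mul]
    refine Finset.sum_le_sum fun n hn => ?_
    rw [← mul_pow, ← mul_pow]
    refine pow_le_pow_left₀ (norm_nonneg _) ?_ 2
    rw [norm_mul, norm_mul, norm_mul, norm_prod, ← mul_assoc]
    by_cases h0 : a i n = 0
    · simp [h0]
    by_cases hz : ∏ j : Fin 4, ‖a (i.succAbove j) (μ j)‖ = 0
    · simp [hz]
    refine mul_le_mul_of_nonneg_right ?_ (Finset.prod_nonneg fun _ _ => norm_nonneg _)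
    refine mul_le_mul_of_nonneg_right ?_ (norm_nonneg _)
    refine (mul_le_of_le_one_left (norm_nonneg _) norm_normConst_le).trans
      ((hb (i.insertNth (α := fun _ => ℤ) n μ) i).trans ?_)
    simp only [Fin.insertNth_apply_same, Fin.insertNth_apply_succAbove]
    rw [hD]
    refine mul_le_mul (mul_le_mul_of_nonneg_left ?_ hC.le) ?_
      (Finset.prod_nonneg fun _ _ => by positivity) (by positivity)
    · refine Real.rpow_le_rpow_of_nonpos (by positivity) ?_ (by norm_num)
      linarith [hai n hn h0]
    · refine (Finset.prod_le_prod (g := fun _ => 2 * (L : ℝ)) (fun _ _ => by positivity)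
        fun j _ => ?_).trans (le_of_eq (by simp))
      have h1 : a (i.succAbove j) (μ j) ≠ 0 :=
        norm_ne_zero_iff.1 (Finset.prod_ne_zero_iff.1 hz j (Finset.mem_univ _))
      have := haj _ (Fin.succAbove_ne i j) _ (Fintype.mem_piFinset.1 hμ j) h1
      linarith
  rw [fiveSum, sum_piFinset_insertNth _ i]
  refine (norm_sum_le _ _).trans ((Finset.sum_le_sum hinner).trans ?_)
  rw [← Finset.mul_sum, ← Finset.prod_univ_sum (fun _ : Fin 4 => freq N)
    (fun j n => ‖a (i.succAbove j) n‖)]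
  have h2 : ∏ j : Fin 4, ∑ n ∈ freq N, ‖a (i.succAbove j) n‖ ≤
      ∏ j : Fin 4, ((3 * L) * coeffNorm (a (i.succAbove j)) N) := by
    refine Finset.prod_le_prod (fun i _ => Finset.sum_nonneg fun _ _ => norm_nonneg _) fun j _ => ?_
    refine (sum_norm_le_coeffNorm (haj _ (Fin.succAbove_ne i j))).trans
      (mul_le_mul_of_nonneg_right ?_ (coeffNorm_nonneg _ _))
    rw [Real.sqrt_le_iff]
    constructor
    · positivity
    · nlinarith
  refine (mul_le_mul_of_nonneg_left h2 (mul_nonneg hD0 (coeffNorm_nonneg _ _))).trans (le_of_eq ?_)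
  rw [Finset.prod_mul_distrib, Finset.prod_const, Finset.card_univ, Fintype.card_fin,
    Fin.prod_univ_succAbove _ i, hD]
  ring

/-! ### Dyadic increments of the five-linear form -/

lemma fiveSum_sum {κ : Type*} [Fintype κ] [DecidableEq κ] (w : (Fin 5 → ℤ) → ℂ)
    (b : κ → ℤ → ℂ) (N : ℕ) :
    fiveSum w (fun _ n => ∑ k, b k n) N = ∑ u : Fin 5 → κ, fiveSum w (fun i => b (u i)) N := by
  simp only [fiveSum]
  rw [Finset.sum_comm]
  refine Finset.sum_congr rfl fun ν _ => ?_
  rw [Finset.prod_univ_sum, Finset.mul_sum, Finset.sum_smul, Fintype.piFinset_univ]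

lemma fiveSum_eq_zero (w : (Fin 5 → ℤ) → ℂ) {a : Fin 5 → ℤ → ℂ} {i : Fin 5} (h : a i = 0) (N : ℕ) :
    fiveSum w a N = 0 := by
  refine Finset.sum_eq_zero fun ν _ => ?_
  rw [Finset.prod_eq_zero (Finset.mem_univ i) (by rw [h]; rfl), mul_zero, zero_smul]

lemma freq_subset {M N : ℕ} (h : M ≤ N) : freq M ⊆ freq N :=
  Finset.Icc_subset_Icc (by omega) (by omega)

lemma fiveSum_eq_of_le (w : (Fin 5 → ℤ) → ℂ) {a b : Fin 5 → ℤ → ℂ} {M N : ℕ} (h : M ≤ N)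
    (h1 : ∀ i, ∀ n ∈ freq M, b i n = a i n) (h2 : ∀ i, ∀ n ∉ freq M, b i n = 0) :
    fiveSum w b N = fiveSum w a M := by
  refine (Finset.sum_subset (Fintype.piFinset_subset _ _ fun _ => freq_subset h)
    fun ν _ hν => ?_).symm.trans (Finset.sum_congr rfl fun ν hν => ?_)
  · rw [Fintype.mem_piFinset, not_forall] at hν
    obtain ⟨i, hi⟩ := hν
    rw [Finset.prod_eq_zero (Finset.mem_univ i) (h2 i _ hi), mul_zero, zero_smul]
  · rw [Finset.prod_congr rfl fun i _ => h1 i _ (Fintype.mem_piFinset.1 hν i)]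

/-- The Sobolev norm of order `s` of `a` is at most `B`. -/
def SobolevBound (s B : ℝ) (a : ℤ → ℂ) : Prop :=
  ∀ S : Finset ℤ, ∑ n ∈ S, (1 + |(n : ℝ)|) ^ (2 * s) * ‖a n‖ ^ 2 ≤ B ^ 2

lemma SobolevSummable.exists_bound {s : ℝ} {a : ℤ → ℂ} (h : SobolevSummable s a) :
    ∃ B : ℝ, 0 ≤ B ∧ SobolevBound s B a := by
  refine ⟨√(∑' n : ℤ, (1 + |(n : ℝ)|) ^ (2 * s) * ‖a n‖ ^ 2), Real.sqrt_nonneg _, fun S => ?_⟩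
  rw [Real.sq_sqrt (tsum_nonneg fun n => by positivity)]
  exact h.sum_le_tsum S fun n _ => by positivity

lemma SobolevBound.sum_sq_le {s B M : ℝ} {a c : ℤ → ℂ} (hB : SobolevBound s B a) (hs : 0 ≤ s)
    (hM : 0 ≤ M) (hc : ∀ n, ‖c n‖ ≤ ‖a n‖) (hcM : ∀ n : ℤ, c n ≠ 0 → M ≤ |(n : ℝ)|)
    (S : Finset ℤ) : ∑ n ∈ S, ‖c n‖ ^ 2 ≤ (B * (1 + M) ^ (-s)) ^ 2 := by
  have hM0 : 0 < 1 + M := by linarith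
  have h1 : ∀ n ∈ S, ‖c n‖ ^ 2 ≤
      ((1 + |(n : ℝ)|) ^ (2 * s) * ‖a n‖ ^ 2) * ((1 + M) ^ (-s)) ^ 2 := by
    intro n _
    rcases eq_or_ne (c n) 0 with h0 | h0
    · rw [h0, norm_zero, zero_pow two_ne_zero]
      positivity
    · have h2 : (1 + M) ^ s ≤ (1 + |(n : ℝ)|) ^ s :=
        Real.rpow_le_rpow hM0.le (by linarith [hcM n h0]) hs
      have h3 : 1 ≤ (1 + |(n : ℝ)|) ^ s * (1 + M) ^ (-s) := by
        rw [Real.rpow_neg hM0.le, ← div_eq_mul_inv, one_le_div (by positivity)]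
        exact h2
      have h4 : (1 + |(n : ℝ)|) ^ (2 * s) = ((1 + |(n : ℝ)|) ^ s) ^ 2 := by
        rw [← Real.rpow_natCast, ← Real.rpow_mul (by positivity), mul_comm]
        norm_num
      have h5 : ‖c n‖ ≤ ((1 + |(n : ℝ)|) ^ s * (1 + M) ^ (-s)) * ‖a n‖ :=
        (hc n).trans (le_mul_of_one_le_left (norm_nonneg _) h3)
      refine (pow_le_pow_left₀ (norm_nonneg _) h5 2).trans (le_of_eq ?_)
      rw [h4]
      ring
  refine (Finset.sum_le_sum h1).trans ?_
  rw [← Finset.sum_mul, mul_pow]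
  exact mul_le_mul_of_nonneg_right (hB S) (by positivity)

lemma SobolevBound.coeffNorm_le {s B M : ℝ} {a c : ℤ → ℂ} (hB : SobolevBound s B a) (hB0 : 0 ≤ B)
    (hs : 0 ≤ s) (hM : 0 ≤ M) (hc : ∀ n, ‖c n‖ ≤ ‖a n‖) (hcM : ∀ n : ℤ, c n ≠ 0 → M ≤ |(n : ℝ)|)
    (N : ℕ) : coeffNorm c N ≤ B * (1 + M) ^ (-s) :=
  Real.sqrt_le_iff.2 ⟨by positivity, hB.sum_sq_le hs hM hc hcM _⟩

lemma SobolevBound.coeffNorm_le_self {s B : ℝ} {a c : ℤ → ℂ} (hB : SobolevBound s B a)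
    (hB0 : 0 ≤ B) (hs : 0 ≤ s) (hc : ∀ n, ‖c n‖ ≤ ‖a n‖) (N : ℕ) : coeffNorm c N ≤ B := by
  simpa using hB.coeffNorm_le hB0 hs le_rfl hc (fun n _ => abs_nonneg _) N

/-- Low, middle and high frequencies of a sequence. -/
noncomputable def band (a : ℤ → ℂ) (L M : ℕ) : Fin 3 → ℤ → ℂ :=
  ![fun n => if n ∈ freq L then a n else 0,
    fun n => if n ∈ freq M ∧ n ∉ freq L then a n else 0,
    fun n => if n ∈ freq M then 0 else a n]

lemma norm_band_le (a : ℤ → ℂ) (L M : ℕ) (k : Fin 3) (n : ℤ) : ‖band a L M k n‖ ≤ ‖a n‖ := by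
  fin_cases k <;> simp only [band, Fin.zero_eta, Fin.mk_one, Fin.reduceFinMk, Matrix.cons_val]
  all_goals
    split_ifs
    all_goals simp

lemma sum_band (a : ℤ → ℂ) {L M : ℕ} (h : L ≤ M) (n : ℤ) : ∑ k, band a L M k n = a n := by
  rw [Fin.sum_univ_three]
  have := @freq_subset L M h n
  simp only [band, Matrix.cons_val]
  split_ifs <;> simp_all

/-- Deleting the high band truncates at degree `M`, so the form at degree `M` expands over the same
words in the bands as the form at degree `N`. -/
lemma sum_band_low {a : ℤ → ℂ} {L M : ℕ} (h : L ≤ M) (n : ℤ) :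
    ∑ k, Function.update (band a L M) 2 0 k n = if n ∈ freq M then a n else 0 := by
  rw [Fin.sum_univ_three]
  have := @freq_subset L M h n
  simp only [band, Function.update_self, Function.update_of_ne, ne_eq, Fin.reduceEq,
    not_false_eq_true, Matrix.cons_val]
  split_ifs <;> simp_all

lemma le_of_band_two_ne_zero {a : ℤ → ℂ} {L M : ℕ} {n : ℤ} (h : band a L M 2 n ≠ 0) :
    (M : ℝ) ≤ |(n : ℝ)| := by
  by_contra! hn
  exact h (if_pos (mem_freq.2 hn.le))

lemma le_of_band_zero_ne_zero {a : ℤ → ℂ} {L M : ℕ} {n : ℤ} (h : band a L M 0 n ≠ 0) :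
    |(n : ℝ)| ≤ L := by
  by_contra! hn
  exact h (if_neg fun h2 => hn.not_ge (mem_freq.1 h2))

lemma le_of_band_ne_zero {a : ℤ → ℂ} {L M : ℕ} (hLM : L ≤ M) {k : Fin 3} (hk : k ≠ 0) {n : ℤ}
    (h : band a L M k n ≠ 0) : (L : ℝ) ≤ |(n : ℝ)| := by
  by_contra! hn
  have hL : n ∈ freq L := mem_freq.2 hn.le
  have hM := freq_subset hLM hL
  apply h
  fin_cases k <;> simp_all [band]

lemma prod_le_of_two {B x y : ℝ} {c : Fin 5 → ℝ} {i j : Fin 5} (hij : i ≠ j)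
    (h0 : ∀ k, 0 ≤ c k) (h : ∀ k, c k ≤ B) (hi : c i ≤ B * x) (hj : c j ≤ B * y) :
    ∏ k, c k ≤ B ^ 5 * (x * y) := by
  have h1 : ∏ k, c k ≤ ∏ k, (B * ((if k = i then x else 1) * (if k = j then y else 1))) := by
    refine Finset.prod_le_prod (fun k _ => h0 k) fun k _ => ?_
    by_cases hki : k = i
    · subst hki
      simpa [hij] using hi
    · by_cases hkj : k = j
      · subst hkj
        simpa [hki] using hj
      · simpa [hki, hkj] using h k
  refine h1.trans (le_of_eq ?_)
  rw [Finset.prod_mul_distrib, Finset.prod_mul_distrib, Finset.prod_ite_eq', Finset.prod_ite_eq']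
  simp

/-- The limiting five-linear form, applied five times to the sequence `a` cut off at degree `N`. -/
noncomputable def limitSum (a : ℤ → ℂ) (N : ℕ) : Lp ℂ 2 arc :=
  fiveSum (fun ν => normConst * kern ν) (fun _ => a) N

/-- The difference expands into `3^5` words in the low, middle and high bands, and words without a
high letter cancel. If all letters beside a high one are low, the frequency gain applies. If some
other letter is not low, the bound with `N ^ η` applies and the two letters give `(1 + M)^(-s)` and
`(1 + L)^(-s)`. -/
lemma exists_norm_limitSum_sub_le {η : ℝ} (h0 : 0 < η) (h1 : η ≤ 1) :
    ∃ C : ℝ, 0 < C ∧ ∀ (s B : ℝ) (a : ℤ → ℂ), 0 ≤ s → 0 ≤ B → SobolevBound s B a →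
      ∀ L M N : ℕ, 1 ≤ L → L ≤ M → M ≤ N →
      ‖limitSum a N - limitSum a M‖ ≤ C * B ^ 5 * (1 + M : ℝ) ^ (-s) *
        ((1 + M : ℝ) ^ (-(1 / 10) : ℝ) * L ^ 8 + (N : ℝ) ^ η * (1 + L : ℝ) ^ (-s)) := by
  obtain ⟨C₁, hC₁, hb₁⟩ := exists_norm_fiveSum_kern_gain
  obtain ⟨C₂, hC₂, hb₂⟩ := exists_norm_fiveSum_kern_le h0 h1
  refine ⟨3 ^ 5 * (C₁ + C₂), by positivity, fun s B a hs hB0 hB L M N hL hLM hMN => ?_⟩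
  set Q : ℝ := (C₁ + C₂) * B ^ 5 * (1 + M : ℝ) ^ (-s) *
        ((1 + M : ℝ) ^ (-(1 / 10) : ℝ) * L ^ 8 + (N : ℝ) ^ η * (1 + L : ℝ) ^ (-s)) with hQ
  have hQ0 : 0 ≤ Q := by positivity
  have e1 : limitSum a N = ∑ u : Fin 5 → Fin 3,
      fiveSum (fun ν => normConst * kern ν) (fun i => band a L M (u i)) N := by
    rw [← fiveSum_sum, limitSum]
    congr 1
    funext _ n
    exact (sum_band a hLM n).symm
  have e2 : limitSum a M = ∑ u : Fin 5 → Fin 3,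
      fiveSum (fun ν => normConst * kern ν) (fun i => Function.update (band a L M) 2 0 (u i)) N := by
    rw [← fiveSum_sum, limitSum]
    refine (fiveSum_eq_of_le _ hMN (fun _ n hn => ?_) fun _ n hn => ?_).symm
    · rw [sum_band_low hLM, if_pos hn]
    · rw [sum_band_low hLM, if_neg hn]
  have hcn : ∀ k, coeffNorm (band a L M k) N ≤ B := fun k =>
    hB.coeffNorm_le_self hB0 hs (norm_band_le a L M k) N
  have hc2 : coeffNorm (band a L M 2) N ≤ B * (1 + M : ℝ) ^ (-s) :=
    hB.coeffNorm_le hB0 hs (by positivity) (norm_band_le a L M 2)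
      (fun n hn => le_of_band_two_ne_zero hn) N
  have hword : ∀ u : Fin 5 → Fin 3,
      ‖fiveSum (fun ν => normConst * kern ν) (fun i => band a L M (u i)) N -
        fiveSum (fun ν => normConst * kern ν)
          (fun i => Function.update (band a L M) 2 0 (u i)) N‖ ≤ Q := by
    intro u
    by_cases hu : ∃ i, u i = 2
    · obtain ⟨i, hi⟩ := hu
      rw [fiveSum_eq_zero (a := fun i => Function.update (band a L M) 2 0 (u i)) (i := i) _
        (by simp [hi]), sub_zero]
      by_cases hj : ∃ j, j ≠ i ∧ u j ≠ 0
      · obtain ⟨j, hji, hj0⟩ := hj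
        have h3 : coeffNorm (band a L M (u j)) N ≤ B * (1 + L : ℝ) ^ (-s) :=
          hB.coeffNorm_le hB0 hs (by positivity) (norm_band_le a L M _)
            (fun n hn => le_of_band_ne_zero hLM hj0 hn) N
        have h4 := prod_le_of_two (c := fun k => coeffNorm (band a L M (u k)) N) hji.symm
          (fun k => coeffNorm_nonneg _ _) (fun k => hcn _) (by rw [hi]; exact hc2) h3
        refine (hb₂ _ N (by omega)).trans ((mul_le_mul_of_nonneg_left h4 (by positivity)).trans ?_)
        calc C₂ * (N : ℝ) ^ η * (B ^ 5 * ((1 + M : ℝ) ^ (-s) * (1 + L : ℝ) ^ (-s)))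
            = C₂ * B ^ 5 * (1 + M : ℝ) ^ (-s) * (0 + (N : ℝ) ^ η * (1 + L : ℝ) ^ (-s)) := by ring
          _ ≤ Q := by
            rw [hQ]
            gcongr
            · linarith
            · positivity
      · push Not at hj
        obtain ⟨j, hji⟩ : ∃ j : Fin 5, j ≠ i := exists_ne i
        have h4 := prod_le_of_two (c := fun k => coeffNorm (band a L M (u k)) N) (y := 1)
          hji.symm (fun k => coeffNorm_nonneg _ _) (fun k => hcn _) (by rw [hi]; exact hc2)
          (by rw [mul_one]; exact hcn _)
        refine (hb₁ _ i N L M hL (by positivity) (fun n _ hn => ?_) fun j hj' n _ hn => ?_).trans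
          ((mul_le_mul_of_nonneg_left h4 (by positivity)).trans ?_)
        · rw [hi] at hn
          exact le_of_band_two_ne_zero hn
        · rw [hj j hj'] at hn
          exact le_of_band_zero_ne_zero hn
        calc C₁ * ((1 + M : ℝ) ^ (-(1 / 10) : ℝ) * L ^ 8) * (B ^ 5 * ((1 + M : ℝ) ^ (-s) * 1))
            = C₁ * B ^ 5 * (1 + M : ℝ) ^ (-s) * ((1 + M : ℝ) ^ (-(1 / 10) : ℝ) * L ^ 8 + 0) := by
              ring
          _ ≤ Q := by
            rw [hQ]
            gcongr
            · linarith
            · positivity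
    · push Not at hu
      have : (fun i => Function.update (band a L M) 2 0 (u i)) = fun i => band a L M (u i) :=
        funext fun i => Function.update_of_ne (hu i) _ _
      rw [this, sub_self, norm_zero]
      exact hQ0
  rw [e1, e2, ← Finset.sum_sub_distrib]
  refine (norm_sum_le _ _).trans ((Finset.sum_le_sum fun u _ => hword u).trans (le_of_eq ?_))
  rw [Finset.sum_const, Finset.card_univ, Fintype.card_fun, Fintype.card_fin, Fintype.card_fin,
    nsmul_eq_mul, hQ]
  push_cast
  ring

/-- Along dyadic truncations the five-linear form gains a fixed power of the frequency. -/
lemma exists_norm_limitSum_succ_sub_le {ε : ℝ} (h0 : 0 < ε) (h1 : ε ≤ 1) {s B : ℝ} {a : ℤ → ℂ}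
    (hs : ε / 2 ≤ s) (hB0 : 0 ≤ B) (hB : SobolevBound s B a) :
    ∃ K : ℝ, ∀ J : ℕ, ‖limitSum a (2 ^ (J + 1)) - limitSum a (2 ^ J)‖ ≤
      K * ((2 : ℝ) ^ (-(s + ε / 640))) ^ J := by
  obtain ⟨C, hC, hb⟩ := exists_norm_limitSum_sub_le (η := ε / 640) (by positivity) (by linarith)
  refine ⟨C * B ^ 5 * 3, fun J => ?_⟩
  have hs0 : 0 ≤ s := by linarith
  set x : ℝ := (2 : ℝ) ^ (J : ℝ) with hx
  have hx1 : 1 ≤ x := Real.one_le_rpow (by norm_num) (by positivity)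
  have hx0 : 0 < x := by linarith
  have hxJ : ((2 ^ J : ℕ) : ℝ) = x := by rw [hx, Real.rpow_natCast]; push_cast; rfl
  -- With this choice `L^8 ≤ x^(1/20)` uses up only half of the gain `x^(-1/10)`. Since `s ≥ ε/2`,
  -- also `(1 + L)^(-s) ≤ x^(-ε/320)`, which beats the loss `(2x)^(ε/640)` by `x^(-ε/640)` up to a
  -- constant.
  set L := ⌊x ^ (1 / 160 : ℝ)⌋₊ with hL
  have hy1 : 1 ≤ x ^ (1 / 160 : ℝ) := Real.one_le_rpow hx1 (by norm_num)
  have hLle : (L : ℝ) ≤ x ^ (1 / 160 : ℝ) := Nat.floor_le (by positivity)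
  have hL1 : 1 ≤ L := Nat.le_floor (by simpa using hy1)
  have hLM : L ≤ 2 ^ J := by
    have : (L : ℝ) ≤ ((2 ^ J : ℕ) : ℝ) := by
      rw [hxJ]
      refine hLle.trans ?_
      exact Real.rpow_le_self_of_one_le hx1 (by norm_num)
    exact_mod_cast this
  refine (hb s B a hs0 hB0 hB L (2 ^ J) (2 ^ (J + 1)) hL1 hLM
    (Nat.pow_le_pow_right (by norm_num) (by omega))).trans ?_
  have hN : ((2 ^ (J + 1) : ℕ) : ℝ) = 2 * x := by
    rw [pow_succ, Nat.cast_mul, hxJ]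
    push_cast
    ring
  rw [hxJ, hN]
  have f1 : (1 + x) ^ (-s) ≤ x ^ (-s) :=
    Real.rpow_le_rpow_of_nonpos hx0 (by linarith) (by linarith)
  have f2 : (1 + x) ^ (-(1 / 10) : ℝ) * L ^ 8 ≤ x ^ (-(ε / 640)) := by
    have g1 : (1 + x) ^ (-(1 / 10) : ℝ) ≤ x ^ (-(1 / 10) : ℝ) :=
      Real.rpow_le_rpow_of_nonpos hx0 (by linarith) (by norm_num)
    have g2 : (L : ℝ) ^ 8 ≤ x ^ (1 / 20 : ℝ) := by
      refine (pow_le_pow_left₀ (by positivity) hLle 8).trans (le_of_eq ?_)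
      rw [← Real.rpow_natCast, ← Real.rpow_mul hx0.le]
      norm_num
    refine (mul_le_mul g1 g2 (by positivity) (by positivity)).trans ?_
    rw [← Real.rpow_add hx0]
    exact Real.rpow_le_rpow_of_exponent_le hx1 (by linarith)
  have f3 : (2 * x) ^ (ε / 640) * (1 + L : ℝ) ^ (-s) ≤ 2 * x ^ (-(ε / 640)) := by
    have g1 : (2 * x) ^ (ε / 640) ≤ 2 * x ^ (ε / 640) := by
      rw [Real.mul_rpow (by norm_num) hx0.le]
      refine mul_le_mul_of_nonneg_right ?_ (by positivity)
      exact Real.rpow_le_self_of_one_le (by norm_num) (by linarith)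
    have g2 : (1 + L : ℝ) ^ (-s) ≤ x ^ (-(ε / 320)) := by
      have : x ^ (1 / 160 : ℝ) ≤ 1 + L := by
        rw [add_comm]
        exact (Nat.lt_floor_add_one _).le
      refine (Real.rpow_le_rpow_of_nonpos (by positivity) this (by linarith)).trans ?_
      rw [← Real.rpow_mul hx0.le]
      exact Real.rpow_le_rpow_of_exponent_le hx1 (by linarith)
    refine (mul_le_mul g1 g2 (by positivity) (by positivity)).trans (le_of_eq ?_)
    rw [mul_assoc, ← Real.rpow_add hx0]
    congr 2
    ring
  have f4 : ((2 : ℝ) ^ (-(s + ε / 640))) ^ J = x ^ (-s) * x ^ (-(ε / 640)) := by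
    rw [← Real.rpow_add hx0, hx, ← Real.rpow_natCast, ← Real.rpow_mul (by norm_num),
      ← Real.rpow_mul (by norm_num)]
    congr 1
    ring
  rw [f4]
  calc C * B ^ 5 * (1 + x) ^ (-s) * ((1 + x) ^ (-(1 / 10) : ℝ) * L ^ 8 +
        (2 * x) ^ (ε / 640) * (1 + L : ℝ) ^ (-s))
      ≤ C * B ^ 5 * x ^ (-s) * (x ^ (-(ε / 640)) + 2 * x ^ (-(ε / 640))) := by gcongr
    _ = _ := by ring

/-! ### Regularity of dyadic limits -/

lemma hat_fiveSum_eq_zero (w : (Fin 5 → ℤ) → ℂ) (a : Fin 5 → ℤ → ℂ) {N : ℕ} {n : ℤ}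
    (hn : 5 * (N : ℝ) < |(n : ℝ)|) : hat (fiveSum w a N) n = 0 := by
  rw [← inner_monoLp, fiveSum, inner_sum]
  refine Finset.sum_eq_zero fun ν hν => ?_
  rw [inner_smul_right, orthonormal_monoLp.2, mul_zero]
  rintro rfl
  refine hn.not_ge ?_
  push_cast
  refine (Finset.abs_sum_le_sum_abs _ _).trans ?_
  refine (Finset.sum_le_sum fun i _ => mem_freq.1 (Fintype.mem_piFinset.1 hν i)).trans (le_of_eq ?_)
  simp

/-- An inverse approximation theorem: above degree `5 · 2^j` the coefficients of `v` are those of `v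
- u j`, so the block of frequencies of size `2^j` has weighted norm squared `O(2^(2(t - τ)j))`. The
factor `5` is the degree growth of a fivefold product. -/
lemma sobolevSummable_of_approx {v : Lp ℂ 2 arc} {u : ℕ → Lp ℂ 2 arc} {K t τ : ℝ} (ht0 : 0 ≤ t)
    (htτ : t < τ) (hu : ∀ (j : ℕ) (n : ℤ), 5 * (2 : ℝ) ^ j < |(n : ℝ)| → hat (u j) n = 0)
    (h : ∀ j, ‖v - u j‖ ≤ K * ((2 : ℝ) ^ (-τ)) ^ j) : SobolevSummable t (hat v) := by
  refine summable_of_tsum_ofReal_lt_top (fun n => by positivity) ?_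
  have hpt : ∀ n : ℤ, ENNReal.ofReal ((1 + |(n : ℝ)|) ^ (2 * t) * ‖hat v n‖ ^ 2) ≤
      (∑' j : ℕ, ENNReal.ofReal ((20 * (2 : ℝ) ^ j) ^ (2 * t) *
        ‖hat (v - u j : Lp ℂ 2 arc) n‖ ^ 2)) +
      (if n ∈ freq 5 then ENNReal.ofReal ((1 + |(n : ℝ)|) ^ (2 * t) * ‖hat v n‖ ^ 2) else 0) := by
    intro n
    split_ifs with hn
    · exact le_add_self
    · rw [add_zero]
      have hn5 : 6 ≤ n.natAbs := by
        rw [Finset.mem_Icc] at hn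
        push_cast at hn
        omega
      -- The largest `j` with `5 · 2^j < |n|`, the inequality being strict as in `hu`. It exists
      -- only for `|n| ≥ 6`, so frequencies up to `5` are treated separately.
      set j := Nat.log 2 ((n.natAbs - 1) / 5) with hj
      have h1 : 2 ^ j ≤ (n.natAbs - 1) / 5 := Nat.pow_log_le_self 2 (by omega)
      have h2 : (n.natAbs - 1) / 5 < 2 ^ (j + 1) := Nat.lt_pow_succ_log_self (by norm_num) _
      rw [pow_succ] at h2
      have h3 : 5 * 2 ^ j < n.natAbs := by omega
      have h4 : 1 + n.natAbs ≤ 20 * 2 ^ j := by omega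
      have habs : |(n : ℝ)| = (n.natAbs : ℝ) := by
        rw [← Int.cast_abs, Int.abs_eq_natAbs, Int.cast_natCast]
      have h5 : 5 * (2 : ℝ) ^ j < |(n : ℝ)| := by
        rw [habs]
        exact_mod_cast h3
      have h6 : 1 + |(n : ℝ)| ≤ 20 * (2 : ℝ) ^ j := by
        rw [habs]
        exact_mod_cast h4
      refine le_trans ?_ (ENNReal.le_tsum j)
      apply ENNReal.ofReal_le_ofReal
      have h7 : hat (v - u j : Lp ℂ 2 arc) n = hat v n := by
        rw [← inner_monoLp, inner_sub_right, inner_monoLp, inner_monoLp, hu j n h5, sub_zero]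
      rw [h7]
      gcongr
  refine (ENNReal.tsum_le_tsum hpt).trans_lt ?_
  rw [ENNReal.tsum_add, ENNReal.tsum_comm]
  refine ENNReal.add_lt_top.2 ⟨?_, ?_⟩
  · have h1 : ∀ j : ℕ, ∑' n : ℤ, ENNReal.ofReal ((20 * (2 : ℝ) ^ j) ^ (2 * t) *
        ‖hat (v - u j : Lp ℂ 2 arc) n‖ ^ 2) ≤
        ENNReal.ofReal (20 ^ (2 * t) * K ^ 2 * ((2 : ℝ) ^ (2 * (t - τ))) ^ j) := by
      intro j
      have hs := hasSum_sq_hat_Lp (v - u j)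
      rw [← ENNReal.ofReal_tsum_of_nonneg (fun n => by positivity) (hs.summable.mul_left _),
        tsum_mul_left, hs.tsum_eq]
      apply ENNReal.ofReal_le_ofReal
      refine (mul_le_mul_of_nonneg_left (pow_le_pow_left₀ (norm_nonneg _) (h j) 2)
        (by positivity)).trans (le_of_eq ?_)
      have e1 : ((2 : ℝ) ^ j) ^ (2 * t) * (((2 : ℝ) ^ (-τ)) ^ j) ^ 2 =
          ((2 : ℝ) ^ (2 * (t - τ))) ^ j := by
        rw [← pow_mul]
        simp only [← Real.rpow_natCast]
        rw [← Real.rpow_mul (by norm_num), ← Real.rpow_mul (by norm_num),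
          ← Real.rpow_mul (by norm_num), ← Real.rpow_add (by norm_num)]
        congr 1
        push_cast
        ring
      rw [← e1, Real.mul_rpow (by norm_num) (by positivity)]
      ring
    refine (ENNReal.tsum_le_tsum h1).trans_lt ?_
    have hlt : (2 : ℝ) ^ (2 * (t - τ)) < 1 :=
      Real.rpow_lt_one_of_one_lt_of_neg (by norm_num) (by linarith)
    exact ((summable_geometric_of_lt_one (by positivity) hlt).mul_left _).tsum_ofReal_lt_top
  · rw [tsum_eq_sum (s := freq 5) fun n hn => if_neg hn]
    refine ENNReal.sum_lt_top.2 fun n hn => ?_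
    rw [if_pos hn]
    exact ENNReal.ofReal_lt_top

/-! ### Convergence of the averages -/

lemma hat_trig (a : ℤ → ℂ) (N : ℕ) (n : ℤ) :
    hat (trig a N) n = if n ∈ freq N then a n else 0 := by
  have h : (∑ m ∈ freq N, a m • monoLp m : Lp ℂ 2 arc) =ᵐ[arc] trig a N :=
    coeFn_sum_smul_monoLp (freq N) a fun n => n
  rw [← hat_congr h, ← inner_monoLp, inner_sum]
  simp only [inner_smul_right, orthonormal_iff_ite.1 orthonormal_monoLp, mul_ite, mul_one, mul_zero]
  rw [Finset.sum_ite_eq]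

lemma SobolevBound.eLpNorm_le {s B M : ℝ} {a : ℤ → ℂ} {h : Circle → ℂ} (hB : SobolevBound s B a)
    (hB0 : 0 ≤ B) (hs : 0 ≤ s) (hM : 0 ≤ M) (hh : MemLp h 2 arc) (hc : ∀ n, ‖hat h n‖ ≤ ‖a n‖)
    (hcM : ∀ n : ℤ, hat h n ≠ 0 → M ≤ |(n : ℝ)|) :
    eLpNorm h 2 arc ≤ ENNReal.ofReal (B * (1 + M) ^ (-s)) := by
  have h1 := hasSum_sq_hat hh
  have h2 := h1.summable.tsum_le_of_sum_le (hB.sum_sq_le hs hM hc hcM)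
  rw [h1.tsum_eq] at h2
  rw [← ENNReal.ofReal_toReal hh.2.ne]
  exact ENNReal.ofReal_le_ofReal (le_of_sq_le_sq h2 (by positivity))

/-- Three errors are added: truncating `g` to degree `N`, replacing averaged multipliers by their
limits, and stopping the limit at degree `N`. Coupling `N` to `r` makes each a positive power of
`r`. -/
lemma exists_eLpNorm_convAvg_sub_lim_le {ε : ℝ} (h0 : 0 < ε) (h1 : ε ≤ 1) {s B : ℝ}
    (hs : ε / 2 ≤ s) (hB0 : 0 ≤ B) {g : Circle → ℂ} (hgm : Measurable g) (hg : MemLp g 2 arc)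
    (hB : SobolevBound s B (hat g)) {v : Lp ℂ 2 arc} {K τ : ℝ} (hτ : 0 < τ)
    (hv : ∀ J : ℕ, ‖v - limitSum (hat g) (2 ^ J)‖ ≤ K * ((2 : ℝ) ^ (-τ)) ^ J) :
    ∃ C β : ℝ, 0 < β ∧ ∀ r : ℝ, 0 < r → r ≤ 1 →
      eLpNorm (fun x : Circle => convAvg (fun _ => g) r x - v x) 2 arc ≤
        ENNReal.ofReal (C * r ^ β) := by
  obtain ⟨C₁, hC₁, hb₁⟩ := exists_eLpNorm_convAvg_sub_le (κ := ε / 320) (by positivity) (by linarith)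
  obtain ⟨C₂, hC₂, hb₂⟩ := exists_norm_fiveSum_sub_le
  have hs0 : 0 ≤ s := by linarith
  set β := min (ε / 640) (τ / 80) with hβ
  have hβ0 : 0 < β := by positivity
  have hβ1 : β ≤ ε / 640 := min_le_left _ _
  have hβ2 : β ≤ τ / 80 := min_le_right _ _
  refine ⟨2 * C₁ * B ^ 5 + C₂ * B ^ 5 + |K| * 2 ^ τ, β, hβ0, fun r hr hr1 => ?_⟩
  -- `N` is the power of two with `y/2 ≤ N ≤ y`. The tail `N^(-ε/2) ≲ r^(ε/160)` then absorbs the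
  -- loss `r^(-ε/320)`, while `r^(1/4) N^10 ≤ r^(1/8)` and `N^(-τ) ≲ r^(τ/80)`.
  set y : ℝ := r ^ (-(1 / 80) : ℝ) with hy
  have hy1 : 1 ≤ y := Real.one_le_rpow_of_pos_of_le_one_of_nonpos hr hr1 (by norm_num)
  have hy0 : 0 < y := by linarith
  set J := Nat.log 2 ⌊y⌋₊ with hJ
  have hfl : 1 ≤ ⌊y⌋₊ := Nat.le_floor (by simpa using hy1)
  have hJle : (2 : ℝ) ^ J ≤ y := by
    have : 2 ^ J ≤ ⌊y⌋₊ := Nat.pow_log_le_self 2 (by omega)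
    exact (by exact_mod_cast this : (2 : ℝ) ^ J ≤ ⌊y⌋₊).trans (Nat.floor_le hy0.le)
  have hJge : y ≤ 2 * (2 : ℝ) ^ J := by
    have : ⌊y⌋₊ + 1 ≤ 2 ^ (J + 1) := Nat.lt_pow_succ_log_self (by norm_num) _
    have h2 : (⌊y⌋₊ : ℝ) + 1 ≤ 2 ^ (J + 1) := by exact_mod_cast this
    rw [pow_succ] at h2
    linarith [Nat.lt_floor_add_one y]
  set N := 2 ^ J with hN
  have hNR : (N : ℝ) = 2 ^ J := by rw [hN]; push_cast; rfl
  have hN1 : 1 ≤ N := Nat.one_le_two_pow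
  set T := trig (hat g) N with hT
  have hTm : Measurable T := (continuous_trig _ _).measurable
  have hT2 : MemLp T 2 arc := memLp_of_continuous (continuous_trig _ _)
  have hyr : ∀ q : ℝ, y ^ q = r ^ (-(q / 80)) := fun q => by
    rw [hy, ← Real.rpow_mul hr.le]
    congr 1
    ring
  have hrβ : ∀ q : ℝ, β ≤ q → r ^ q ≤ r ^ β := fun q hq =>
    Real.rpow_le_rpow_of_exponent_ge hr hr1 hq
  have hg' : eLpNorm g 2 arc ≤ ENNReal.ofReal B := by
    simpa using hB.eLpNorm_le hB0 hs0 le_rfl hg (fun n => le_rfl) fun n _ => abs_nonneg _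
  have hT' : eLpNorm T 2 arc ≤ ENNReal.ofReal B := by
    rw [hT, eLpNorm_trig]
    exact ENNReal.ofReal_le_ofReal (hB.coeffNorm_le_self hB0 hs0 (fun n => le_rfl) N)
  have hhat : ∀ n, hat (g - T) n = if n ∈ freq N then 0 else hat g n := fun n => by
    have h2 : hat (g - T) n = hat g n - hat T n := hat_sub hg hT2 n
    rw [h2, hT, hat_trig]
    split_ifs <;> simp
  have htail : eLpNorm (g - T) 2 arc ≤ ENNReal.ofReal (B * (1 + N : ℝ) ^ (-s)) := by
    refine hB.eLpNorm_le hB0 hs0 (by positivity) (hg.sub hT2) (fun n => ?_) fun n hn => ?_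
    · rw [hhat]
      split_ifs <;> simp
    · by_contra! h2
      exact hn (by rw [hhat, if_pos (mem_freq.2 h2.le)])
  have p1 : eLpNorm (fun x : Circle => convAvg (fun _ => g) r x - convAvg (fun _ => T) r x) 2 arc ≤
      ENNReal.ofReal (2 * C₁ * B ^ 5 * r ^ β) := by
    refine (hb₁ g T hgm hTm hg hT2 _ hg' hT' r hr hr1).trans ?_
    refine (mul_le_mul_right (mul_le_mul_left htail _) _).trans ?_
    rw [← ENNReal.ofReal_pow hB0, ← ENNReal.ofReal_mul (by positivity),
      ← ENNReal.ofReal_mul (by positivity)]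
    apply ENNReal.ofReal_le_ofReal
    have g1 : (1 + N : ℝ) ^ (-s) ≤ 2 * r ^ (ε / 160) := by
      have e1 : (1 + N : ℝ) ^ (-s) ≤ (1 + N : ℝ) ^ (-(ε / 2)) :=
        Real.rpow_le_rpow_of_exponent_le (by linarith [(Nat.cast_nonneg N : (0 : ℝ) ≤ N)])
          (by linarith)
      have e2 : (1 + N : ℝ) ^ (-(ε / 2)) ≤ (y / 2) ^ (-(ε / 2)) :=
        Real.rpow_le_rpow_of_nonpos (by positivity) (by rw [hNR]; linarith) (by linarith)
      refine e1.trans (e2.trans ?_)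
      rw [Real.div_rpow hy0.le (by norm_num), hyr, Real.rpow_neg (by norm_num : (0 : ℝ) ≤ 2), div_inv_eq_mul,
        mul_comm]
      refine mul_le_mul (Real.rpow_le_self_of_one_le (by norm_num) (by linarith)) (le_of_eq ?_)
        (by positivity) (by norm_num)
      congr 1
      ring
    calc C₁ * r ^ (-(ε / 320)) * (B * (1 + N : ℝ) ^ (-s) * B ^ 4)
        ≤ C₁ * r ^ (-(ε / 320)) * (B * (2 * r ^ (ε / 160)) * B ^ 4) := by gcongr
      _ = 2 * C₁ * B ^ 5 * (r ^ (-(ε / 320)) * r ^ (ε / 160)) := by ring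
      _ ≤ 2 * C₁ * B ^ 5 * r ^ β := by
        refine mul_le_mul_of_nonneg_left ?_ (by positivity)
        rw [← Real.rpow_add hr]
        exact hrβ _ (by linarith)
  have p2 : eLpNorm (fun x : Circle => convAvg (fun _ => T) r x - limitSum (hat g) N x) 2 arc ≤
      ENNReal.ofReal (C₂ * B ^ 5 * r ^ β) := by
    have h2 := hb₂ (fun _ => hat g) N hN1 r hr
    set W := fiveSum (fun ν => normConst * convAvg (fun i z => (z : ℂ) ^ ν i) r 1)
      (fun _ => hat g) N with hW
    have h3 : (fun x : Circle => convAvg (fun _ => T) r x - limitSum (hat g) N x) =ᵐ[arc]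
        (W - limitSum (hat g) N : Lp ℂ 2 arc) := by
      filter_upwards [Lp.coeFn_sub W (limitSum (hat g) N),
        coeFn_fiveSum_convAvg (fun _ => hat g) N hr] with x hx1 hx2
      rw [hx1, Pi.sub_apply, hW, hx2]
    rw [eLpNorm_congr_ae h3, ← ENNReal.ofReal_toReal (Lp.eLpNorm_ne_top _), ← Lp.norm_def]
    refine ENNReal.ofReal_le_ofReal (h2.trans ?_)
    have g1 : ∏ _i : Fin 5, coeffNorm (hat g) N ≤ B ^ 5 := by
      rw [Finset.prod_const, Finset.card_univ, Fintype.card_fin]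
      exact pow_le_pow_left₀ (coeffNorm_nonneg _ _)
        (hB.coeffNorm_le_self hB0 hs0 (fun n => le_rfl) N) 5
    have g2 : (N : ℝ) ^ 10 ≤ r ^ (-(1 / 8) : ℝ) := by
      rw [hNR]
      refine (pow_le_pow_left₀ (by positivity) hJle 10).trans (le_of_eq ?_)
      rw [← Real.rpow_natCast, hyr]
      norm_num
    calc C₂ * (r ^ (1 / 4 : ℝ) * (N : ℝ) ^ 10) * ∏ _i : Fin 5, coeffNorm (hat g) N
        ≤ C₂ * (r ^ (1 / 4 : ℝ) * r ^ (-(1 / 8) : ℝ)) * B ^ 5 := by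
          gcongr
          exact Finset.prod_nonneg fun _ _ => coeffNorm_nonneg _ _
      _ = C₂ * B ^ 5 * r ^ (1 / 8 : ℝ) := by
          rw [← Real.rpow_add hr]
          norm_num
          ring
      _ ≤ C₂ * B ^ 5 * r ^ β :=
          mul_le_mul_of_nonneg_left (hrβ _ (by linarith)) (by positivity)
  have p3 : eLpNorm (fun x : Circle => limitSum (hat g) N x - v x) 2 arc ≤
      ENNReal.ofReal (|K| * 2 ^ τ * r ^ β) := by
    have h3 : (fun x : Circle => limitSum (hat g) N x - v x) =ᵐ[arc]
        (limitSum (hat g) N - v : Lp ℂ 2 arc) := (Lp.coeFn_sub _ _).symm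
    rw [eLpNorm_congr_ae h3, ← ENNReal.ofReal_toReal (Lp.eLpNorm_ne_top _), ← Lp.norm_def,
      norm_sub_rev]
    refine ENNReal.ofReal_le_ofReal ((hv J).trans ?_)
    have g1 : ((2 : ℝ) ^ (-τ)) ^ J ≤ 2 ^ τ * r ^ β := by
      have e1 : ((2 : ℝ) ^ (-τ)) ^ J = ((2 : ℝ) ^ J) ^ (-τ) := by
        rw [← Real.rpow_natCast, ← Real.rpow_natCast, ← Real.rpow_mul (by norm_num),
          ← Real.rpow_mul (by norm_num), mul_comm]
      have e2 : ((2 : ℝ) ^ J) ^ (-τ) ≤ (y / 2) ^ (-τ) :=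
        Real.rpow_le_rpow_of_nonpos (by positivity) (by linarith) (by linarith)
      rw [e1]
      refine e2.trans ?_
      rw [Real.div_rpow hy0.le (by norm_num), hyr, Real.rpow_neg (by norm_num : (0 : ℝ) ≤ 2), div_inv_eq_mul,
        mul_comm]
      refine mul_le_mul_of_nonneg_left (hrβ _ ?_) (by positivity)
      linarith
    calc K * ((2 : ℝ) ^ (-τ)) ^ J ≤ |K| * (2 ^ τ * r ^ β) :=
          mul_le_mul (le_abs_self K) g1 (by positivity) (abs_nonneg K)
      _ = _ := by ring
  have m1 := aestronglyMeasurable_convAvg (f := fun _ => g) (fun _ => hgm) hr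
  have m2 := aestronglyMeasurable_convAvg (f := fun _ => T) (fun _ => hTm) hr
  have m3 := Lp.aestronglyMeasurable (limitSum (hat g) N)
  have m4 := Lp.aestronglyMeasurable v
  have hsplit : (fun x : Circle => convAvg (fun _ => g) r x - v x) =
      ((fun x : Circle => convAvg (fun _ => g) r x - convAvg (fun _ => T) r x) +
        fun x : Circle => convAvg (fun _ => T) r x - limitSum (hat g) N x) +
        fun x : Circle => limitSum (hat g) N x - v x := by
    funext x
    simp only [Pi.add_apply]
    ring
  rw [hsplit]
  refine (eLpNorm_add_le ((m1.sub m2).add (m2.sub m3)) (m3.sub m4) (by norm_num)).trans ?_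
  refine (add_le_add ((eLpNorm_add_le (m1.sub m2) (m2.sub m3) (by norm_num)).trans
    (add_le_add p1 p2)) p3).trans (le_of_eq ?_)
  rw [← ENNReal.ofReal_add (by positivity) (by positivity),
    ← ENNReal.ofReal_add (by positivity) (by positivity)]
  congr 1
  ring

/-- The dyadic truncations are Cauchy in `L²` at the geometric rate `2^(-(s + ε/640))`. The same
rate identifies their limit with the limit of the averages and gives its regularity. -/
lemma exists_restriction {ε : ℝ} (h0 : 0 < ε) (h1 : ε ≤ 1) {s : ℝ} (hs : ε / 2 ≤ s)
    {f : Circle → ℂ} (hf : MemLp f 2 arc) (hsum : SobolevSummable s (hat f)) :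
    ∃ F : Circle → ℂ, IsCircleRestriction (conv5 f) F ∧
      ∀ t : ℝ, 0 ≤ t → t < s + ε / 640 → SobolevSummable t (hat F) := by
  obtain ⟨g, hgm, hfg⟩ := hf.1
  have hg : MemLp g 2 arc := hf.ae_eq hfg
  rw [hat_congr hfg] at hsum
  obtain ⟨B, hB0, hB⟩ := hsum.exists_bound
  obtain ⟨K, hK⟩ := exists_norm_limitSum_succ_sub_le h0 h1 hs hB0 hB
  set τ := s + ε / 640 with hτ
  have hτ0 : 0 < τ := by linarith
  have hρ : (2 : ℝ) ^ (-τ) < 1 := Real.rpow_lt_one_of_one_lt_of_neg (by norm_num) (by linarith)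
  have hd : ∀ J : ℕ, dist (limitSum (hat g) (2 ^ J)) (limitSum (hat g) (2 ^ (J + 1))) ≤
      K * ((2 : ℝ) ^ (-τ)) ^ J := fun J => by
    rw [dist_eq_norm, norm_sub_rev]
    exact hK J
  obtain ⟨v, hv⟩ := cauchySeq_tendsto_of_complete (cauchySeq_of_le_geometric _ _ hρ hd)
  have hv2 : ∀ J : ℕ, ‖v - limitSum (hat g) (2 ^ J)‖ ≤
      K / (1 - (2 : ℝ) ^ (-τ)) * ((2 : ℝ) ^ (-τ)) ^ J := fun J => by
    rw [← dist_eq_norm, dist_comm, div_mul_eq_mul_div]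
    exact dist_le_of_le_geometric_of_tendsto _ _ hρ hd hv J
  refine ⟨v, ⟨Lp.memLp v, ?_⟩, fun t ht htτ => ?_⟩
  · obtain ⟨C, β, hβ, hb⟩ := exists_eLpNorm_convAvg_sub_lim_le h0 h1 hs hB0 hgm.measurable hg hB
      hτ0 hv2
    have hlim : Tendsto (fun r : ℝ => ENNReal.ofReal (C * r ^ β)) (𝓝[>] 0) (𝓝 0) := by
      have h2 : Tendsto (fun r : ℝ => ENNReal.ofReal (C * r ^ β)) (𝓝 0)
          (𝓝 (ENNReal.ofReal (C * 0 ^ β))) :=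
        ENNReal.tendsto_ofReal
          ((Real.continuousAt_rpow_const 0 β (Or.inr hβ.le)).tendsto.const_mul C)
      rw [Real.zero_rpow hβ.ne', mul_zero, ENNReal.ofReal_zero] at h2
      exact h2.mono_left nhdsWithin_le_nhds
    refine tendsto_of_tendsto_of_tendsto_of_le_of_le' tendsto_const_nhds hlim
      (.of_forall fun r => zero_le) ?_
    filter_upwards [Ioc_mem_nhdsGT (zero_lt_one (α := ℝ))] with r hr
    refine le_of_eq_of_le ?_ (hb r hr.1 hr.2)
    congr 1
    funext x
    rw [conv5_ball_div hf hfg]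
  · refine sobolevSummable_of_approx ht htτ (fun J n hn => ?_) hv2
    exact hat_fiveSum_eq_zero _ _ (by push_cast; exact hn)

end CircleConv

/-! ### Conclusion: from Sobolev weights back to the spaces `𝓗^s`. -/

theorem lemma5 (ε : ℝ) (hε : 0 < ε) :
    ∃ δ : ℝ, 0 < δ ∧
      ∀ s : ℝ, ε ≤ s → s ∉ Set.range ((↑) : ℤ → ℝ) →
        ∀ f : Circle → ℂ, CircleConv.MemH s f →
          ∃ F : Circle → ℂ, CircleConv.IsCircleRestriction (CircleConv.conv5 f) F ∧
            ∀ t : ℝ, 0 ≤ t → t ≤ s + δ → t ∉ Set.range ((↑) : ℤ → ℝ) →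
              CircleConv.MemH t F := by
  set η := min ε 1 with hη
  have hη0 : 0 < η := by positivity
  have hη1 : η ≤ 1 := min_le_right _ _
  have hηε : η ≤ ε := min_le_left _ _
  -- The Sobolev exponent is lowered to `s - η/2560`, still at least `η/2`. The gain `η/640` then
  -- reaches every `t < s + 3η/2560`, which includes `s + η/1280`.
  refine ⟨η / 1280, by positivity, fun s hs _ f hf => ?_⟩
  have hmem : MemLp f 2 CircleConv.arc := by
    obtain ⟨D, hD, h, -⟩ := hf
    rw [← hD]
    exact h 0 (Nat.zero_le _)
  obtain ⟨F, hF, hreg⟩ := CircleConv.exists_restriction hη0 hη1 (s := s - η / 2560) (by linarith)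
    hmem (hf.sobolevSummable (by linarith) (by linarith))
  exact ⟨F, hF, fun t ht htδ _ =>
    CircleConv.memH_of_sobolevSummable ht hF.1 (hreg t ht (by linarith))⟩
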